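/- Let $k \ge 1$ be an integer, $q = e^{\pi i/(k+2)}$, $[i] = \frac{q^i - q^{-i}}{q - q^{-1}}$ and $\delta = -[2]$. Consider the $\mathbb{C}$-linear monoidal category with object set $\mathbb{N}$ in which $\mathrm{Hom}(m,n)$ has as basis the isotopy classes of planar diagrams without loops, with $m$ dots at the bottom and $n$ dots at the top joined in pairs by non-crossing lines; composition is vertical stacking, where every closed loop is replaced by the factor $\delta$, and the tensor product is horizontal juxtaposition. Let $TL$ be its additive and idempotent completion, with the induced monoidal structure. For $0 \le i \le k+1$ let $f_i : i \to i$ be the Jones–Wenzl projections, defined by $f_0 = 1_0$, $f_1 = 1_1$ and $$f_i = f_{i-1}\otimes 1_1 + \tfrac{[i-1]}{[i]}\,(f_{i-1}\otimes 1_1)\circ U_{i-1}\circ (f_{i-1}\otimes 1_1) \qquad (2 \le i \le k+1),$$ where $U_{i-1} : i \to i$ is the cap-cup diagram on the last two of the $i$ strands, and let $F_i = (i, f_i) \in TL$. Let $\widetilde{TL} = TL/(F_{k+1})$ be the quotient of $TL$ by the ideal of morphisms generated by (the identity of) $F_{k+1}$, i.e. the smallest class of morphisms containing it and closed under sums, under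 composition with arbitrary morphisms on either side and under tensoring with arbitrary objects on either side. Let $\Sigma = \bigoplus_{i=0}^{k} F_i \in \widetilde{TL}$, with the algebra structure whose unit $u : \mathbb{1} = F_0 \hookrightarrow \Sigma$ is the inclusion and whose multiplication $m : \Sigma\otimes\Sigma \to \Sigma$ is the sum of the maps $f_{i+j}\circ(f_i\otimes f_j) : F_i \otimes F_j \to F_{i+j} \hookrightarrow \Sigma$ over all $0\le i, j \le k$ with $i + j \le k$ (and is zero on $F_i\otimes F_j$ if $i+j>k$). A Frobenius structure on an algebra $(A,u,m)$ with a left dual $A^\vee$ and coevaluation $c : \mathbb{1} \to A \otimes A^\vee$ in a monoidal category is a pair $(W, n)$ of an object $W$ and a morphism $n : A \to W$ such that $$A \xrightarrow{1_A\otimes c} A\otimes A\otimes A^\vee \xrightarrow{(n\circ m)\otimes 1_{A^\vee}} W\otimes A^\vee$$ is an isomorphism; it is called classical if $W = \mathbb{1}$. Then $\Sigma$ admits no classical Frobenius structure. Moreover, every morphism $n : \Sigma \to \mathbb{1}$ in $\widetilde{TL}$ vanishes on the summands $F_i$ with $0 < i \le k$. -/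

import Mathlib

set_option linter.unusedSectionVars false
set_option linter.unusedVariables false
set_option linter.style.longLine false

namespace TemperleyLieb

/-- Position of a dot on the boundary of the rectangle, read counterclockwise from the bottom left
corner: the `m` bottom dots from left to right, then the `n` top dots from right to left. -/
def pos {m n : ℕ} : Fin m ⊕ Fin n → ℕ
  | Sum.inl i => i
  | Sum.inr j => m + (n - 1 - j)

/-- A planar diagram `m → n` without loops, up to isotopy: `m` bottom dots and `n` top dots,
joined in pairs by non-crossing lines. `rel x y` says that `x` and `y` lie on the same line. -/
@[ext] structure Diagram (m n : ℕ) where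
  rel : Setoid (Fin m ⊕ Fin n)
  pair : ∀ x, ∃! y, y ≠ x ∧ rel x y
  planar : ∀ a b c d, pos a < pos b → pos b < pos c → pos c < pos d → rel a c → ¬ rel b d

/-! ### Labelings -/

/-- A labeling is compatible with a setoid if it is constant on classes. -/
def Compat {X : Type} (s : Setoid X) (l : X → Bool) : Prop := ∀ x y, s x y → l x = l y

theorem setoid_eq_of_compat {X : Type} {s t : Setoid X} (h : ∀ l, Compat s l ↔ Compat t l) :
    s = t := by
  classical
  have key : ∀ {s t : Setoid X}, (∀ l, Compat t l → Compat s l) → ∀ x y, s x y → t x y := by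
    intro s t h x y hxy
    have h1 : Compat t (fun z => decide (t x z)) := by
      intro u v huv
      simp only [decide_eq_decide]
      exact ⟨fun h => t.trans h huv, fun h => t.trans h (t.symm huv)⟩
    have h2 := h _ h1 x y hxy
    simp only [decide_eq_decide] at h2
    exact h2.1 (t.refl x)
  ext x y
  exact ⟨key (fun l => (h l).2) x y, key (fun l => (h l).1) x y⟩

theorem card_compat {X T : Type} [Finite T] (S : Setoid T) (o : X → T) (l : X → Bool) [Decidable (Compat (S.comap o) l)] :
    Nat.card {L : T → Bool // Compat S L ∧ L ∘ o = l} =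
      if Compat (S.comap o) l then
        2 ^ Nat.card {c : Quotient S // ∀ x, c ≠ Quotient.mk S (o x)} else 0 := by
  classical
  have := Fintype.ofFinite T
  split_ifs with hl
  · have hex : ∀ c : Quotient S, ∃ b : Bool, ∀ x, c = Quotient.mk S (o x) → b = l x := by
      intro c
      by_cases hc : ∃ x, c = Quotient.mk S (o x)
      · obtain ⟨x, rfl⟩ := hc
        exact ⟨l x, fun y hy => hl x y (Quotient.exact (s := S) hy)⟩
      · exact ⟨true, fun x hx => (hc ⟨x, hx⟩).elim⟩
    choose b hb using hex
    have e : {L : T → Bool // Compat S L ∧ L ∘ o = l} ≃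
        ({c : Quotient S // ∀ x, c ≠ Quotient.mk S (o x)} → Bool) :=
      { toFun := fun L c => Quotient.lift L.1 (fun x y h => L.2.1 x y h) c.1
        invFun := fun M => ⟨fun t => if h : ∀ x, Quotient.mk S t ≠ Quotient.mk S (o x) then
            M ⟨Quotient.mk S t, h⟩ else b (Quotient.mk S t), by
            intro x y h
            have : Quotient.mk S x = Quotient.mk S y := Quotient.sound h
            simp only [this], by
            funext x
            have : ¬ ∀ y, Quotient.mk S (o x) ≠ Quotient.mk S (o y) := fun h => h x rfl
            simp only [Function.comp, dif_neg this]
            exact hb _ x rfl⟩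
        left_inv := by
          rintro ⟨L, hL, hLo⟩
          apply Subtype.ext
          funext t
          simp only
          split_ifs with h
          · rfl
          · push Not at h
            obtain ⟨x, hx⟩ := h
            rw [hb _ x hx, ← hLo]
            exact hL _ _ (S.symm (Quotient.exact hx))
        right_inv := by
          intro M
          funext ⟨c, hc⟩
          induction c using Quotient.ind with | _ t => ?_
          simp only [Quotient.lift_mk]
          rw [dif_pos hc] }
    rw [Nat.card_congr e, Nat.card_fun]
    simp
  · have : IsEmpty {L : T → Bool // Compat S L ∧ L ∘ o = l} := by
      constructor
      rintro ⟨L, hL, rfl⟩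
      exact hl fun x y h => hL _ _ h
    simp

namespace Diagram
variable {m n p r : ℕ}

/-! ### Stacking -/

/-- The lower diagram inside the stack of two diagrams. -/
def lo : Fin m ⊕ Fin n → Fin m ⊕ (Fin n ⊕ Fin p) := Sum.map id Sum.inl

/-- The upper diagram inside the stack of two diagrams. -/
def hi : Fin n ⊕ Fin p → Fin m ⊕ (Fin n ⊕ Fin p) := Sum.inr

/-- The outer dots of the stack of two diagrams. -/
def outer : Fin m ⊕ Fin p → Fin m ⊕ (Fin n ⊕ Fin p) := Sum.map id Sum.inr

/-- Stack `g` on top of `f`: two of the dots are related if they lie on the same component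
of the stacked picture. -/
def glue (f : Diagram m n) (g : Diagram n p) : Setoid (Fin m ⊕ (Fin n ⊕ Fin p)) :=
  Relation.EqvGen.setoid fun x y =>
    (∃ a b, f.rel a b ∧ x = lo a ∧ y = lo b) ∨ (∃ a b, g.rel a b ∧ x = hi a ∧ y = hi b)

/-- The number of loops created by stacking: the components of the stacked picture
that contain no outer dot. -/
noncomputable def loops (f : Diagram m n) (g : Diagram n p) : ℕ :=
  Nat.card {c : Quotient (glue f g) // ∀ x, c ≠ Quotient.mk (glue f g) (outer x)}

theorem glue_lo {f : Diagram m n} {g : Diagram n p} {a b} (h : f.rel a b) :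
    glue f g (lo a) (lo b) := Relation.EqvGen.rel _ _ (Or.inl ⟨a, b, h, rfl, rfl⟩)

theorem glue_hi {f : Diagram m n} {g : Diagram n p} {a b} (h : g.rel a b) :
    glue f g (hi a) (hi b) := Relation.EqvGen.rel _ _ (Or.inr ⟨a, b, h, rfl, rfl⟩)

/-- A property transported along both kinds of lines is transported along components. -/
theorem glue_induction {f : Diagram m n} {g : Diagram n p} {P : Fin m ⊕ (Fin n ⊕ Fin p) → Prop}
    (h1 : ∀ a b, f.rel a b → P (lo a) → P (lo b)) (h2 : ∀ a b, g.rel a b → P (hi a) → P (hi b))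
    {x y} (h : glue f g x y) : P x ↔ P y := by
  have h' : Relation.EqvGen (fun x y => (∃ a b, f.rel a b ∧ x = lo a ∧ y = lo b) ∨
    (∃ a b, g.rel a b ∧ x = hi a ∧ y = hi b)) x y := h
  clear h
  induction h' with
  | rel x y h =>
    rcases h with ⟨a, b, h, rfl, rfl⟩ | ⟨a, b, h, rfl, rfl⟩
    · exact ⟨h1 _ _ h, h1 _ _ (f.rel.symm h)⟩
    · exact ⟨h2 _ _ h, h2 _ _ (g.rel.symm h)⟩
  | refl => exact Iff.rfl
  | symm x y h ih => exact ih.symm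
  | trans x y z h1 h2 ih1 ih2 => exact ih1.trans ih2

theorem compat_glue {f : Diagram m n} {g : Diagram n p} {L : Fin m ⊕ (Fin n ⊕ Fin p) → Bool} :
    Compat (glue f g) L ↔ Compat f.rel (L ∘ lo) ∧ Compat g.rel (L ∘ hi) := by
  constructor
  · intro h
    exact ⟨fun a b hab => h _ _ (glue_lo hab), fun a b hab => h _ _ (glue_hi hab)⟩
  · rintro ⟨h1, h2⟩ x y hxy
    exact (glue_induction (P := fun z => L x = L z) (fun a b hab h => h.trans (h1 a b hab))
      (fun a b hab h => h.trans (h2 a b hab)) hxy).1 rfl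

/-- The matrix of a relation on dots, indexed by labelings of the bottom and top dots. -/
noncomputable def relMat (s : Setoid (Fin m ⊕ Fin n)) :
    Matrix (Fin m → Bool) (Fin n → Bool) ℕ :=
  open Classical in fun a b => if Compat s (Sum.elim a b) then 1 else 0

theorem relMat_injective {s t : Setoid (Fin m ⊕ Fin n)} (h : relMat s = relMat t) : s = t := by
  apply setoid_eq_of_compat
  intro l
  have := congrFun (congrFun h (l ∘ Sum.inl)) (l ∘ Sum.inr)
  simp only [relMat, Sum.elim_comp_inl_inr] at this
  split_ifs at this <;> simp_all

theorem relMat_mul (f : Diagram m n) (g : Diagram n p) :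
    relMat f.rel * relMat g.rel = 2 ^ loops f g • relMat ((glue f g).comap outer) := by
  classical
  ext a c
  have := card_compat (glue f g) outer (Sum.elim a c)
  simp only [Matrix.mul_apply, relMat, Matrix.smul_apply, smul_eq_mul, mul_ite, mul_one, mul_zero]
  simp only [loops, ← this, ← ite_and, Finset.sum_boole, Nat.cast_id]
  rw [← Fintype.card_subtype, ← Nat.card_eq_fintype_card]
  refine Nat.card_congr
    { toFun := fun b => ⟨Sum.elim a (Sum.elim b.1 c), compat_glue.2 ⟨?_, ?_⟩, ?_⟩
      invFun := fun L => ⟨fun i => L.1 (Sum.inr (Sum.inl i)), ?_⟩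
      left_inv := ?_
      right_inv := ?_ }
  · convert b.2.2 using 1
    funext x; rcases x with x | x <;> rfl
  · exact b.2.1
  · funext x; rcases x with x | x <;> rfl
  · obtain ⟨L, hL, hLo⟩ := L
    rw [compat_glue] at hL
    have ha : ∀ i, L (Sum.inl i) = a i := fun i => congrFun hLo (Sum.inl i)
    have hc : ∀ i, L (Sum.inr (Sum.inr i)) = c i := fun i => congrFun hLo (Sum.inr i)
    refine ⟨?_, ?_⟩
    · convert hL.2 using 1
      funext x; rcases x with x | x
      · rfl
      · exact (hc x).symm
    · convert hL.1 using 1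
      funext x; rcases x with x | x
      · exact (ha x).symm
      · rfl
  · intro b; rfl
  · rintro ⟨L, hL, hLo⟩
    apply Subtype.ext
    have ha : ∀ i, L (Sum.inl i) = a i := fun i => congrFun hLo (Sum.inl i)
    have hc : ∀ i, L (Sum.inr (Sum.inr i)) = c i := fun i => congrFun hLo (Sum.inr i)
    funext x; rcases x with x | x | x
    · exact (ha x).symm
    · rfl
    · exact (hc x).symm

theorem relMat_smul_cancel {a b : ℕ} {s t : Setoid (Fin m ⊕ Fin n)}
    (h : 2 ^ a • relMat s = 2 ^ b • relMat t) : a = b ∧ s = t := by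
  have h1 := congrFun (congrFun h (fun _ => true)) (fun _ => true)
  have hc : ∀ s : Setoid (Fin m ⊕ Fin n),
      Compat s (Sum.elim (fun _ => true) (fun _ => true)) := by
    intro s x y _; rcases x with x | x <;> rcases y with y | y <;> rfl
  simp only [relMat, Matrix.smul_apply, hc, if_true, smul_eq_mul, mul_one] at h1
  have h2 := Nat.pow_right_injective le_rfl h1
  subst h2
  refine ⟨rfl, relMat_injective ?_⟩
  ext x y
  have := congrFun (congrFun h x) y
  simpa using this

end Diagram
namespace Diagram
variable {m n p r : ℕ}

/-! ### The stack of two diagrams is a diagram -/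

theorem pos_injective : Function.Injective (pos : Fin m ⊕ Fin n → ℕ) := by
  rintro (x | x) (y | y) h <;> simp only [pos] at h <;> congr 1 <;> (try apply Fin.ext) <;> omega

/-- The other end of the line through a dot. -/
noncomputable def partner (f : Diagram m n) (x : Fin m ⊕ Fin n) : Fin m ⊕ Fin n :=
  (f.pair x).choose

theorem partner_ne (f : Diagram m n) (x) : f.partner x ≠ x := (f.pair x).choose_spec.1.1

theorem rel_partner (f : Diagram m n) (x) : f.rel x (f.partner x) := (f.pair x).choose_spec.1.2

theorem eq_partner {f : Diagram m n} {x y} (h : f.rel x y) (hne : y ≠ x) : y = f.partner x :=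
  (f.pair x).choose_spec.2 y ⟨hne, h⟩

theorem partner_partner (f : Diagram m n) (x) : f.partner (f.partner x) = x :=
  (eq_partner (f.rel.symm (f.rel_partner x)) (f.partner_ne x).symm).symm

/-- The indicator of a proposition, modulo two. -/
noncomputable def ind (P : Prop) : ZMod 2 := open Classical in if P then 1 else 0

theorem ind_pos {P : Prop} (h : P) : ind P = 1 := if_pos h

theorem ind_neg {P : Prop} (h : ¬ P) : ind P = 0 := if_neg h

theorem sum_saturated (f : Diagram m n) (S : Fin m ⊕ Fin n → Prop)
    (hS : ∀ x, S x → S (f.partner x)) : ∑ x, ind (S x) = 0 := by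
  classical
  unfold ind
  rw [← Finset.sum_filter]
  refine Finset.sum_involution (fun x _ => f.partner x) ?_ ?_ ?_ ?_
  · intros; decide
  · intro a _ _; exact f.partner_ne a
  · intro a ha; simpa using hS a (by simpa using ha)
  · intro a _; exact f.partner_partner a

/-- Parity of the number of marked dots to the left of a dot. -/
noncomputable def row {n : ℕ} (S : Fin n → Prop) (i : Fin n) : ZMod 2 :=
  ∑ j, ind (S j ∧ j < i)

/-- Parity of the number of marked dots in the same row to the left of a dot. -/
noncomputable def lev (S : Fin m ⊕ Fin n → Prop) : Fin m ⊕ Fin n → ZMod 2 :=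
  Sum.elim (row (fun i => S (Sum.inl i))) (row (fun i => S (Sum.inr i)))

theorem lev_eq (S : Fin m ⊕ Fin n → Prop) (h0 : ∑ x, ind (S x) = 0)
    (x) (hx : ¬ S x) : lev S x = ∑ y, ind (S y ∧ pos y < pos x) := by
  rcases x with i | j
  · rw [Fintype.sum_sum_type]
    simp only [lev, Sum.elim_inl, row, pos]
    rw [Finset.sum_eq_zero (s := (Finset.univ : Finset (Fin n)))]
    · rw [add_zero]; rfl
    · intro j _
      refine ind_neg ?_; rintro ⟨-, h⟩; omega
  · rw [Fintype.sum_sum_type] at h0 ⊢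
    simp only [lev, Sum.elim_inr, row, pos]
    have e1 : ∀ i : Fin m, ind (S (Sum.inl i) ∧ (i : ℕ) < m + (n - 1 - j)) = ind (S (Sum.inl i)) := by
      intro i
      have : (i : ℕ) < m + (n - 1 - j) := by omega
      simp [this]
    rw [Finset.sum_congr rfl (fun i _ => e1 i)]
    have e2 : ∀ i : Fin n, ind (S (Sum.inr i)) = ind (S (Sum.inr i) ∧ i < j) +
        ind (S (Sum.inr i) ∧ m + (n - 1 - i) < m + (n - 1 - j)) := by
      intro i
      by_cases hS : S (Sum.inr i)
      · rcases lt_trichotomy i j with h | h | h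
        · rw [ind_pos hS, ind_pos ⟨hS, h⟩, ind_neg (by omega), add_zero]
        · subst h; exact (hx hS).elim
        · rw [ind_pos hS, ind_neg (by omega), ind_pos ⟨hS, by omega⟩, zero_add]
      · rw [ind_neg hS, ind_neg (fun h => hS h.1), ind_neg (fun h => hS h.1), zero_add]
    rw [Finset.sum_congr rfl (fun i _ => e2 i), Finset.sum_add_distrib] at h0
    have e3 : ∀ a b c : ZMod 2, a + (b + c) = 0 → b = a + c := by decide
    exact e3 _ _ _ h0

theorem lev_congr (f : Diagram m n) (S : Fin m ⊕ Fin n → Prop) (hS : ∀ x y, f.rel x y → S x → S y)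
    {x y} (h : f.rel x y) (hx : ¬ S x) : lev S x = lev S y := by
  classical
  wlog hlt : pos x < pos y generalizing x y
  · rcases Nat.lt_or_ge (pos y) (pos x) with h' | h'
    · exact (this (f.rel.symm h) (fun h2 => hx (hS _ _ (f.rel.symm h) h2)) h').symm
    · rw [pos_injective (le_antisymm h' (not_lt.1 hlt))]
  have hS' : ∀ x, S x → S (f.partner x) := fun x => hS _ _ (f.rel_partner x)
  have hy : ¬ S y := fun h2 => hx (hS _ _ (f.rel.symm h) h2)
  rw [lev_eq S (f.sum_saturated S hS') x hx, lev_eq S (f.sum_saturated S hS') y hy]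
  have e : ∀ z, ind (S z ∧ pos z < pos y) =
      ind (S z ∧ pos z < pos x) + ind (S z ∧ pos x < pos z ∧ pos z < pos y) := by
    intro z
    by_cases hz : S z
    · rcases lt_trichotomy (pos z) (pos x) with h1 | h1 | h1
      · rw [ind_pos ⟨hz, h1.trans hlt⟩, ind_pos ⟨hz, h1⟩, ind_neg (by omega), add_zero]
      · rw [pos_injective h1] at hz; exact (hx hz).elim
      · rw [ind_neg (P := _ ∧ pos z < pos x) (by omega), zero_add]
        simp [h1]
    · rw [ind_neg (fun h => hz h.1), ind_neg (fun h => hz h.1), ind_neg (fun h => hz h.1), zero_add]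
  rw [Finset.sum_congr rfl (fun z _ => e z), Finset.sum_add_distrib]
  have : ∑ z, ind (S z ∧ pos x < pos z ∧ pos z < pos y) = 0 := by
    refine sum_saturated f (fun z => S z ∧ pos x < pos z ∧ pos z < pos y) ?_
    rintro z ⟨hz, h1, h2⟩
    have hz' := hS' z hz
    have hr := f.rel_partner z
    refine ⟨hz', ?_, ?_⟩
    · rcases lt_trichotomy (pos x) (pos (f.partner z)) with h3 | h3 | h3
      · exact h3
      · rw [← pos_injective h3] at hz'; exact (hx hz').elim
      · exact (f.planar _ _ _ _ h3 h1 h2 (f.rel.symm hr) h).elim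
    · rcases lt_trichotomy (pos (f.partner z)) (pos y) with h3 | h3 | h3
      · exact h3
      · rw [pos_injective h3] at hz'; exact (hy hz').elim
      · exact (f.planar _ _ _ _ h1 h2 h3 h hr).elim
  rw [this, add_zero]

/-- A component of the stacked picture has an even number of outer dots. -/
theorem sum_outer (f : Diagram m n) (g : Diagram n p) (K : Fin m ⊕ (Fin n ⊕ Fin p) → Prop)
    (hK : ∀ s t, glue f g s t → K s → K t) : ∑ x, ind (K (outer x)) = 0 := by
  have h1 := f.sum_saturated (fun x => K (lo x)) (fun x h => hK _ _ (glue_lo (f.rel_partner x)) h)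
  have h2 := g.sum_saturated (fun x => K (hi x)) (fun x h => hK _ _ (glue_hi (g.rel_partner x)) h)
  rw [Fintype.sum_sum_type] at h1 h2 ⊢
  have e : ∀ a b c : ZMod 2, a + b = 0 → b + c = 0 → a + c = 0 := by decide
  exact e _ _ _ h1 h2

theorem card_le_two_of_degree {V : Type} [Fintype V] [DecidableEq V] (G : SimpleGraph V)
    [DecidableRel G.Adj] (hG : G.Connected) (O : V → Prop) [DecidablePred O]
    (h : ∀ u, G.degree u + (if O u then 1 else 0) ≤ 2) : (Finset.univ.filter O).card ≤ 2 := by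
  have hsum := Finset.sum_le_sum (s := Finset.univ) (fun u _ => h u)
  rw [Finset.sum_add_distrib, G.sum_degrees_eq_twice_card_edges] at hsum
  have hE := hG.card_vert_le_card_edgeSet_add_one
  rw [Nat.card_eq_fintype_card, Nat.card_eq_fintype_card, ← SimpleGraph.edgeFinset_card] at hE
  simp only [Finset.sum_const, Finset.card_univ, smul_eq_mul, Finset.sum_boole, Nat.cast_id] at hsum
  have h2 : (Finset.univ.filter fun x => O x).card ≤ 2 := by omega
  exact h2

/-- A component of the stacked picture has at most two outer dots. -/
theorem outer_le_two (f : Diagram m n) (g : Diagram n p) {x y z : Fin m ⊕ Fin p}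
    (hy : glue f g (outer x) (outer y)) (hz : glue f g (outer x) (outer z))
    (hxy : x ≠ y) (hxz : x ≠ z) (hyz : y ≠ z) : False := by
  classical
  let V := {t // glue f g (outer x) t}
  let R : Fin m ⊕ (Fin n ⊕ Fin p) → Fin m ⊕ (Fin n ⊕ Fin p) → Prop := fun s t =>
    (∃ a b, f.rel a b ∧ s = lo a ∧ t = lo b) ∨ (∃ a b, g.rel a b ∧ s = hi a ∧ t = hi b)
  have hRs : ∀ s t, R s t → R t s := by
    rintro s t (⟨a, b, h, h1, h2⟩ | ⟨a, b, h, h1, h2⟩)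
    · exact Or.inl ⟨b, a, f.rel.symm h, h2, h1⟩
    · exact Or.inr ⟨b, a, g.rel.symm h, h2, h1⟩
  let G : SimpleGraph V :=
    { Adj := fun u v => u ≠ v ∧ R u.1 v.1
      symm := ⟨fun u v h => ⟨h.1.symm, hRs _ _ h.2⟩⟩
      loopless := ⟨fun u h => h.1 rfl⟩ }
  have hreach : ∀ t (h : glue f g (outer x) t), G.Reachable ⟨outer x, (glue f g).refl _⟩ ⟨t, h⟩ := by
    have step : ∀ s t, R s t → glue f g s t →
        (∃ h : glue f g (outer x) s, G.Reachable ⟨outer x, (glue f g).refl _⟩ ⟨s, h⟩) →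
        ∃ h : glue f g (outer x) t, G.Reachable ⟨outer x, (glue f g).refl _⟩ ⟨t, h⟩ := by
      rintro s t hR hst ⟨h, hr⟩
      refine ⟨(glue f g).trans h hst, ?_⟩
      by_cases hst' : s = t
      · subst hst'; exact hr
      · refine hr.trans (SimpleGraph.Adj.reachable ⟨?_, hR⟩)
        intro h'; exact hst' (congrArg Subtype.val h')
    intro t ht
    obtain ⟨h, hr⟩ := (glue_induction
      (P := fun t => ∃ h : glue f g (outer x) t, G.Reachable ⟨outer x, (glue f g).refl _⟩ ⟨t, h⟩)
      (fun a b h => step _ _ (Or.inl ⟨a, b, h, rfl, rfl⟩) (glue_lo h))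
      (fun a b h => step _ _ (Or.inr ⟨a, b, h, rfl, rfl⟩) (glue_hi h)) ht).1
      ⟨(glue f g).refl _, SimpleGraph.Reachable.refl _⟩
    exact hr
  have hconn : G.Connected :=
    { preconnected := fun u v => (hreach u.1 u.2).symm.trans (hreach v.1 v.2)
      nonempty := ⟨⟨outer x, (glue f g).refl _⟩⟩ }
  let nb : Fin m ⊕ (Fin n ⊕ Fin p) → Finset (Fin m ⊕ (Fin n ⊕ Fin p)) := fun t => match t with
    | Sum.inl i => {lo (f.partner (Sum.inl i))}
    | Sum.inr (Sum.inl j) => {lo (f.partner (Sum.inr j)), hi (g.partner (Sum.inl j))}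
    | Sum.inr (Sum.inr l) => {hi (g.partner (Sum.inr l))}
  have hnb : ∀ s t, s ≠ t → R s t → t ∈ nb s := by
    rintro s t hst (⟨a, b, h, rfl, rfl⟩ | ⟨a, b, h, rfl, rfl⟩)
    · have hb := eq_partner h (fun h' => hst (by rw [h']))
      subst hb
      rcases a with a | a
      · exact Finset.mem_singleton_self _
      · exact Finset.mem_insert_self _ _
    · have hb := eq_partner h (fun h' => hst (by rw [h']))
      subst hb
      rcases a with a | a
      · exact Finset.mem_insert_of_mem (Finset.mem_singleton_self _)
      · exact Finset.mem_singleton_self _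
  let O : V → Prop := fun u => ∃ w : Fin m ⊕ Fin p, u.1 = outer w
  have hdeg : ∀ u : V, G.degree u + (if O u then 1 else 0) ≤ 2 := by
    rintro ⟨u, hu⟩
    have h1 : G.degree ⟨u, hu⟩ ≤ (nb u).card := by
      rw [← SimpleGraph.card_neighborFinset_eq_degree,
        ← Finset.card_map (Function.Embedding.subtype _)]
      apply Finset.card_le_card
      intro t ht
      simp only [Finset.mem_map, SimpleGraph.mem_neighborFinset] at ht
      obtain ⟨v, hv, rfl⟩ := ht
      exact hnb _ _ (fun h' => hv.1 (Subtype.ext h')) hv.2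
    have h2 : (nb u).card + (if O ⟨u, hu⟩ then 1 else 0) ≤ 2 := by
      rcases u with u | u | u
      · simp only [nb, Finset.card_singleton]; split_ifs <;> omega
      · have : ¬ O ⟨Sum.inr (Sum.inl u), hu⟩ := by
          rintro ⟨w | w, hw⟩ <;> simp [outer] at hw
        rw [if_neg this]
        exact Finset.card_le_two
      · simp only [nb, Finset.card_singleton]; split_ifs <;> omega
    omega
  have h2 := card_le_two_of_degree G hconn O (fun u => by convert hdeg u)
  have h3 : 3 ≤ (Finset.univ.filter O).card := by
    have hinj : ∀ a b : Fin m ⊕ Fin p, (outer a : Fin m ⊕ (Fin n ⊕ Fin p)) = outer b → a = b := by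
      rintro (a | a) (b | b) h <;> simp [outer] at h <;> rw [h]
    let v : ∀ w, glue f g (outer x) (outer w) → V := fun w h => ⟨outer w, h⟩
    have hsub : ({v x ((glue f g).refl _), v y hy, v z hz} : Finset V) ⊆ Finset.univ.filter O := by
      intro u hu
      simp only [Finset.mem_insert, Finset.mem_singleton] at hu
      simp only [Finset.mem_filter, Finset.mem_univ, true_and]
      rcases hu with rfl | rfl | rfl
      exacts [⟨_, rfl⟩, ⟨_, rfl⟩, ⟨_, rfl⟩]
    refine le_trans ?_ (Finset.card_le_card hsub)
    rw [Finset.card_eq_three.2 ⟨_, _, _, ?_, ?_, ?_, rfl⟩]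
    · intro h; exact hxy (hinj _ _ (congrArg Subtype.val h))
    · intro h; exact hxz (hinj _ _ (congrArg Subtype.val h))
    · intro h; exact hyz (hinj _ _ (congrArg Subtype.val h))
  omega

/-- Vertical stacking: `f` below, `g` on top, with the loops removed. -/
def comp (f : Diagram m n) (g : Diagram n p) : Diagram m p where
  rel := (glue f g).comap outer
  pair := by
    classical
    intro x
    have h := sum_outer f g (fun t => glue f g (outer x) t) (fun s t h h' => (glue f g).trans h' h)
    have hex : ∃ y, y ≠ x ∧ glue f g (outer x) (outer y) := by
      by_contra hno
      push Not at hno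
      rw [Finset.sum_eq_single x] at h
      · rw [ind_pos ((glue f g).refl _)] at h; exact one_ne_zero h
      · intro y _ hy; exact ind_neg (hno y hy)
      · intro h'; exact (h' (Finset.mem_univ _)).elim
    obtain ⟨y, hy, hr⟩ := hex
    refine ⟨y, ⟨hy, hr⟩, ?_⟩
    rintro z ⟨hz, hr'⟩
    by_contra hne
    exact outer_le_two f g hr hr' hy.symm hz.symm (Ne.symm hne)
  planar := by
    classical
    intro a b c d hab hbc hcd hac hbd
    have hac' : glue f g (outer a) (outer c) := hac
    have hbd' : glue f g (outer b) (outer d) := hbd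
    let K : Fin m ⊕ (Fin n ⊕ Fin p) → Prop := fun t => glue f g (outer a) t
    have hK : ∀ s t, glue f g s t → K s → K t := fun s t h h' => (glue f g).trans h' h
    have hne : ∀ {x y : Fin m ⊕ Fin p}, pos x < pos y → x ≠ y := by
      rintro x y h rfl; exact lt_irrefl _ h
    have hKac : ∀ x, K (outer x) ↔ x = a ∨ x = c := by
      intro x
      constructor
      · intro hx
        by_contra hno
        push Not at hno
        exact outer_le_two f g hac' hx (hne (hab.trans hbc)) hno.1.symm hno.2.symm
      · rintro (rfl | rfl)
        exacts [(glue f g).refl _, hac']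
    have hb : ¬ K (outer b) := by
      rw [hKac]; rintro (h | h)
      exacts [hne hab h.symm, hne hbc h]
    have hd : ¬ K (outer d) := by
      rw [hKac]; rintro (h | h)
      exacts [hne (hab.trans (hbc.trans hcd)) h.symm, hne hcd h.symm]
    let lv : Fin m ⊕ (Fin n ⊕ Fin p) → ZMod 2 := Sum.elim (row fun i => K (Sum.inl i))
      (Sum.elim (row fun i => K (Sum.inr (Sum.inl i))) (row fun i => K (Sum.inr (Sum.inr i))))
    have hlo : ∀ x, lv (lo x) = lev (fun x => K (lo x)) x := by rintro (x | x) <;> rfl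
    have hhi : ∀ x, lv (hi x) = lev (fun x => K (hi x)) x := by rintro (x | x) <;> rfl
    have hou : ∀ x, lv (outer x) = lev (fun x => K (outer x)) x := by rintro (x | x) <;> rfl
    have key : lv (outer b) = lv (outer d) := by
      refine ((glue_induction (P := fun t => ¬ K t ∧ lv (outer b) = lv t) ?_ ?_ hbd').1
        ⟨hb, rfl⟩).2
      · rintro s t h ⟨h1, h2⟩
        refine ⟨fun h3 => h1 (hK _ _ (glue_lo (f.rel.symm h)) h3), ?_⟩
        rw [h2, hlo, hlo]
        exact f.lev_congr _ (fun x y h => hK _ _ (glue_lo h)) h h1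
      · rintro s t h ⟨h1, h2⟩
        refine ⟨fun h3 => h1 (hK _ _ (glue_hi (g.rel.symm h)) h3), ?_⟩
        rw [h2, hhi, hhi]
        exact g.lev_congr _ (fun x y h => hK _ _ (glue_hi h)) h h1
    have h0 := sum_outer f g K hK
    rw [hou, hou, lev_eq _ h0 _ hb, lev_eq _ h0 _ hd] at key
    simp only [hKac] at key
    rw [Finset.sum_eq_single a, Finset.sum_eq_add a c (hne (hab.trans hbc)),
      ind_pos ⟨Or.inl rfl, hab⟩, ind_pos ⟨Or.inl rfl, hab.trans (hbc.trans hcd)⟩,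
      ind_pos ⟨Or.inr rfl, hcd⟩] at key
    · exact absurd key (by decide)
    · rintro x _ ⟨h1, h2⟩; exact ind_neg (by simp [h1, h2])
    · simp
    · simp
    · intro x _ h1
      refine ind_neg ?_
      rintro ⟨rfl | rfl, h2⟩
      · exact h1 rfl
      · omega
    · simp

end Diagram
namespace Diagram
variable {m n p r m₁ m₂ m₃ n₁ n₂ n₃ p₁ p₂ : ℕ}

theorem relMat_comp (f : Diagram m n) (g : Diagram n p) :
    relMat f.rel * relMat g.rel = 2 ^ loops f g • relMat (comp f g).rel := relMat_mul f g

theorem ext_compat {f g : Diagram m n}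
    (h : ∀ a b, Compat f.rel (Sum.elim a b) ↔ Compat g.rel (Sum.elim a b)) : f = g := by
  apply Diagram.ext
  apply setoid_eq_of_compat
  intro l
  have := h (l ∘ Sum.inl) (l ∘ Sum.inr)
  rwa [Sum.elim_comp_inl_inr] at this

theorem comp_assoc' (f : Diagram m n) (g : Diagram n p) (h : Diagram p r) :
    loops f g + loops (comp f g) h = loops g h + loops f (comp g h) ∧
      comp (comp f g) h = comp f (comp g h) := by
  have key := Matrix.mul_assoc (relMat f.rel) (relMat g.rel) (relMat h.rel)
  rw [relMat_comp, relMat_comp, Matrix.smul_mul, Matrix.mul_smul, relMat_comp, relMat_comp,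
    smul_smul, smul_smul, ← pow_add, ← pow_add] at key
  exact ⟨(relMat_smul_cancel key).1, Diagram.ext (relMat_smul_cancel key).2⟩

/-- The identity diagram: `n` vertical lines. -/
def id (n : ℕ) : Diagram n n where
  rel := Setoid.ker (Sum.elim _root_.id _root_.id)
  pair := by
    rintro (x | x)
    · refine ⟨Sum.inr x, ⟨by simp, rfl⟩, ?_⟩
      rintro (y | y) ⟨h1, h2⟩
      · exact (h1 (congrArg Sum.inl (Eq.symm h2))).elim
      · exact congrArg Sum.inr (Eq.symm h2)
    · refine ⟨Sum.inl x, ⟨by simp, rfl⟩, ?_⟩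
      rintro (y | y) ⟨h1, h2⟩
      · exact congrArg Sum.inl (Eq.symm h2)
      · exact (h1 (congrArg Sum.inr (Eq.symm h2))).elim
  planar := by
    rintro (a | a) (b | b) (c | c) (d | d) h1 h2 h3 h4 h5 <;>
    simp only [Setoid.ker_def, Sum.elim_inl, Sum.elim_inr, id_eq] at h4 h5 <;> subst h4 <;>
    subst h5 <;> simp only [pos] at h1 h2 h3 <;> omega

theorem compat_id {a b : Fin n → Bool} : Compat (id n).rel (Sum.elim a b) ↔ a = b := by
  constructor
  · intro h; funext i; exact h (Sum.inl i) (Sum.inr i) rfl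
  · rintro rfl x y h
    have h' : Sum.elim _root_.id _root_.id x = Sum.elim _root_.id _root_.id y := h
    rcases x with x | x <;> rcases y with y | y <;> exact congrArg a h'

theorem relMat_id : relMat (id n).rel = 1 := by
  classical
  ext a b
  simp [relMat, compat_id, Matrix.one_apply]

theorem id_comp' (f : Diagram m n) : loops (id m) f = 0 ∧ comp (id m) f = f := by
  have key := relMat_comp (id m) f
  rw [relMat_id, Matrix.one_mul] at key
  have := relMat_smul_cancel (a := 0) (s := f.rel) ((by simp : _ = relMat f.rel).trans key)
  exact ⟨this.1.symm, Diagram.ext this.2.symm⟩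

theorem comp_id' (f : Diagram m n) : loops f (id n) = 0 ∧ comp f (id n) = f := by
  have key := relMat_comp f (id n)
  rw [relMat_id, Matrix.mul_one] at key
  have := relMat_smul_cancel (a := 0) (s := f.rel) ((by simp : _ = relMat f.rel).trans key)
  exact ⟨this.1.symm, Diagram.ext this.2.symm⟩

/-! ### Horizontal juxtaposition -/

/-- The dots of two diagrams next to each other. -/
def split : (Fin m₁ ⊕ Fin n₁) ⊕ (Fin m₂ ⊕ Fin n₂) ≃ Fin (m₁ + m₂) ⊕ Fin (n₁ + n₂) :=
  (Equiv.sumSumSumComm _ _ _ _).trans (Equiv.sumCongr finSumFinEquiv finSumFinEquiv)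

/-- The relation on the dots of two diagrams next to each other. -/
def sumRel (f : Diagram m₁ n₁) (g : Diagram m₂ n₂) :
    Setoid ((Fin m₁ ⊕ Fin n₁) ⊕ (Fin m₂ ⊕ Fin n₂)) where
  r := Sum.LiftRel f.rel g.rel
  iseqv :=
    { refl := by
        rintro (x | x)
        exacts [Sum.LiftRel.inl (f.rel.refl x), Sum.LiftRel.inr (g.rel.refl x)]
      symm := by
        rintro _ _ (h | h)
        exacts [Sum.LiftRel.inl (f.rel.symm h), Sum.LiftRel.inr (g.rel.symm h)]
      trans := by
        rintro _ _ _ (h | h) (h' | h')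
        exacts [Sum.LiftRel.inl (f.rel.trans h h'), Sum.LiftRel.inr (g.rel.trans h h')] }

theorem pos_split_inl (x : Fin m₁ ⊕ Fin n₁) :
    pos (split (Sum.inl x) : Fin (m₁ + m₂) ⊕ Fin (n₁ + n₂)) =
      if x.isLeft then pos x else pos x + (m₂ + n₂) := by
  rcases x with x | x
  · simp [split, pos]
  · simp [split, pos]; omega

theorem pos_split_inr (x : Fin m₂ ⊕ Fin n₂) :
    pos (split (Sum.inr x) : Fin (m₁ + m₂) ⊕ Fin (n₁ + n₂)) = m₁ + pos x := by
  rcases x with x | x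
  · simp [split, pos]
  · simp [split, pos]; omega

theorem pos_lt (x : Fin m ⊕ Fin n) : pos x < m + n ∧ (x.isLeft ↔ pos x < m) := by
  rcases x with x | x
  · simp [pos]; omega
  · simp [pos]; omega

/-- Horizontal juxtaposition: `f` on the left, `g` on the right. -/
def tensor (f : Diagram m₁ n₁) (g : Diagram m₂ n₂) : Diagram (m₁ + m₂) (n₁ + n₂) where
  rel := (sumRel f g).comap split.symm
  pair := by
    intro x
    obtain ⟨x, rfl⟩ := split.surjective x
    rcases x with x | x
    · refine ⟨split (Sum.inl (f.partner x)), ⟨?_, ?_⟩, ?_⟩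
      · simp [f.partner_ne x]
      · rw [Setoid.comap_rel, Equiv.symm_apply_apply, Equiv.symm_apply_apply]
        exact Sum.LiftRel.inl (f.rel_partner x)
      · rintro y ⟨h1, h2⟩
        obtain ⟨y, rfl⟩ := split.surjective y
        rw [Setoid.comap_rel, Equiv.symm_apply_apply, Equiv.symm_apply_apply] at h2
        rcases h2 with h2 | h2
        rw [eq_partner h2 (fun h => h1 (by rw [h]))]
    · refine ⟨split (Sum.inr (g.partner x)), ⟨?_, ?_⟩, ?_⟩
      · simp [g.partner_ne x]
      · rw [Setoid.comap_rel, Equiv.symm_apply_apply, Equiv.symm_apply_apply]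
        exact Sum.LiftRel.inr (g.rel_partner x)
      · rintro y ⟨h1, h2⟩
        obtain ⟨y, rfl⟩ := split.surjective y
        rw [Setoid.comap_rel, Equiv.symm_apply_apply, Equiv.symm_apply_apply] at h2
        rcases h2 with h2 | h2
        rw [eq_partner h2 (fun h => h1 (by rw [h]))]
  planar := by
    intro a b c d h1 h2 h3 h4 h5
    obtain ⟨a, rfl⟩ := split.surjective a
    obtain ⟨b, rfl⟩ := split.surjective b
    obtain ⟨c, rfl⟩ := split.surjective c
    obtain ⟨d, rfl⟩ := split.surjective d
    rw [Setoid.comap_rel, Equiv.symm_apply_apply, Equiv.symm_apply_apply] at h4 h5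
    rcases h4 with @⟨a, c, h4⟩ | @⟨a, c, h4⟩ <;> rcases h5 with @⟨b, d, h5⟩ | @⟨b, d, h5⟩ <;>
    simp only [pos_split_inl, pos_split_inr] at h1 h2 h3 <;>
    have ha := pos_lt a <;> have hb := pos_lt b <;> have hc := pos_lt c <;> have hd := pos_lt d
    · refine f.planar a b c d ?_ ?_ ?_ h4 h5 <;> split_ifs at h1 h2 h3 <;> simp_all <;> omega
    · split_ifs at h1 h2 h3 <;> simp_all <;> omega
    · split_ifs at h1 h2 h3 <;> simp_all <;> omega
    · exact g.planar a b c d (by omega) (by omega) (by omega) h4 h5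

theorem compat_tensor {f : Diagram m₁ n₁} {g : Diagram m₂ n₂} {a b} :
    Compat (tensor f g).rel (Sum.elim a b) ↔
      Compat f.rel (Sum.elim (fun i => a (Fin.castAdd m₂ i)) (fun i => b (Fin.castAdd n₂ i))) ∧
      Compat g.rel (Sum.elim (fun i => a (Fin.natAdd m₁ i)) (fun i => b (Fin.natAdd n₁ i))) := by
  have e1 : ∀ x : Fin m₁ ⊕ Fin n₁, Sum.elim (fun i => a (Fin.castAdd m₂ i))
      (fun i => b (Fin.castAdd n₂ i)) x = Sum.elim a b (split (Sum.inl x)) := by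
    rintro (x | x) <;> simp [split]
  have e2 : ∀ x : Fin m₂ ⊕ Fin n₂, Sum.elim (fun i => a (Fin.natAdd m₁ i))
      (fun i => b (Fin.natAdd n₁ i)) x = Sum.elim a b (split (Sum.inr x)) := by
    rintro (x | x) <;> simp [split]
  constructor
  · intro h
    refine ⟨fun x y hxy => ?_, fun x y hxy => ?_⟩
    · rw [e1, e1]; apply h
      change sumRel f g (split.symm (split (Sum.inl x))) (split.symm (split (Sum.inl y)))
      rw [Equiv.symm_apply_apply, Equiv.symm_apply_apply]
      exact Sum.LiftRel.inl hxy
    · rw [e2, e2]; apply h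
      change sumRel f g (split.symm (split (Sum.inr x))) (split.symm (split (Sum.inr y)))
      rw [Equiv.symm_apply_apply, Equiv.symm_apply_apply]
      exact Sum.LiftRel.inr hxy
  · rintro ⟨h1, h2⟩ x y hxy
    obtain ⟨x, rfl⟩ := split.surjective x
    obtain ⟨y, rfl⟩ := split.surjective y
    change sumRel f g (split.symm (split x)) (split.symm (split y)) at hxy
    rw [Equiv.symm_apply_apply, Equiv.symm_apply_apply] at hxy
    rcases hxy with h | h
    · rw [← e1, ← e1]; exact h1 _ _ h
    · rw [← e2, ← e2]; exact h2 _ _ h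

theorem relMat_tensor (f : Diagram m₁ n₁) (g : Diagram m₂ n₂) (a b) :
    relMat (tensor f g).rel a b =
      relMat f.rel (fun i => a (Fin.castAdd m₂ i)) (fun i => b (Fin.castAdd n₂ i)) *
      relMat g.rel (fun i => a (Fin.natAdd m₁ i)) (fun i => b (Fin.natAdd n₁ i)) := by
  classical
  simp only [relMat, compat_tensor]
  split_ifs <;> simp_all

theorem tensor_comp' (f : Diagram m₁ n₁) (g : Diagram m₂ n₂) (f' : Diagram n₁ p₁)
    (g' : Diagram n₂ p₂) :
    loops (tensor f g) (tensor f' g') = loops f f' + loops g g' ∧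
      comp (tensor f g) (tensor f' g') = tensor (comp f f') (comp g g') := by
  have key : relMat (tensor f g).rel * relMat (tensor f' g').rel =
      2 ^ (loops f f' + loops g g') • relMat (tensor (comp f f') (comp g g')).rel := by
    ext a c
    rw [Matrix.smul_apply, relMat_tensor]
    have h1 := congrFun (congrFun (relMat_comp f f') (fun i => a (Fin.castAdd m₂ i)))
      (fun i => c (Fin.castAdd p₂ i))
    have h2 := congrFun (congrFun (relMat_comp g g') (fun i => a (Fin.natAdd m₁ i)))
      (fun i => c (Fin.natAdd p₁ i))
    rw [Matrix.smul_apply, Matrix.mul_apply] at h1 h2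
    rw [pow_add, smul_eq_mul, mul_mul_mul_comm, ← smul_eq_mul (2 ^ loops f f'),
      ← smul_eq_mul (2 ^ loops g g'), ← h1, ← h2, Finset.sum_mul_sum, ← Finset.sum_product',
      Finset.univ_product_univ, Matrix.mul_apply, ← (Fin.appendEquiv n₁ n₂).sum_comp]
    refine Finset.sum_congr rfl (fun b _ => ?_)
    simp only [relMat_tensor, Fin.appendEquiv, Equiv.coe_fn_mk, Fin.append_left, Fin.append_right]
    ring
  rw [relMat_comp] at key
  exact ⟨(relMat_smul_cancel key).1, Diagram.ext (relMat_smul_cancel key).2⟩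

theorem tensor_id' : tensor (id m) (id n) = id (m + n) := by
  apply ext_compat
  intro a b
  rw [compat_tensor, compat_id, compat_id, compat_id]
  constructor
  · rintro ⟨h1, h2⟩
    funext i
    refine Fin.addCases (fun i => ?_) (fun i => ?_) i
    exacts [congrFun h1 i, congrFun h2 i]
  · rintro rfl; exact ⟨rfl, rfl⟩

/-- Transport along equalities of the numbers of dots. -/
def cast {m' n' : ℕ} (hm : m = m') (hn : n = n') (f : Diagram m n) : Diagram m' n' := hm ▸ hn ▸ f

theorem compat_cast {m' n' : ℕ} (hm : m = m') (hn : n = n') (f : Diagram m n) {a b} :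
    Compat (cast hm hn f).rel (Sum.elim a b) ↔
      Compat f.rel (Sum.elim (fun i => a (Fin.cast hm i)) (fun i => b (Fin.cast hn i))) := by
  subst hm hn; rfl

theorem tensor_assoc' (f : Diagram m₁ n₁) (g : Diagram m₂ n₂) (h : Diagram m₃ n₃) :
    cast (Nat.add_assoc _ _ _) (Nat.add_assoc _ _ _) (tensor (tensor f g) h) =
      tensor f (tensor g h) := by
  apply ext_compat
  intro a b
  have e : ∀ (a b c : ℕ) (i : Fin c), Fin.cast (Nat.add_assoc a b c) (Fin.natAdd (a + b) i) =
      Fin.natAdd a (Fin.natAdd b i) := fun a b c i => Fin.ext (Nat.add_assoc _ _ _)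
  simp only [compat_cast, compat_tensor, and_assoc, e]
  rfl

theorem tensor_zero' (f : Diagram m n) : tensor f (id 0) = f := by
  apply ext_compat
  intro a b
  rw [compat_tensor, compat_id, and_iff_left (Subsingleton.elim _ _)]
  rfl

theorem zero_tensor' (f : Diagram m n) :
    cast (Nat.zero_add _) (Nat.zero_add _) (tensor (id 0) f) = f := by
  apply ext_compat
  intro a b
  rw [compat_cast, compat_tensor, compat_id, and_iff_right (Subsingleton.elim _ _)]
  simp only [Fin.natAdd_zero, Fin.cast_cast]
  rfl

/-- The cup: a single line joining two top dots. -/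
def cup : Diagram 0 2 where
  rel := ⊤
  pair := by
    rintro (x | x)
    · exact x.elim0
    · fin_cases x
      · refine ⟨Sum.inr 1, ⟨by simp, trivial⟩, ?_⟩
        rintro (y | y) ⟨h, -⟩
        · exact y.elim0
        · fin_cases y
          · exact (h rfl).elim
          · rfl
      · refine ⟨Sum.inr 0, ⟨by simp, trivial⟩, ?_⟩
        rintro (y | y) ⟨h, -⟩
        · exact y.elim0
        · fin_cases y
          · rfl
          · exact (h rfl).elim
  planar := by
    rintro (a | a) (b | b) (c | c) (d | d) h1 h2 h3 <;> simp only [pos] at h1 h2 h3 <;> omega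

/-- The cap: a single line joining two bottom dots. -/
def cap : Diagram 2 0 where
  rel := ⊤
  pair := by
    rintro (x | x)
    · fin_cases x
      · refine ⟨Sum.inl 1, ⟨by simp, trivial⟩, ?_⟩
        rintro (y | y) ⟨h, -⟩
        · fin_cases y
          · exact (h rfl).elim
          · rfl
        · exact y.elim0
      · refine ⟨Sum.inl 0, ⟨by simp, trivial⟩, ?_⟩
        rintro (y | y) ⟨h, -⟩
        · fin_cases y
          · rfl
          · exact (h rfl).elim
        · exact y.elim0
    · exact x.elim0
  planar := by
    rintro (a | a) (b | b) (c | c) (d | d) h1 h2 h3 <;> simp only [pos] at h1 h2 h3 <;> omega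

end Diagram
namespace Diagram

theorem relMat_cup (a b) : relMat cup.rel a b = if b 0 = b 1 then 1 else 0 := by
  have : Compat cup.rel (Sum.elim a b) ↔ b 0 = b 1 := by
    constructor
    · intro h; exact h (Sum.inr 0) (Sum.inr 1) trivial
    · rintro h (x | x) (y | y) -
      · exact x.elim0
      · exact x.elim0
      · exact y.elim0
      · fin_cases x <;> fin_cases y <;> simp [h]
  simp only [relMat, this]

theorem relMat_cap (a b) : relMat cap.rel a b = if a 0 = a 1 then 1 else 0 := by
  have : Compat cap.rel (Sum.elim a b) ↔ a 0 = a 1 := by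
    constructor
    · intro h; exact h (Sum.inl 0) (Sum.inl 1) trivial
    · rintro h (x | x) (y | y) -
      · fin_cases x <;> fin_cases y <;> simp [h]
      · exact y.elim0
      · exact x.elim0
      · exact x.elim0
  simp only [relMat, this]

theorem cup_cap : loops cup cap = 1 ∧ comp cup cap = id 0 := by
  have key := relMat_comp cup cap
  have h2 : relMat cup.rel * relMat cap.rel = 2 ^ 1 • relMat (id 0).rel := by
    ext a b
    rw [relMat_id, Matrix.mul_apply]
    simp only [relMat_cup, relMat_cap]
    revert a b; decide
  have := relMat_smul_cancel (key.symm.trans h2)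
  exact ⟨this.1, Diagram.ext this.2⟩

/-- A line with a cup on its right. -/
def lineCup : Diagram 1 3 := tensor (m₁ := 1) (m₂ := 0) (n₁ := 1) (n₂ := 2) (id 1) cup

/-- A line with a cup on its left. -/
def cupLine : Diagram 1 3 := tensor (m₁ := 0) (m₂ := 1) (n₁ := 2) (n₂ := 1) cup (id 1)

/-- A line with a cap on its right. -/
def lineCap : Diagram 3 1 := tensor (m₁ := 1) (m₂ := 2) (n₁ := 1) (n₂ := 0) (id 1) cap

/-- A line with a cap on its left. -/
def capLine : Diagram 3 1 := tensor (m₁ := 2) (m₂ := 1) (n₁ := 0) (n₂ := 1) cap (id 1)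

theorem relMat_lineCup (a b) :
    relMat lineCup.rel a b = if a 0 = b 0 ∧ b 1 = b 2 then 1 else 0 := by
  refine (relMat_tensor (m₁ := 1) (m₂ := 0) (n₁ := 1) (n₂ := 2) (id 1) cup a b).trans ?_
  rw [relMat_id, relMat_cup, Matrix.one_apply]
  revert a b; decide

theorem relMat_cupLine (a b) :
    relMat cupLine.rel a b = if b 0 = b 1 ∧ a 0 = b 2 then 1 else 0 := by
  refine (relMat_tensor (m₁ := 0) (m₂ := 1) (n₁ := 2) (n₂ := 1) cup (id 1) a b).trans ?_
  rw [relMat_id, relMat_cup, Matrix.one_apply]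
  revert a b; decide

theorem relMat_lineCap (a b) :
    relMat lineCap.rel a b = if a 0 = b 0 ∧ a 1 = a 2 then 1 else 0 := by
  refine (relMat_tensor (m₁ := 1) (m₂ := 2) (n₁ := 1) (n₂ := 0) (id 1) cap a b).trans ?_
  rw [relMat_id, relMat_cap, Matrix.one_apply]
  revert a b; decide

theorem relMat_capLine (a b) :
    relMat capLine.rel a b = if a 0 = a 1 ∧ a 2 = b 0 then 1 else 0 := by
  refine (relMat_tensor (m₁ := 2) (m₂ := 1) (n₁ := 0) (n₂ := 1) cap (id 1) a b).trans ?_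
  rw [relMat_id, relMat_cap, Matrix.one_apply]
  revert a b; decide

theorem zigzag_left : loops lineCup capLine = 0 ∧ comp lineCup capLine = id 1 := by
  have key := relMat_comp lineCup capLine
  have h2 : relMat lineCup.rel * relMat capLine.rel = 2 ^ 0 • relMat (id 1).rel := by
    ext a b
    rw [relMat_id, Matrix.mul_apply]
    simp only [relMat_lineCup, relMat_capLine, Matrix.smul_apply, Matrix.one_apply]
    revert a b; decide
  have := relMat_smul_cancel (key.symm.trans h2)
  exact ⟨this.1, Diagram.ext this.2⟩

theorem zigzag_right : loops cupLine lineCap = 0 ∧ comp cupLine lineCap = id 1 := by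
  have key := relMat_comp cupLine lineCap
  have h2 : relMat cupLine.rel * relMat lineCap.rel = 2 ^ 0 • relMat (id 1).rel := by
    ext a b
    rw [relMat_id, Matrix.mul_apply]
    simp only [relMat_cupLine, relMat_lineCap, Matrix.smul_apply, Matrix.one_apply]
    revert a b; decide
  have := relMat_smul_cancel (key.symm.trans h2)
  exact ⟨this.1, Diagram.ext this.2⟩

end Diagram

/-! ### Linear combinations of diagrams, with every loop replaced by a scalar -/

section Linear
variable {m n p r m₁ m₂ m₃ n₁ n₂ n₃ p₁ p₂ : ℕ}

/-- Formal complex linear combinations of diagrams `m → n`. -/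
abbrev LinHom (m n : ℕ) : Type := Diagram m n →₀ ℂ

/-- A diagram as a linear combination. -/
noncomputable def dg (f : Diagram m n) : LinHom m n := Finsupp.single f 1

/-- Bilinear extension of vertical stacking, where every loop contributes a factor `δ`. -/
noncomputable def lcomp (δ : ℂ) : LinHom m n →ₗ[ℂ] LinHom n p →ₗ[ℂ] LinHom m p :=
  Finsupp.linearCombination ℂ fun f => Finsupp.linearCombination ℂ fun g =>
    δ ^ Diagram.loops f g • dg (Diagram.comp f g)

/-- Bilinear extension of horizontal juxtaposition. -/
noncomputable def ltensor :
    LinHom m₁ n₁ →ₗ[ℂ] LinHom m₂ n₂ →ₗ[ℂ] LinHom (m₁ + m₂) (n₁ + n₂) :=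
  Finsupp.linearCombination ℂ fun f => Finsupp.linearCombination ℂ fun g =>
    dg (Diagram.tensor f g)

/-- The identity on `n` strands. -/
noncomputable def lid (n : ℕ) : LinHom n n := dg (Diagram.id n)

theorem lcomp_dg (δ : ℂ) (f : Diagram m n) (g : Diagram n p) :
    lcomp δ (dg f) (dg g) = δ ^ Diagram.loops f g • dg (Diagram.comp f g) := by
  simp [lcomp, dg]

theorem ltensor_dg (f : Diagram m₁ n₁) (g : Diagram m₂ n₂) :
    ltensor (dg f) (dg g) = dg (Diagram.tensor f g) := by
  simp [ltensor, dg]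

theorem lin_induction {P : LinHom m n → Prop} (f : LinHom m n) (h0 : P 0)
    (hadd : ∀ f g, P f → P g → P (f + g)) (hs : ∀ (c : ℂ) (f : Diagram m n), P (c • dg f)) : P f := by
  refine Finsupp.induction_linear f h0 hadd (fun a b => ?_)
  simpa [dg] using hs b a

theorem lcomp_assoc (δ : ℂ) (f : LinHom m n) (g : LinHom n p) (h : LinHom p r) :
    lcomp δ (lcomp δ f g) h = lcomp δ f (lcomp δ g h) := by
  induction f using lin_induction with
  | h0 => simp
  | hadd f f' h1 h2 => simp only [map_add, LinearMap.add_apply, h1, h2]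
  | hs c f =>
    induction g using lin_induction with
    | h0 => simp
    | hadd f f' h1 h2 => simp only [map_add, LinearMap.add_apply, h1, h2]
    | hs d g =>
      induction h using lin_induction with
      | h0 => simp
      | hadd f f' h1 h2 => simp only [map_add, h1, h2]
      | hs e h =>
        have := Diagram.comp_assoc' f g h
        simp only [map_smul, LinearMap.smul_apply, lcomp_dg, smul_smul, this.2]
        congr 1
        have h1 : δ ^ f.loops g * δ ^ (f.comp g).loops h = δ ^ g.loops h * δ ^ f.loops (g.comp h) := by
          rw [← pow_add, ← pow_add, this.1]
        linear_combination (c * d * e) * h1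

theorem lid_lcomp (δ : ℂ) (f : LinHom m n) : lcomp δ (lid m) f = f := by
  induction f using lin_induction with
  | h0 => simp
  | hadd f f' h1 h2 => simp only [map_add, h1, h2]
  | hs c f => simp [lid, lcomp_dg, (Diagram.id_comp' f).1, (Diagram.id_comp' f).2]

theorem lcomp_lid (δ : ℂ) (f : LinHom m n) : lcomp δ f (lid n) = f := by
  induction f using lin_induction with
  | h0 => simp
  | hadd f f' h1 h2 => simp only [map_add, LinearMap.add_apply, h1, h2]
  | hs c f => simp [lid, lcomp_dg, (Diagram.comp_id' f).1, (Diagram.comp_id' f).2]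

theorem ltensor_lcomp (δ : ℂ) (f : LinHom m₁ n₁) (g : LinHom m₂ n₂) (f' : LinHom n₁ p₁)
    (g' : LinHom n₂ p₂) : lcomp δ (ltensor f g) (ltensor f' g') =
      ltensor (lcomp δ f f') (lcomp δ g g') := by
  induction f using lin_induction with
  | h0 => simp
  | hadd f f' h1 h2 => simp only [map_add, LinearMap.add_apply, h1, h2]
  | hs c f =>
    induction g using lin_induction with
    | h0 => simp
    | hadd f f' h1 h2 => simp only [map_add, LinearMap.add_apply, h1, h2]
    | hs d g =>
      induction f' using lin_induction with
      | h0 => simp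
      | hadd f f' h1 h2 => simp only [map_add, LinearMap.add_apply, h1, h2]
      | hs e f' =>
        induction g' using lin_induction with
        | h0 => simp
        | hadd f f' h1 h2 => simp only [map_add, h1, h2]
        | hs t g' =>
          have := Diagram.tensor_comp' f g f' g'
          simp only [map_smul, LinearMap.smul_apply, lcomp_dg, ltensor_dg, smul_smul, this.2,
            this.1, pow_add]
          congr 1
          ring

theorem ltensor_lid : ltensor (lid m) (lid n) = lid (m + n) := by
  simp only [lid, ltensor_dg, Diagram.tensor_id']

/-- Transport along equalities of the numbers of dots. -/
def lcast {m' n' : ℕ} (hm : m = m') (hn : n = n') (f : LinHom m n) : LinHom m' n' := hm ▸ hn ▸ f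

theorem lcast_add {m' n' : ℕ} (hm : m = m') (hn : n = n') (f g : LinHom m n) :
    lcast hm hn (f + g) = lcast hm hn f + lcast hm hn g := by subst hm hn; rfl

theorem lcast_smul {m' n' : ℕ} (hm : m = m') (hn : n = n') (c : ℂ) (f : LinHom m n) :
    lcast hm hn (c • f) = c • lcast hm hn f := by subst hm hn; rfl

theorem lcast_zero {m' n' : ℕ} (hm : m = m') (hn : n = n') :
    lcast hm hn (0 : LinHom m n) = 0 := by subst hm hn; rfl

theorem lcast_dg {m' n' : ℕ} (hm : m = m') (hn : n = n') (f : Diagram m n) :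
    lcast hm hn (dg f) = dg (Diagram.cast hm hn f) := by subst hm hn; rfl

theorem ltensor_assoc (f : LinHom m₁ n₁) (g : LinHom m₂ n₂) (h : LinHom m₃ n₃) :
    lcast (Nat.add_assoc _ _ _) (Nat.add_assoc _ _ _) (ltensor (ltensor f g) h) =
      ltensor f (ltensor g h) := by
  induction f using lin_induction with
  | h0 => simp [lcast_zero]
  | hadd f f' h1 h2 => simp only [map_add, LinearMap.add_apply, lcast_add, h1, h2]
  | hs c f =>
    induction g using lin_induction with
    | h0 => simp [lcast_zero]
    | hadd f f' h1 h2 => simp only [map_add, LinearMap.add_apply, lcast_add, h1, h2]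
    | hs d g =>
      induction h using lin_induction with
      | h0 => simp [lcast_zero]
      | hadd f f' h1 h2 => simp only [map_add, lcast_add, h1, h2]
      | hs e h =>
        simp only [map_smul, LinearMap.smul_apply, ltensor_dg, lcast_smul, lcast_dg,
          Diagram.tensor_assoc']

theorem ltensor_zero (f : LinHom m n) : ltensor f (lid 0) = f := by
  induction f using lin_induction with
  | h0 => simp
  | hadd f f' h1 h2 => rw [map_add, LinearMap.add_apply, h1, h2]
  | hs c f =>
    rw [map_smul, LinearMap.smul_apply, lid, ltensor_dg, Diagram.tensor_zero']

theorem zero_ltensor (f : LinHom m n) :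
    lcast (Nat.zero_add _) (Nat.zero_add _) (ltensor (lid 0) f) = f := by
  induction f using lin_induction with
  | h0 => simp [lcast_zero]
  | hadd f f' h1 h2 => rw [map_add, lcast_add, h1, h2]
  | hs c f =>
    rw [map_smul, lid, ltensor_dg, lcast_smul, lcast_dg, Diagram.zero_tensor']

end Linear

/-! ### Quantum integers -/

/-- `q = exp(π i / (k + 2))`. -/
noncomputable def qq (k : ℕ) : ℂ := Complex.exp (Real.pi * Complex.I / (k + 2))

/-- The quantum integer `[i]`. -/
noncomputable def qint (k i : ℕ) : ℂ := (qq k ^ i - (qq k ^ i)⁻¹) / (qq k - (qq k)⁻¹)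

/-- The value `δ = -[2]` of a loop. -/
noncomputable def delta (k : ℕ) : ℂ := -qint k 2

theorem qq_ne_zero (k : ℕ) : qq k ≠ 0 := Complex.exp_ne_zero _

theorem qq_pow_sub_ne (k i : ℕ) (h1 : 1 ≤ i) (h2 : i ≤ k + 1) :
    qq k ^ i - (qq k ^ i)⁻¹ ≠ 0 := by
  intro h
  have hq := pow_ne_zero i (qq_ne_zero k)
  have h3 : qq k ^ i * qq k ^ i = 1 := by
    have := sub_eq_zero.1 h
    nth_rewrite 1 [this]
    exact inv_mul_cancel₀ hq
  rw [← pow_add, qq, ← Complex.exp_nat_mul, Complex.exp_eq_one_iff] at h3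
  obtain ⟨z, hz⟩ := h3
  have hk : ((k : ℂ) + 2) ≠ 0 := by
    have : ((k + 2 : ℕ) : ℂ) ≠ 0 := Nat.cast_ne_zero.2 (by omega)
    simpa using this
  have hpi : (Real.pi : ℂ) * Complex.I ≠ 0 :=
    mul_ne_zero (Complex.ofReal_ne_zero.2 Real.pi_ne_zero) Complex.I_ne_zero
  have h4 : ((i : ℤ) : ℂ) = ((z * (k + 2) : ℤ) : ℂ) := by
    push_cast at hz ⊢
    field_simp at hz
    have h5 : (Real.pi : ℂ) * Complex.I * (2 * ((i : ℂ) - z * (k + 2))) = 0 := by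
      linear_combination (Real.pi : ℂ) * Complex.I * hz
    rcases mul_eq_zero.1 h5 with h5 | h5
    · exact (hpi h5).elim
    · linear_combination h5 / 2
  have h6 : (i : ℤ) = z * (k + 2) := by exact_mod_cast h4
  have hz0 : 0 < z := by
    by_contra hz0
    nlinarith
  nlinarith

theorem qq_sub_ne (k : ℕ) : qq k - (qq k)⁻¹ ≠ 0 := by
  simpa using qq_pow_sub_ne k 1 le_rfl (by omega)

theorem qint_ne_zero (k i : ℕ) (h1 : 1 ≤ i) (h2 : i ≤ k + 1) : qint k i ≠ 0 :=
  div_ne_zero (qq_pow_sub_ne k i h1 h2) (qq_sub_ne k)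

theorem qint_one (k : ℕ) : qint k 1 = 1 := by
  rw [qint, pow_one, div_self (qq_sub_ne k)]

theorem qint_rec (k n : ℕ) : qint k 2 * qint k (n + 1) = qint k n + qint k (n + 2) := by
  have h := qq_sub_ne k
  have hq := qq_ne_zero k
  have h2 : qint k 2 = qq k + (qq k)⁻¹ := by
    rw [qint, div_eq_iff h]; field_simp; ring
  rw [h2]
  simp only [qint]
  rw [← add_div, mul_div_assoc']
  congr 1
  simp only [pow_succ]
  field_simp
  ring

/-! ### Jones-Wenzl projections -/

/-- The cap-cup morphism on two strands. -/
noncomputable def capCup : LinHom 2 2 := dg (Diagram.comp Diagram.cap Diagram.cup)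

/-- The Jones-Wenzl projections: `f₀ = 1`, `f₁ = 1` and
`fᵢ = fᵢ₋₁ ⊗ 1 + ([i-1]/[i]) (fᵢ₋₁ ⊗ 1) Uᵢ₋₁ (fᵢ₋₁ ⊗ 1)`,
where `Uᵢ₋₁` is the cap-cup on the last two of `i` strands. -/
noncomputable def jw (k : ℕ) : (n : ℕ) → LinHom n n
  | 0 => lid 0
  | 1 => lid 1
  | n + 2 => ltensor (jw k (n + 1)) (lid 1) + (qint k (n + 1) / qint k (n + 2)) •
      lcomp (delta k) (lcomp (delta k) (ltensor (jw k (n + 1)) (lid 1)) (ltensor (lid n) capCup))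
        (ltensor (jw k (n + 1)) (lid 1))

theorem loops_cap_cup : Diagram.loops Diagram.cap Diagram.cup = 0 := by
  have key := congrFun (congrFun (Diagram.relMat_comp Diagram.cap Diagram.cup)
    (fun _ => true)) (fun _ => true)
  rw [Matrix.mul_apply, Matrix.smul_apply] at key
  simp only [Diagram.relMat_cap, Diagram.relMat_cup] at key
  by_contra h
  obtain ⟨l, hl⟩ := Nat.exists_eq_succ_of_ne_zero h
  rw [hl, pow_succ, smul_eq_mul] at key
  simp at key
  have h2 : 2 ∣ 1 := ⟨2 ^ l * _, by rw [← mul_assoc, mul_comm 2]; exact key⟩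
  omega

theorem capCup_eq (k : ℕ) : capCup = lcomp (delta k) (dg Diagram.cap) (dg Diagram.cup) := by
  rw [lcomp_dg, loops_cap_cup, pow_zero, one_smul, capCup]

theorem lcup_lcap (k : ℕ) :
    lcomp (delta k) (dg Diagram.cup) (dg Diagram.cap) = delta k • lid 0 := by
  rw [lcomp_dg, Diagram.cup_cap.1, Diagram.cup_cap.2, pow_one, lid]

theorem capCup_sq (k : ℕ) : lcomp (delta k) capCup capCup = delta k • capCup := by
  rw [capCup_eq k, lcomp_assoc, ← lcomp_assoc _ (dg Diagram.cup), lcup_lcap]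
  simp [lid_lcomp]

/-- Cap-cup on the last two of three strands. -/
noncomputable def lineU : LinHom 3 3 := ltensor (m₁ := 1) (n₁ := 1) (lid 1) capCup

/-- Cap-cup on the first two of three strands. -/
noncomputable def uLine : LinHom 3 3 := ltensor (m₁ := 2) (n₁ := 2) capCup (lid 1)

theorem lineU_eq (k : ℕ) : lineU = lcomp (delta k) (dg Diagram.lineCap) (dg Diagram.lineCup) := by
  have := ltensor_lcomp (m₁ := 1) (n₁ := 1) (p₁ := 1) (delta k) (lid 1) (dg Diagram.cap) (lid 1) (dg Diagram.cup)
  rw [lid_lcomp, ← capCup_eq, lid, ltensor_dg, ltensor_dg] at this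
  exact this.symm

theorem uLine_eq (k : ℕ) : uLine = lcomp (delta k) (dg Diagram.capLine) (dg Diagram.cupLine) := by
  have := ltensor_lcomp (m₂ := 1) (n₂ := 1) (p₂ := 1) (delta k) (dg Diagram.cap) (lid 1) (dg Diagram.cup) (lid 1)
  rw [lid_lcomp, ← capCup_eq, lid, ltensor_dg, ltensor_dg] at this
  exact this.symm

theorem lineU_uLine_lineU (k : ℕ) :
    lcomp (delta k) (lcomp (delta k) lineU uLine) lineU = lineU := by
  have h1 : lcomp (delta k) (dg Diagram.lineCup) (dg Diagram.capLine) = lid 1 := by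
    rw [lcomp_dg, Diagram.zigzag_left.1, Diagram.zigzag_left.2, pow_zero, one_smul, lid]
  have h2 : lcomp (delta k) (dg Diagram.cupLine) (dg Diagram.lineCap) = lid 1 := by
    rw [lcomp_dg, Diagram.zigzag_right.1, Diagram.zigzag_right.2, pow_zero, one_smul, lid]
  rw [lineU_eq k, uLine_eq k]
  simp only [lcomp_assoc]
  rw [← lcomp_assoc _ (dg Diagram.cupLine), h2, lid_lcomp, ← lcomp_assoc _ (dg Diagram.lineCup),
    h1, lid_lcomp]

section JW
variable {k : ℕ}

theorem ltensor_lid_succ {m n : ℕ} (f : LinHom m n) (b : ℕ) :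
    ltensor f (lid (b + 1)) = ltensor (ltensor f (lid b)) (lid 1) := by
  rw [← ltensor_lid, ← ltensor_assoc]; rfl

/-- Facts about `f_{n+1}` proved together by induction on `n`. -/
theorem jw_aux (n : ℕ) (hn : n ≤ k) :
    lcomp (delta k) (jw k (n + 1)) (jw k (n + 1)) = jw k (n + 1) ∧
    lcomp (delta k) (jw k (n + 1)) (ltensor (jw k n) (lid 1)) = jw k (n + 1) ∧
    lcomp (delta k) (ltensor (jw k n) (lid 1)) (jw k (n + 1)) = jw k (n + 1) ∧
    lcomp (delta k) (lcomp (delta k) (ltensor (lid n) capCup) (ltensor (jw k (n + 1)) (lid 1)))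
      (ltensor (lid n) capCup) =
      (-(qint k (n + 2) / qint k (n + 1))) •
        lcomp (delta k) (ltensor (jw k n) (lid 2)) (ltensor (lid n) capCup) := by
  induction n with
  | zero =>
    have e : ltensor (lid 0) (lid 1) = (lid 1 : LinHom 1 1) := ltensor_lid
    have e2 : ltensor (lid 1) (lid 1) = (lid 2 : LinHom 2 2) := ltensor_lid
    have e3 : ltensor (lid 0) (lid 2) = (lid 2 : LinHom 2 2) := ltensor_lid
    refine ⟨lid_lcomp _ _, ?_, ?_, ?_⟩
    · exact (congrArg (lcomp (delta k) (lid 1)) e).trans (lid_lcomp _ _)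
    · exact (congrArg (fun x => lcomp (delta k) x (lid 1)) e).trans (lid_lcomp _ _)
    · have h1 := ltensor_lcomp (delta k) (lid 0) capCup (lid 0) capCup
      rw [lid_lcomp, capCup_sq, map_smul] at h1
      change lcomp (delta k) (lcomp (delta k) (ltensor (lid 0) capCup) (ltensor (lid 1) (lid 1))) _
         = _ • lcomp (delta k) (ltensor (lid 0) (lid 2)) _
      rw [ltensor_lid, ltensor_lid]
      refine (congrArg (fun x => lcomp (delta k) x _) (lcomp_lid (delta k) _)).trans ?_
      rw [lid_lcomp, h1, qint_one, delta, div_one]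
  | succ n ih =>
    obtain ⟨ih1, ih2, ih3, ih4⟩ := ih (by omega)
    have hq1 := qint_ne_zero k (n + 1) (by omega) (by omega)
    have hq2 := qint_ne_zero k (n + 2) (by omega) (by omega)
    set g : LinHom (n + 2) (n + 2) := ltensor (jw k (n + 1)) (lid 1) with hg
    set E : LinHom (n + 2) (n + 2) := ltensor (lid n) capCup with hE
    set h : LinHom (n + 2) (n + 2) := ltensor (jw k n) (lid 2) with hh
    set μ := qint k (n + 1) / qint k (n + 2) with hμ
    have hf : jw k (n + 2) = g + μ • lcomp (delta k) (lcomp (delta k) g E) g := rfl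
    have hgg : lcomp (delta k) g g = g := by
      refine (ltensor_lcomp (delta k) (jw k (n + 1)) (lid 1) (jw k (n + 1)) (lid 1)).trans ?_
      rw [ih1, lid_lcomp]
    have hgh : lcomp (delta k) g h = g := by
      have hh' : h = ltensor (ltensor (jw k n) (lid 1)) (lid 1) := ltensor_lid_succ _ 1
      rw [hh']
      refine (ltensor_lcomp (delta k) (jw k (n + 1)) (lid 1) (ltensor (jw k n) (lid 1))
        (lid 1)).trans ?_
      rw [ih2, lid_lcomp]
    have hμc : μ * -(qint k (n + 2) / qint k (n + 1)) = -1 := by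
      rw [hμ]; field_simp
    have hgEgEg : lcomp (delta k) (lcomp (delta k) g E) (lcomp (delta k) g (lcomp (delta k) E g)) =
        (-(qint k (n + 2) / qint k (n + 1))) • lcomp (delta k) g (lcomp (delta k) E g) := by
      have : lcomp (delta k) (lcomp (delta k) g E) (lcomp (delta k) g (lcomp (delta k) E g)) =
        lcomp (delta k) g (lcomp (delta k) (lcomp (delta k) (lcomp (delta k) E g) E) g) := by
        simp only [lcomp_assoc]
      rw [this, ih4]
      simp only [map_smul, LinearMap.smul_apply]
      rw [lcomp_assoc, ← lcomp_assoc _ g h, hgh]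
    have hidem : lcomp (delta k) (jw k (n + 2)) (jw k (n + 2)) = jw k (n + 2) := by
      rw [hf]
      simp only [map_add, LinearMap.add_apply, map_smul, LinearMap.smul_apply, lcomp_assoc, hgg]
      rw [← lcomp_assoc _ g g, hgg]
      have h5 := hgEgEg
      rw [lcomp_assoc] at h5
      have h6 : lcomp (delta k) g (lcomp (delta k) E (lcomp (delta k) g (lcomp (delta k) g
          (lcomp (delta k) E g)))) =
        (-(qint k (n + 2) / qint k (n + 1))) • lcomp (delta k) g (lcomp (delta k) E g) := by
        rw [← lcomp_assoc _ g g, hgg, h5]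
      first
        | rw [h6]
        | rw [h5]
      rw [smul_smul μ, hμc]
      module
    have hl : lcomp (delta k) (jw k (n + 2)) g = jw k (n + 2) := by
      rw [hf]
      simp only [map_add, LinearMap.add_apply, map_smul, LinearMap.smul_apply, lcomp_assoc, hgg]
    have hr : lcomp (delta k) g (jw k (n + 2)) = jw k (n + 2) := by
      rw [hf]
      simp only [map_add, map_smul, hgg]
      rw [← lcomp_assoc, ← lcomp_assoc, hgg]
    refine ⟨hidem, hl, hr, ?_⟩
    -- the partial trace
    set A : LinHom (n + 3) (n + 3) := ltensor g (lid 1) with hA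
    have hA' : ltensor (jw k (n + 1)) (lid 2) = A := ltensor_lid_succ _ _
    set F : LinHom (n + 3) (n + 3) := ltensor (lid (n + 1)) capCup with hF
    have hFA : lcomp (delta k) F A = lcomp (delta k) A F := by
      rw [← hA']
      refine (ltensor_lcomp (delta k) (lid (n + 1)) capCup (jw k (n + 1)) (lid 2)).trans
        (Eq.trans ?_ (ltensor_lcomp (delta k) (jw k (n + 1)) (lid 2) (lid (n + 1)) capCup).symm)
      simp only [lid_lcomp, lcomp_lid]
    have hAA : lcomp (delta k) A A = A := by
      refine (ltensor_lcomp (delta k) g (lid 1) g (lid 1)).trans ?_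
      rw [hgg, lid_lcomp]
    have hFF : lcomp (delta k) F F = delta k • F := by
      refine (ltensor_lcomp (delta k) (lid (n + 1)) capCup (lid (n + 1)) capCup).trans ?_
      rw [lid_lcomp, capCup_sq, map_smul]
    have hF' : F = ltensor (lid n) lineU := by
      have e : lid (n + 1) = ltensor (lid n) (lid 1) := ltensor_lid.symm
      have := ltensor_assoc (lid n) (lid 1) capCup
      rw [hF, e, lineU, ← this]; rfl
    have hE' : ltensor E (lid 1) = ltensor (lid n) uLine := by
      have := ltensor_assoc (lid n) capCup (lid 1)
      rw [hE, uLine, ← this]; rfl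
    have hFEF : lcomp (delta k) (lcomp (delta k) F (ltensor E (lid 1))) F = F := by
      rw [hF', hE']
      have h1 : lcomp (delta k) (ltensor (lid n) lineU) (ltensor (lid n) uLine) =
          ltensor (lid n) (lcomp (delta k) lineU uLine) := by
        rw [ltensor_lcomp, lid_lcomp]
      refine (congrArg (fun x => lcomp (delta k) x (ltensor (lid n) lineU)) h1).trans ?_
      refine (ltensor_lcomp (delta k) (lid n) _ (lid n) lineU).trans ?_
      rw [lineU_uLine_lineU, lid_lcomp]
    have hT : ltensor (jw k (n + 2)) (lid 1) =
        A + μ • lcomp (delta k) (lcomp (delta k) A (ltensor E (lid 1))) A := by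
      rw [hf, map_add, map_smul, LinearMap.add_apply, LinearMap.smul_apply]
      have h1 : lcomp (delta k) A (ltensor E (lid 1)) = ltensor (lcomp (delta k) g E) (lid 1) := by
        refine (ltensor_lcomp (delta k) g (lid 1) E (lid 1)).trans ?_
        rw [lid_lcomp]
      have h2 : lcomp (delta k) (ltensor (lcomp (delta k) g E) (lid 1)) A =
          ltensor (lcomp (delta k) (lcomp (delta k) g E) g) (lid 1) := by
        refine (ltensor_lcomp (delta k) (lcomp (delta k) g E) (lid 1) g (lid 1)).trans ?_
        rw [lid_lcomp]
      rw [h1, h2]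
    rw [hA', hT]
    have e1 : lcomp (delta k) (lcomp (delta k) F A) F = delta k • lcomp (delta k) A F := by
      rw [hFA, lcomp_assoc, hFF, map_smul]
    have e2 : lcomp (delta k) (lcomp (delta k) F (lcomp (delta k) (lcomp (delta k) A
        (ltensor E (lid 1))) A)) F = lcomp (delta k) A F := by
      have : lcomp (delta k) (lcomp (delta k) F (lcomp (delta k) (lcomp (delta k) A
        (ltensor E (lid 1))) A)) F =
          lcomp (delta k) (lcomp (delta k) (lcomp (delta k) F A) (ltensor E (lid 1)))
            (lcomp (delta k) A F) := by
        simp only [lcomp_assoc]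
      rw [this, hFA, ← hFA]
      rw [hFA, ← hFA]
      have h7 : lcomp (delta k) (lcomp (delta k) (lcomp (delta k) A F) (ltensor E (lid 1)))
            (lcomp (delta k) F A) = lcomp (delta k) A (lcomp (delta k)
              (lcomp (delta k) (lcomp (delta k) F (ltensor E (lid 1))) F) A) := by
        simp only [lcomp_assoc]
      nth_rewrite 1 [hFA]
      rw [h7, hFEF, hFA, ← lcomp_assoc, hAA]
    simp only [map_add, LinearMap.add_apply, map_smul, LinearMap.smul_apply]
    rw [e1, e2, ← add_smul]
    congr 1
    have := qint_rec k (n + 1)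
    rw [delta, hμ, eq_neg_iff_add_eq_zero]
    field_simp
    linear_combination -this

end JW
section JW
variable {k : ℕ}

theorem jw_idem {n : ℕ} (hn : n ≤ k + 1) : lcomp (delta k) (jw k n) (jw k n) = jw k n := by
  cases n with
  | zero => exact lid_lcomp _ _
  | succ n => exact (jw_aux n (by omega)).1

/-- A cap-cup below a Jones-Wenzl projection vanishes. -/
theorem capCup_jw (a b : ℕ) (h : a + 2 + b ≤ k + 1) :
    lcomp (delta k) (ltensor (ltensor (lid a) capCup) (lid b)) (jw k (a + 2 + b)) = 0 := by
  induction b with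
  | zero =>
    rw [ltensor_zero]
    obtain ⟨h1, h2, h3, h4⟩ := jw_aux (k := k) a (by omega)
    have hq1 := qint_ne_zero k (a + 1) (by omega) (by omega)
    have hq2 := qint_ne_zero k (a + 2) (by omega) (by omega)
    have hgh : lcomp (delta k) (ltensor (jw k a) (lid 2)) (ltensor (jw k (a + 1)) (lid 1)) =
        ltensor (jw k (a + 1)) (lid 1) := by
      have hh' : ltensor (jw k a) (lid 2) = ltensor (ltensor (jw k a) (lid 1)) (lid 1) :=
        ltensor_lid_succ _ 1
      rw [hh']
      refine (ltensor_lcomp (delta k) (ltensor (jw k a) (lid 1)) (lid 1) (jw k (a + 1))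
        (lid 1)).trans ?_
      rw [h3, lid_lcomp]
    have hc : lcomp (delta k) (ltensor (jw k a) (lid 2)) (ltensor (lid a) capCup) =
        lcomp (delta k) (ltensor (lid a) capCup) (ltensor (jw k a) (lid 2)) := by
      rw [ltensor_lcomp, ltensor_lcomp]
      simp only [lid_lcomp, lcomp_lid]
    have hf : jw k (a + 2) = ltensor (jw k (a + 1)) (lid 1) + (qint k (a + 1) / qint k (a + 2)) •
      lcomp (delta k) (lcomp (delta k) (ltensor (jw k (a + 1)) (lid 1)) (ltensor (lid a) capCup))
        (ltensor (jw k (a + 1)) (lid 1)) := rfl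
    change lcomp (delta k) (ltensor (lid a) capCup) (jw k (a + 2)) = 0
    rw [hf, map_add, map_smul, ← lcomp_assoc, ← lcomp_assoc, h4, map_smul, LinearMap.smul_apply,
      hc]
    rw [lcomp_assoc _ (ltensor (lid a) capCup) (ltensor (jw k a) (lid 2))]
    have e : lcomp (delta k) (ltensor (lid a) capCup) (lcomp (delta k) (ltensor (jw k a) (lid 2))
      (ltensor (jw k (a + 1)) (lid 1))) =
      lcomp (delta k) (ltensor (lid a) capCup) (ltensor (jw k (a + 1)) (lid 1)) :=
      congrArg _ hgh
    refine (congrArg (fun x => _ + _ • _ • x) e).trans ?_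
    rw [smul_smul]
    have : qint k (a + 1) / qint k (a + 2) * -(qint k (a + 2) / qint k (a + 1)) = -1 := by
      field_simp
    rw [this]
    module
  | succ b ih =>
    obtain ⟨h1, h2, h3, h4⟩ := jw_aux (k := k) (a + 2 + b) (by omega)
    have hh' : ltensor (ltensor (lid a) capCup) (lid (b + 1)) =
      ltensor (ltensor (ltensor (lid a) capCup) (lid b)) (lid 1) := ltensor_lid_succ _ b
    change lcomp (delta k) _ (jw k (a + 2 + b + 1)) = 0
    rw [hh', ← h3]
    refine (lcomp_assoc _ _ _ _).symm.trans ?_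
    have e : lcomp (delta k) (ltensor (ltensor (ltensor (lid a) capCup) (lid b)) (lid 1))
        (ltensor (jw k (a + 2 + b)) (lid 1)) = 0 := by
      rw [ltensor_lcomp, ih (by omega)]; simp
    rw [e]; simp

/-- Absorption on the left strands. -/
theorem jw_absorb_left (a b : ℕ) (h : a + b ≤ k + 1) :
    lcomp (delta k) (ltensor (jw k a) (lid b)) (jw k (a + b)) = jw k (a + b) := by
  induction b with
  | zero => rw [ltensor_zero]; exact jw_idem h
  | succ b ih =>
    obtain ⟨h1, h2, h3, h4⟩ := jw_aux (k := k) (a + b) (by omega)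
    have hh' : ltensor (jw k a) (lid (b + 1)) =
      ltensor (ltensor (jw k a) (lid b)) (lid 1) := ltensor_lid_succ _ b
    change lcomp (delta k) _ (jw k (a + b + 1)) = jw k (a + b + 1)
    rw [hh', ← h3]
    refine (lcomp_assoc _ _ _ _).symm.trans ?_
    have e : lcomp (delta k) (ltensor (ltensor (jw k a) (lid b)) (lid 1))
        (ltensor (jw k (a + b)) (lid 1)) = ltensor (jw k (a + b)) (lid 1) := by
      rw [ltensor_lcomp, ih (by omega), lid_lcomp]
    rw [e]

/-- Absorption on the right strands. -/
theorem jw_absorb_right (a b : ℕ) (h : a + b ≤ k + 1) :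
    lcomp (delta k) (ltensor (lid a) (jw k b)) (jw k (a + b)) = jw k (a + b) := by
  induction b with
  | zero =>
    change lcomp (delta k) (ltensor (lid a) (lid 0)) _ = _
    rw [ltensor_lid, lid_lcomp]
  | succ b ih =>
    cases b with
    | zero =>
      change lcomp (delta k) (ltensor (lid a) (lid 1)) _ = _
      rw [ltensor_lid, lid_lcomp]
    | succ b =>
      obtain ⟨h1, h2, h3, h4⟩ := jw_aux (k := k) (a + (b + 1)) (by omega)
      set N := jw k (a + (b + 1) + 1) with hN
      set x : LinHom (b + 2) (b + 2) := ltensor (jw k (b + 1)) (lid 1) with hx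
      have hx' : ltensor (lid a) x = ltensor (ltensor (lid a) (jw k (b + 1))) (lid 1) :=
        (ltensor_assoc (lid a) (jw k (b + 1)) (lid 1)).symm
      have e1 : lcomp (delta k) (ltensor (lid a) x) N = N := by
        rw [hx', ← h3]
        refine (lcomp_assoc _ _ _ _).symm.trans ?_
        have e : lcomp (delta k) (ltensor (ltensor (lid a) (jw k (b + 1))) (lid 1))
            (ltensor (jw k (a + (b + 1))) (lid 1)) = ltensor (jw k (a + (b + 1))) (lid 1) := by
          rw [ltensor_lcomp, ih (by omega), lid_lcomp]
        rw [e]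
      have e2 : lcomp (delta k) (ltensor (lid a) (ltensor (lid b) capCup)) N = 0 := by
        have h5 := capCup_jw (k := k) (a + b) 0 (by omega)
        rw [ltensor_zero, ← ltensor_lid] at h5
        have h6 := ltensor_assoc (lid a) (lid b) capCup
        rw [← h6]
        exact h5
      have hf : jw k (b + 1 + 1) = x + (qint k (b + 1) / qint k (b + 2)) •
        lcomp (delta k) (lcomp (delta k) x (ltensor (lid b) capCup)) x := rfl
      have e3 : ∀ y z : LinHom (b + 2) (b + 2), ltensor (lid a) (lcomp (delta k) y z) =
          lcomp (delta k) (ltensor (lid a) y) (ltensor (lid a) z) := by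
        intro y z; rw [ltensor_lcomp, lid_lcomp]
      change lcomp (delta k) (ltensor (lid a) (jw k (b + 1 + 1))) N = N
      rw [hf, map_add, map_smul, e3, e3, map_add, LinearMap.add_apply, map_smul,
        LinearMap.smul_apply]
      have e4 : lcomp (delta k) (lcomp (delta k) (lcomp (delta k) (ltensor (lid a) x)
        (ltensor (lid a) (ltensor (lid b) capCup))) (ltensor (lid a) x)) N = 0 := by
        refine (lcomp_assoc _ _ _ _).trans ?_
        refine (congrArg _ e1).trans ?_
        refine (lcomp_assoc _ _ _ _).trans ?_
        refine (congrArg _ e2).trans ?_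
        exact map_zero _
      refine (congrArg₂ (fun x y => x + _ • y) e1 e4).trans ?_
      rw [smul_zero, add_zero]

end JW
open CategoryTheory MonoidalCategory

theorem add_lcomp {m n p : ℕ} (δ : ℂ) (f g : LinHom m n) (h : LinHom n p) :
    lcomp δ (f + g) h = lcomp δ f h + lcomp δ g h := by simp

theorem lcomp_add {m n p : ℕ} (δ : ℂ) (f : LinHom m n) (g h : LinHom n p) :
    lcomp δ f (g + h) = lcomp δ f g + lcomp δ f h := by simp

theorem add_ltensor {m n m' n' : ℕ} (f g : LinHom m n) (h : LinHom m' n') :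
    ltensor (f + g) h = ltensor f h + ltensor g h := by simp

theorem ltensor_add {m n m' n' : ℕ} (f : LinHom m n) (g h : LinHom m' n') :
    ltensor f (g + h) = ltensor f g + ltensor f h := by simp

theorem lzero_ltensor {m n m' n' : ℕ} (h : LinHom m' n') :
    ltensor (0 : LinHom m n) h = 0 := by simp

theorem ltensor_lzero {m n m' n' : ℕ} (f : LinHom m n) :
    ltensor f (0 : LinHom m' n') = 0 := by simp

/-- The linear category of planar diagrams in which every loop equals `δ`:
the objects are the natural numbers. -/
structure Strands (k : ℕ) where
  n : ℕ

namespace Strands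
variable {k : ℕ}

noncomputable instance : Category (Strands k) where
  Hom X Y := LinHom X.n Y.n
  id X := lid X.n
  comp f g := lcomp (delta k) f g
  id_comp f := lid_lcomp _ f
  comp_id f := lcomp_lid _ f
  assoc f g h := lcomp_assoc _ f g h

noncomputable instance : Preadditive (Strands k) where
  homGroup X Y := inferInstanceAs (AddCommGroup (LinHom X.n Y.n))
  add_comp _ _ _ f g h := add_lcomp (delta k) f g h
  comp_add _ _ _ f g h := lcomp_add (delta k) f g h

theorem cast_comm {X X' Y Y' : Strands k} (hX : X = X') (hY : Y = Y') (f : X ⟶ Y) (g : X' ⟶ Y')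
    (h : lcast (congrArg n hX) (congrArg n hY) f = g) :
    f ≫ eqToHom hY = eqToHom hX ≫ g := by
  subst hX hY
  rw [eqToHom_refl, eqToHom_refl, Category.comp_id, Category.id_comp]
  exact h

theorem tensor_eqToHom {X X' Y Y' : Strands k} (hX : X = X') (hY : Y = Y') :
    ltensor (eqToHom hX : X ⟶ X') (eqToHom hY : Y ⟶ Y') =
      (eqToHom (congrArg₂ (fun a b => (⟨a.n + b.n⟩ : Strands k)) hX hY) :
        (⟨X.n + Y.n⟩ : Strands k) ⟶ ⟨X'.n + Y'.n⟩) := by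
  subst hX hY
  exact ltensor_lid

noncomputable instance : MonoidalCategory (Strands k) where
  tensorObj X Y := ⟨X.n + Y.n⟩
  tensorUnit := ⟨0⟩
  tensorHom f g := ltensor f g
  whiskerLeft X _ _ f := ltensor (lid X.n) f
  whiskerRight f Y := ltensor f (lid Y.n)
  associator X Y Z := eqToIso (congrArg Strands.mk (Nat.add_assoc _ _ _))
  leftUnitor X := eqToIso (congrArg Strands.mk (Nat.zero_add _))
  rightUnitor X := eqToIso (congrArg Strands.mk (Nat.add_zero _))
  tensorHom_def f g := by
    refine Eq.symm ((ltensor_lcomp (delta k) _ _ _ _).trans ?_)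
    rw [lid_lcomp, lcomp_lid]
  id_tensorHom_id X Y := ltensor_lid
  tensorHom_comp_tensorHom f g h i := ltensor_lcomp (delta k) _ _ _ _
  whiskerLeft_id X Y := ltensor_lid
  id_whiskerRight X Y := ltensor_lid
  associator_naturality f g h :=
    cast_comm (congrArg Strands.mk (Nat.add_assoc _ _ _)) (congrArg Strands.mk (Nat.add_assoc _ _ _)) _ _ (ltensor_assoc f g h)
  leftUnitor_naturality f :=
    cast_comm (congrArg Strands.mk (Nat.zero_add _)) (congrArg Strands.mk (Nat.zero_add _)) _ _ (zero_ltensor f)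
  rightUnitor_naturality f :=
    cast_comm (congrArg Strands.mk (Nat.add_zero _)) (congrArg Strands.mk (Nat.add_zero _)) _ _ (ltensor_zero f)
  pentagon W X Y Z := by
    have e1 := tensor_eqToHom (k := k) (X := ⟨W.n + X.n + Y.n⟩) (X' := ⟨W.n + (X.n + Y.n)⟩)
      (Y := Z) (by rw [Nat.add_assoc]) rfl
    have e2 := tensor_eqToHom (k := k) (Y := ⟨X.n + Y.n + Z.n⟩) (Y' := ⟨X.n + (Y.n + Z.n)⟩)
      (X := W) rfl (by rw [Nat.add_assoc])
    refine (congrArg₂ (fun x y => x ≫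
      eqToHom (congrArg Strands.mk (Nat.add_assoc W.n (X.n + Y.n) Z.n)) ≫ y) e1 e2).trans ?_
    simp
  triangle X Y := by
    have e1 := tensor_eqToHom (k := k) (X := ⟨X.n + 0⟩) (X' := X)
      (Y := Y) rfl rfl
    have e2 := tensor_eqToHom (k := k) (Y := ⟨0 + Y.n⟩) (Y' := Y)
      (X := X) rfl (by rw [Nat.zero_add])
    refine (congrArg (fun x =>
      eqToHom (congrArg Strands.mk (Nat.add_assoc X.n 0 Y.n)) ≫ x) e2).trans (Eq.trans ?_ e1.symm)
    simp

instance : MonoidalPreadditive (Strands k) where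
  whiskerLeft_zero {X Y Z} := ltensor_lzero (lid X.n)
  zero_whiskerRight {X Y Z} := lzero_ltensor (lid X.n)
  whiskerLeft_add {X Y Z} f g := ltensor_add (lid X.n) f g
  add_whiskerRight {X Y Z} f g := add_ltensor f g (lid X.n)

end Strands

/-! ### The monoidal structure on the additive completion -/

namespace MatMonoidal
universe v u
variable {C : Type u} [Category.{v} C] [Preadditive C]

/-- The entries of a morphism in the additive completion. -/
def ent {M N : Mat_ C} (f : M ⟶ N) (i : M.ι) (j : N.ι) : M.X i ⟶ N.X j := f i j

/-- The morphism in the additive completion with given entries. -/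
def ofEnt {M N : Mat_ C} (f : ∀ i j, M.X i ⟶ N.X j) : M ⟶ N := f

theorem ent_ofEnt {M N : Mat_ C} (f : ∀ i j, M.X i ⟶ N.X j) (i j) :
    ent (ofEnt f : M ⟶ N) i j = f i j := rfl

theorem ent_ext {M N : Mat_ C} {f g : M ⟶ N} (h : ∀ i j, ent f i j = ent g i j) : f = g :=
  Mat_.hom_ext f g h

theorem ent_comp {M N K : Mat_ C} (f : M ⟶ N) (g : N ⟶ K) (i k) :
    ent (f ≫ g) i k = ∑ j, ent f i j ≫ ent g j k := rfl

theorem ent_add {M N : Mat_ C} (f g : M ⟶ N) (i j) :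
    ent (f + g) i j = ent f i j + ent g i j := rfl

theorem ent_zero {M N : Mat_ C} (i j) : ent (0 : M ⟶ N) i j = 0 := rfl

/-- `g` has exactly one nonzero entry `φ i` in each row `i`, in the column `e i`. -/
structure IsMono {M N : Mat_ C} (g : M ⟶ N) (e : M.ι → N.ι) (φ : ∀ i, M.X i ⟶ N.X (e i)) :
    Prop where
  self : ∀ i, ent g i (e i) = φ i
  ne : ∀ i j, e i ≠ j → ent g i j = 0

theorem IsMono.ext {M N : Mat_ C} {g g' : M ⟶ N} {e : M.ι → N.ι} {φ : ∀ i, M.X i ⟶ N.X (e i)}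
    (h : IsMono g e φ) (h' : IsMono g' e φ) : g = g' := by
  apply ent_ext
  intro i j
  by_cases hij : e i = j
  · subst hij; rw [h.self, h'.self]
  · rw [h.ne _ _ hij, h'.ne _ _ hij]

theorem IsMono.comp_apply {M N K : Mat_ C} {g : M ⟶ N} {e : M.ι → N.ι}
    {φ : ∀ i, M.X i ⟶ N.X (e i)} (h : IsMono g e φ) (f : N ⟶ K) (i k) :
    ent (g ≫ f) i k = φ i ≫ ent f (e i) k := by
  rw [ent_comp, Finset.sum_eq_single (e i)]
  · rw [h.self]
  · intro j _ hj
    rw [h.ne _ _ hj.symm, Limits.zero_comp]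
  · intro h; exact (h (Finset.mem_univ _)).elim

theorem IsMono.apply_comp {M N K : Mat_ C} {g : M ⟶ N} {e : M.ι → N.ι}
    {φ : ∀ i, M.X i ⟶ N.X (e i)} (h : IsMono g e φ) (he : Function.Injective e) (f : K ⟶ M) (k i) :
    ent (f ≫ g) k (e i) = ent f k i ≫ φ i := by
  rw [ent_comp, Finset.sum_eq_single i]
  · rw [h.self]
  · intro j _ hj
    rw [h.ne _ _ (fun h => hj (he h)), Limits.comp_zero]
  · intro h; exact (h (Finset.mem_univ _)).elim

theorem isMono_id (M : Mat_ C) : IsMono (𝟙 M) (fun i => i) (fun i => 𝟙 (M.X i)) :=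
  ⟨fun i => Mat_.id_apply_self M i, fun i j h => Mat_.id_apply_of_ne M i j h⟩

theorem IsMono.comp {M N K : Mat_ C} {g : M ⟶ N} {e : M.ι → N.ι}
    {φ : ∀ i, M.X i ⟶ N.X (e i)} (h : IsMono g e φ) {g' : N ⟶ K} {e' : N.ι → K.ι}
    {φ' : ∀ i, N.X i ⟶ K.X (e' i)} (h' : IsMono g' e' φ') :
    IsMono (g ≫ g') (fun i => e' (e i)) (fun i => φ i ≫ φ' (e i)) := by
  constructor
  · intro i; rw [h.comp_apply, h'.self]
  · intro i j hij; rw [h.comp_apply, h'.ne _ _ hij, Limits.comp_zero]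

/-- The matrix of a bijection of index sets together with morphisms of the entries. -/
noncomputable def mono {M N : Mat_ C} (e : M.ι → N.ι) (φ : ∀ i, M.X i ⟶ N.X (e i)) : M ⟶ N :=
  open Classical in
  ofEnt fun i j => if h : e i = j then φ i ≫ eqToHom (congrArg N.X h) else 0

theorem isMono_mono {M N : Mat_ C} (e : M.ι → N.ι) (φ : ∀ i, M.X i ⟶ N.X (e i)) :
    IsMono (mono e φ) e φ := by
  constructor
  · intro i; rw [mono, ent_ofEnt, dif_pos rfl, eqToHom_refl, Category.comp_id]
  · intro i j h; rw [mono, ent_ofEnt, dif_neg h]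

/-- A bijection of index sets with isomorphisms of the entries gives an isomorphism. -/
noncomputable def monoIso {M N : Mat_ C} (e : M.ι → N.ι) (e' : N.ι → M.ι)
    (h : ∀ i, e' (e i) = i) (h' : ∀ j, e (e' j) = j) (φ : ∀ i, M.X i ≅ N.X (e i)) : M ≅ N where
  hom := mono e fun i => (φ i).hom
  inv := mono e' fun j => eqToHom (congrArg N.X (h' j).symm) ≫ (φ (e' j)).inv
  hom_inv_id := by
    have key := (isMono_mono e fun i => (φ i).hom).comp
      (isMono_mono e' fun j => eqToHom (congrArg N.X (h' j).symm) ≫ (φ (e' j)).inv)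
    apply ent_ext
    intro i j
    by_cases hij : i = j
    · subst hij
      rw [(isMono_id M).self]
      have h2 : ∀ i' (hi : i' = i), (φ i).hom ≫ eqToHom (by rw [hi]) ≫ (φ i').inv ≫
          eqToHom (congrArg M.X hi) = 𝟙 _ := by
        rintro _ rfl; simp
      rw [(isMono_mono e fun i => (φ i).hom).comp_apply, mono, ent_ofEnt, dif_pos (h i),
        Category.assoc]
      exact h2 _ (h i)
    · rw [(isMono_id M).ne _ _ hij, key.ne _ _ (by rw [h]; exact hij)]
  inv_hom_id := by
    have key := (isMono_mono e' fun j => eqToHom (congrArg N.X (h' j).symm) ≫ (φ (e' j)).inv).comp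
      (isMono_mono e fun i => (φ i).hom)
    apply ent_ext
    intro i j
    by_cases hij : i = j
    · subst hij
      rw [(isMono_id N).self, (isMono_mono e' fun j => eqToHom (congrArg N.X (h' j).symm) ≫
        (φ (e' j)).inv).comp_apply, mono, ent_ofEnt, dif_pos (h' i)]
      simp
    · rw [(isMono_id N).ne _ _ hij, key.ne _ _ (by rw [h']; exact hij)]

variable [MonoidalCategory C] [MonoidalPreadditive C]

/-- Tensor product of objects: all pairwise tensor products. -/
abbrev tobj (M N : Mat_ C) : Mat_ C := ⟨M.ι × N.ι, fun p => M.X p.1 ⊗ N.X p.2⟩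

/-- Tensor product of matrices of morphisms. -/
def tens {M N M' N' : Mat_ C} (f : M ⟶ N) (g : M' ⟶ N') : tobj M M' ⟶ tobj N N' :=
  ofEnt fun p q => ent f p.1 q.1 ⊗ₘ ent g p.2 q.2

theorem ent_tens {M N M' N' : Mat_ C} (f : M ⟶ N) (g : M' ⟶ N') (p q) :
    ent (tens f g) p q = ent f p.1 q.1 ⊗ₘ ent g p.2 q.2 := rfl

theorem tens_comp {M N K M' N' K' : Mat_ C} (f : M ⟶ N) (g : M' ⟶ N') (f' : N ⟶ K) (g' : N' ⟶ K') :
    tens f g ≫ tens f' g' = tens (f ≫ f') (g ≫ g') := by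
  apply ent_ext
  intro p q
  rw [ent_comp, ent_tens, ent_comp, ent_comp, sum_tensor]
  refine (Fintype.sum_prod_type _).trans ?_
  refine Finset.sum_congr rfl fun i _ => ?_
  rw [tensor_sum]
  refine Finset.sum_congr rfl fun j _ => ?_
  exact tensorHom_comp_tensorHom _ _ _ _

theorem IsMono.tens {M N M' N' : Mat_ C} {g : M ⟶ N} {e : M.ι → N.ι}
    {φ : ∀ i, M.X i ⟶ N.X (e i)} (h : IsMono g e φ) {g' : M' ⟶ N'} {e' : M'.ι → N'.ι}
    {φ' : ∀ i, M'.X i ⟶ N'.X (e' i)} (h' : IsMono g' e' φ') :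
    IsMono (tens g g') (fun p => (e p.1, e' p.2)) (fun p => φ p.1 ⊗ₘ φ' p.2) := by
  constructor
  · rintro ⟨i, i'⟩
    rw [ent_tens, h.self, h'.self]
  · rintro ⟨i, i'⟩ ⟨j, j'⟩ hij
    rw [ent_tens]
    by_cases h1 : e i = j
    · have h2 : e' i' ≠ j' := fun h2 => hij (Prod.ext h1 h2)
      rw [h'.ne _ _ h2, MonoidalPreadditive.tensor_zero]
    · rw [h.ne _ _ h1, MonoidalPreadditive.zero_tensor]

theorem isMono_whiskerLeft (L : Mat_ C) {M N : Mat_ C} {g : M ⟶ N} {e : M.ι → N.ι}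
    {φ : ∀ i, M.X i ⟶ N.X (e i)} (h : IsMono g e φ) :
    IsMono (tens (𝟙 L) g) (fun p => (p.1, e p.2)) (fun p => L.X p.1 ◁ φ p.2) := by
  have := (isMono_id L).tens h
  simp only [id_tensorHom] at this
  exact this

theorem isMono_whiskerRight (L : Mat_ C) {M N : Mat_ C} {g : M ⟶ N} {e : M.ι → N.ι}
    {φ : ∀ i, M.X i ⟶ N.X (e i)} (h : IsMono g e φ) :
    IsMono (tens g (𝟙 L)) (fun p => (e p.1, p.2)) (fun p => φ p.1 ▷ L.X p.2) := by
  have := h.tens (isMono_id L)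
  simp only [tensorHom_id] at this
  exact this

theorem tens_id (M M' : Mat_ C) : tens (𝟙 M) (𝟙 M') = 𝟙 (tobj M M') := by
  have h := isMono_whiskerLeft M (isMono_id M')
  simp only [whiskerLeft_id] at h
  exact h.ext (isMono_id _)

/-- The associativity isomorphism. -/
noncomputable def assoc (L M N : Mat_ C) : tobj (tobj L M) N ≅ tobj L (tobj M N) :=
  monoIso (fun p => (p.1.1, (p.1.2, p.2))) (fun p => ((p.1, p.2.1), p.2.2)) (fun _ => rfl)
    (fun _ => rfl) fun _ => α_ _ _ _

/-- The left unit isomorphism. -/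
noncomputable def lunit (M : Mat_ C) : tobj ⟨Unit, fun _ => 𝟙_ C⟩ M ≅ M :=
  monoIso (fun p => p.2) (fun p => ((), p)) (fun _ => rfl) (fun _ => rfl) fun _ => λ_ _

/-- The right unit isomorphism. -/
noncomputable def runit (M : Mat_ C) : tobj M ⟨Unit, fun _ => 𝟙_ C⟩ ≅ M :=
  monoIso (fun p => p.1) (fun p => (p, ())) (fun _ => rfl) (fun _ => rfl) fun _ => ρ_ _

theorem isMono_assoc (L M N : Mat_ C) : IsMono (assoc L M N).hom (fun p => (p.1.1, (p.1.2, p.2)))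
    (fun p => (α_ (L.X p.1.1) (M.X p.1.2) (N.X p.2)).hom) := isMono_mono _ _

theorem isMono_lunit (M : Mat_ C) : IsMono (lunit M).hom (fun p => p.2)
    (fun p => (λ_ (M.X p.2)).hom) := isMono_mono _ _

theorem isMono_runit (M : Mat_ C) : IsMono (runit M).hom (fun p => p.1)
    (fun p => (ρ_ (M.X p.1)).hom) := isMono_mono _ _

theorem ent_id_unit (i j : Unit) :
    ent (𝟙 (⟨Unit, fun _ => 𝟙_ C⟩ : Mat_ C)) i j = 𝟙 (𝟙_ C) :=
  (isMono_id (⟨Unit, fun _ => 𝟙_ C⟩ : Mat_ C)).self i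

theorem assoc_nat {L M N L' M' N' : Mat_ C} (f : L ⟶ L') (g : M ⟶ M') (h : N ⟶ N') :
    tens (tens f g) h ≫ (assoc L' M' N').hom = (assoc L M N).hom ≫ tens f (tens g h) := by
  apply ent_ext
  rintro p ⟨a, b, c⟩
  refine ((isMono_assoc L' M' N').apply_comp ?_ _ p ((a, b), c)).trans
    (Eq.trans ?_ ((isMono_assoc L M N).comp_apply _ _ _).symm)
  · rintro ⟨⟨a, b⟩, c⟩ ⟨⟨a', b'⟩, c'⟩ h
    simp only [Prod.mk.injEq] at h
    obtain ⟨rfl, rfl, rfl⟩ := h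
    rfl
  · exact associator_naturality _ _ _

theorem lunit_nat {M N : Mat_ C} (f : M ⟶ N) :
    tens (𝟙 (⟨Unit, fun _ => 𝟙_ C⟩ : Mat_ C)) f ≫ (lunit N).hom = (lunit M).hom ≫ f := by
  apply ent_ext
  rintro p b
  refine ((isMono_lunit N).apply_comp ?_ _ p ((), b)).trans
    (Eq.trans ?_ ((isMono_lunit M).comp_apply _ _ _).symm)
  · rintro ⟨_, b⟩ ⟨_, b'⟩ h
    simp only at h
    subst h
    rfl
  · rw [ent_tens, ent_id_unit, id_tensorHom]
    exact leftUnitor_naturality _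

theorem runit_nat {M N : Mat_ C} (f : M ⟶ N) :
    tens f (𝟙 (⟨Unit, fun _ => 𝟙_ C⟩ : Mat_ C)) ≫ (runit N).hom = (runit M).hom ≫ f := by
  apply ent_ext
  rintro p b
  refine ((isMono_runit N).apply_comp ?_ _ p (b, ())).trans
    (Eq.trans ?_ ((isMono_runit M).comp_apply _ _ _).symm)
  · rintro ⟨b, _⟩ ⟨b', _⟩ h
    simp only at h
    subst h
    rfl
  · rw [ent_tens, ent_id_unit, tensorHom_id]
    exact rightUnitor_naturality _

theorem pent (W X Y Z : Mat_ C) :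
    tens (assoc W X Y).hom (𝟙 Z) ≫ (assoc W (tobj X Y) Z).hom ≫ tens (𝟙 W) (assoc X Y Z).hom =
      (assoc (tobj W X) Y Z).hom ≫ (assoc W X (tobj Y Z)).hom := by
  have h1 := (isMono_whiskerRight Z (isMono_assoc W X Y)).comp
    ((isMono_assoc W (tobj X Y) Z).comp (isMono_whiskerLeft W (isMono_assoc X Y Z)))
  have h2 := (isMono_assoc (tobj W X) Y Z).comp (isMono_assoc W X (tobj Y Z))
  simp only [pentagon] at h1
  exact h1.ext h2

theorem tri (X Y : Mat_ C) :
    (assoc X ⟨Unit, fun _ => 𝟙_ C⟩ Y).hom ≫ tens (𝟙 X) (lunit Y).hom =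
      tens (runit X).hom (𝟙 Y) := by
  have h1 := (isMono_assoc X ⟨Unit, fun _ => 𝟙_ C⟩ Y).comp (isMono_whiskerLeft X (isMono_lunit Y))
  have h2 := isMono_whiskerRight Y (isMono_runit X)
  simp only [triangle] at h1
  exact h1.ext h2

noncomputable instance : MonoidalCategory (Mat_ C) where
  tensorObj M N := tobj M N
  tensorUnit := ⟨Unit, fun _ => 𝟙_ C⟩
  tensorHom f g := tens f g
  whiskerLeft M _ _ f := tens (𝟙 M) f
  whiskerRight f M := tens f (𝟙 M)
  associator L M N := assoc L M N
  leftUnitor M := lunit M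
  rightUnitor M := runit M
  tensorHom_def f g := by rw [tens_comp, Category.id_comp, Category.comp_id]
  id_tensorHom_id M N := tens_id M N
  tensorHom_comp_tensorHom f g h i := tens_comp f g h i
  whiskerLeft_id M N := tens_id M N
  id_whiskerRight M N := tens_id M N
  associator_naturality f g h := assoc_nat f g h
  leftUnitor_naturality f := lunit_nat f
  rightUnitor_naturality f := runit_nat f
  pentagon W X Y Z := pent W X Y Z
  triangle X Y := tri X Y

theorem tens_add {M N M' N' : Mat_ C} (f : M ⟶ N) (g h : M' ⟶ N') :
    tens f (g + h) = tens f g + tens f h := by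
  apply ent_ext
  intro p q
  rw [ent_tens, ent_add, ent_add, ent_tens, ent_tens, MonoidalPreadditive.tensor_add]

theorem add_tens {M N M' N' : Mat_ C} (f g : M ⟶ N) (h : M' ⟶ N') :
    tens (f + g) h = tens f h + tens g h := by
  apply ent_ext
  intro p q
  rw [ent_tens, ent_add, ent_add, ent_tens, ent_tens, MonoidalPreadditive.add_tensor]

theorem tens_zero {M N M' N' : Mat_ C} (f : M ⟶ N) :
    tens f (0 : M' ⟶ N') = 0 := by
  apply ent_ext
  intro p q
  rw [ent_tens, ent_zero, ent_zero, MonoidalPreadditive.tensor_zero]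

theorem zero_tens {M N M' N' : Mat_ C} (h : M' ⟶ N') :
    tens (0 : M ⟶ N) h = 0 := by
  apply ent_ext
  intro p q
  rw [ent_tens, ent_zero, ent_zero, MonoidalPreadditive.zero_tensor]

instance : MonoidalPreadditive (Mat_ C) where
  whiskerLeft_zero := tens_zero _
  zero_whiskerRight := zero_tens _
  whiskerLeft_add f g := tens_add _ f g
  add_whiskerRight f g := add_tens f g _

end MatMonoidal

/-! ### The monoidal structure on the idempotent completion -/

namespace KaroubiMonoidal
open Idempotents
universe v u
variable {C : Type u} [Category.{v} C]

/-- An isomorphism of underlying objects that commutes with the idempotents. -/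
def karIso {P Q : Karoubi C} (φ : P.X ≅ Q.X) (h : P.p ≫ φ.hom = φ.hom ≫ Q.p) : P ≅ Q where
  hom := ⟨P.p ≫ φ.hom, by rw [Category.assoc, ← h, ← Category.assoc, ← Category.assoc,
    P.idem, P.idem]⟩
  inv := ⟨Q.p ≫ φ.inv, by
    have h' : φ.inv ≫ P.p = Q.p ≫ φ.inv := by
      rw [Iso.inv_comp_eq, ← Category.assoc, ← h, Category.assoc, Iso.hom_inv_id,
        Category.comp_id]
    rw [Category.assoc, h', ← Category.assoc, ← Category.assoc, Q.idem, Q.idem]⟩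
  hom_inv_id := by
    apply Karoubi.hom_ext
    change (P.p ≫ φ.hom) ≫ Q.p ≫ φ.inv = P.p
    rw [Category.assoc, ← Category.assoc φ.hom, ← h, Category.assoc, Iso.hom_inv_id,
      Category.comp_id, P.idem]
  inv_hom_id := by
    have h' : φ.inv ≫ P.p = Q.p ≫ φ.inv := by
      rw [Iso.inv_comp_eq, ← Category.assoc, ← h, Category.assoc, Iso.hom_inv_id,
        Category.comp_id]
    apply Karoubi.hom_ext
    change (Q.p ≫ φ.inv) ≫ P.p ≫ φ.hom = Q.p
    rw [Category.assoc, ← Category.assoc φ.inv, h', Category.assoc, Iso.inv_hom_id,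
      Category.comp_id, Q.idem]

variable [MonoidalCategory C]

/-- Tensor product of formal direct factors. -/
abbrev kobj (P Q : Karoubi C) : Karoubi C :=
  ⟨P.X ⊗ Q.X, P.p ⊗ₘ Q.p, by rw [tensorHom_comp_tensorHom, P.idem, Q.idem]⟩

/-- Tensor product of morphisms between formal direct factors. -/
def khom {P Q P' Q' : Karoubi C} (f : P ⟶ Q) (g : P' ⟶ Q') : kobj P P' ⟶ kobj Q Q' :=
  ⟨f.f ⊗ₘ g.f, by
    rw [tensorHom_comp_tensorHom, tensorHom_comp_tensorHom, f.comm, g.comm]⟩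

/-- The unit object. -/
abbrev kunit : Karoubi C := ⟨𝟙_ C, 𝟙 _, by rw [Category.comp_id]⟩

theorem khom_f {P Q P' Q' : Karoubi C} (f : P ⟶ Q) (g : P' ⟶ Q') :
    (khom f g).f = f.f ⊗ₘ g.f := rfl

/-- The associativity isomorphism. -/
def kassoc (P Q R : Karoubi C) : kobj (kobj P Q) R ≅ kobj P (kobj Q R) :=
  karIso (α_ P.X Q.X R.X) (associator_naturality _ _ _)

/-- The left unit isomorphism. -/
def klunit (P : Karoubi C) : kobj kunit P ≅ P :=
  karIso (λ_ P.X) (by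
    change (𝟙 _ ⊗ₘ P.p) ≫ _ = _
    rw [id_tensorHom]; exact leftUnitor_naturality _)

/-- The right unit isomorphism. -/
def krunit (P : Karoubi C) : kobj P kunit ≅ P :=
  karIso (ρ_ P.X) (by
    change (P.p ⊗ₘ 𝟙 _) ≫ _ = _
    rw [tensorHom_id]; exact rightUnitor_naturality _)

theorem kassoc_f (P Q R : Karoubi C) :
    (kassoc P Q R).hom.f = ((P.p ⊗ₘ Q.p) ⊗ₘ R.p) ≫ (α_ P.X Q.X R.X).hom := rfl

theorem kassoc_f' (P Q R : Karoubi C) :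
    (kassoc P Q R).hom.f = (α_ P.X Q.X R.X).hom ≫ (P.p ⊗ₘ (Q.p ⊗ₘ R.p)) := by
  rw [kassoc_f, associator_naturality]

theorem klunit_f (P : Karoubi C) :
    (klunit P).hom.f = (λ_ P.X).hom ≫ P.p := by
  change (𝟙 _ ⊗ₘ P.p) ≫ _ = _
  rw [id_tensorHom, leftUnitor_naturality]

theorem krunit_f (P : Karoubi C) :
    (krunit P).hom.f = (ρ_ P.X).hom ≫ P.p := by
  change (P.p ⊗ₘ 𝟙 _) ≫ _ = _
  rw [tensorHom_id, rightUnitor_naturality]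

theorem khom_comp {P Q R P' Q' R' : Karoubi C} (f : P ⟶ Q) (g : P' ⟶ Q') (f' : Q ⟶ R)
    (g' : Q' ⟶ R') : khom f g ≫ khom f' g' = khom (f ≫ f') (g ≫ g') := by
  apply Karoubi.hom_ext
  rw [Karoubi.comp_f, khom_f, khom_f, khom_f, tensorHom_comp_tensorHom]
  rfl

theorem kassoc_nat {P Q R P' Q' R' : Karoubi C} (f : P ⟶ P') (g : Q ⟶ Q') (h : R ⟶ R') :
    khom (khom f g) h ≫ (kassoc P' Q' R').hom = (kassoc P Q R).hom ≫ khom f (khom g h) := by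
  apply Karoubi.hom_ext
  rw [Karoubi.comp_f, Karoubi.comp_f, kassoc_f, kassoc_f', khom_f, khom_f, khom_f, khom_f,
    ← Category.assoc, tensorHom_comp_tensorHom, tensorHom_comp_tensorHom, Category.assoc,
    tensorHom_comp_tensorHom, tensorHom_comp_tensorHom]
  rw [Karoubi.comp_p, Karoubi.comp_p, Karoubi.comp_p, Karoubi.p_comp, Karoubi.p_comp,
    Karoubi.p_comp, associator_naturality]

theorem klunit_nat {P Q : Karoubi C} (f : P ⟶ Q) :
    khom (𝟙 kunit) f ≫ (klunit Q).hom = (klunit P).hom ≫ f := by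
  apply Karoubi.hom_ext
  rw [Karoubi.comp_f, Karoubi.comp_f, klunit_f, klunit_f, khom_f]
  change (𝟙 _ ⊗ₘ f.f) ≫ _ = _
  rw [id_tensorHom, ← Category.assoc, leftUnitor_naturality, Category.assoc, Category.assoc,
    Karoubi.comp_p, Karoubi.p_comp]

theorem krunit_nat {P Q : Karoubi C} (f : P ⟶ Q) :
    khom f (𝟙 kunit) ≫ (krunit Q).hom = (krunit P).hom ≫ f := by
  apply Karoubi.hom_ext
  rw [Karoubi.comp_f, Karoubi.comp_f, krunit_f, krunit_f, khom_f]
  change (f.f ⊗ₘ 𝟙 _) ≫ _ = _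
  rw [tensorHom_id, ← Category.assoc, rightUnitor_naturality, Category.assoc, Category.assoc,
    Karoubi.comp_p, Karoubi.p_comp]

theorem kpent (W X Y Z : Karoubi C) :
    khom (kassoc W X Y).hom (𝟙 Z) ≫ (kassoc W (kobj X Y) Z).hom ≫ khom (𝟙 W) (kassoc X Y Z).hom =
      (kassoc (kobj W X) Y Z).hom ≫ (kassoc W X (kobj Y Z)).hom := by
  apply Karoubi.hom_ext
  simp only [Karoubi.comp_f, khom_f, Karoubi.id_f]
  have e1 : (kassoc W X Y).hom.f ⊗ₘ Z.p = (((W.p ⊗ₘ X.p) ⊗ₘ Y.p) ⊗ₘ Z.p) ≫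
      ((α_ W.X X.X Y.X).hom ▷ Z.X) := by
    rw [← tensorHom_id, tensorHom_comp_tensorHom, Category.comp_id, kassoc_f]
  have e2 : W.p ⊗ₘ (kassoc X Y Z).hom.f = (W.p ⊗ₘ ((X.p ⊗ₘ Y.p) ⊗ₘ Z.p)) ≫
      (W.X ◁ (α_ X.X Y.X Z.X).hom) := by
    rw [← id_tensorHom, tensorHom_comp_tensorHom, Category.comp_id, kassoc_f]
  have e3 : (kassoc W (kobj X Y) Z).hom.f = (α_ W.X (X.X ⊗ Y.X) Z.X).hom ≫
    (W.p ⊗ₘ ((X.p ⊗ₘ Y.p) ⊗ₘ Z.p)) := kassoc_f' _ _ _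
  have e4 : (kassoc (kobj W X) Y Z).hom.f =
    (((W.p ⊗ₘ X.p) ⊗ₘ Y.p) ⊗ₘ Z.p) ≫ (α_ (W.X ⊗ X.X) Y.X Z.X).hom := rfl
  have e5 : (kassoc W X (kobj Y Z)).hom.f = (α_ W.X X.X (Y.X ⊗ Z.X)).hom ≫
    (W.p ⊗ₘ (X.p ⊗ₘ (Y.p ⊗ₘ Z.p))) := kassoc_f' _ _ _
  have e6 : (W.p ⊗ₘ ((X.p ⊗ₘ Y.p) ⊗ₘ Z.p)) ≫ (W.X ◁ (α_ X.X Y.X Z.X).hom) =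
      (W.X ◁ (α_ X.X Y.X Z.X).hom) ≫ (W.p ⊗ₘ (X.p ⊗ₘ (Y.p ⊗ₘ Z.p))) := by
    rw [← id_tensorHom, tensorHom_comp_tensorHom, tensorHom_comp_tensorHom,
      associator_naturality, Category.comp_id, Category.id_comp]
  have e7 : (W.p ⊗ₘ (X.p ⊗ₘ (Y.p ⊗ₘ Z.p))) ≫ (W.p ⊗ₘ (X.p ⊗ₘ (Y.p ⊗ₘ Z.p))) =
      (W.p ⊗ₘ (X.p ⊗ₘ (Y.p ⊗ₘ Z.p))) := by
    simp only [tensorHom_comp_tensorHom, Karoubi.idem]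
  rw [e1, e2, e3, e4, e5, e6]
  simp only [Category.assoc]
  rw [← Category.assoc (W.p ⊗ₘ ((X.p ⊗ₘ Y.p) ⊗ₘ Z.p)), e6, Category.assoc, e7]
  rw [← pentagon_assoc]

theorem ktri (X Y : Karoubi C) :
    (kassoc X kunit Y).hom ≫ khom (𝟙 X) (klunit Y).hom = khom (krunit X).hom (𝟙 Y) := by
  apply Karoubi.hom_ext
  simp only [Karoubi.comp_f, khom_f, Karoubi.id_f]
  have e1 : X.p ⊗ₘ (klunit Y).hom.f = (X.X ◁ (λ_ Y.X).hom) ≫ (X.p ⊗ₘ Y.p) := by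
    rw [← id_tensorHom, tensorHom_comp_tensorHom, Category.id_comp, klunit_f]
  have e2 : (krunit X).hom.f ⊗ₘ Y.p = ((ρ_ X.X).hom ▷ Y.X) ≫ (X.p ⊗ₘ Y.p) := by
    rw [← tensorHom_id, tensorHom_comp_tensorHom, Category.id_comp, krunit_f]
  have e3 : (kassoc X kunit Y).hom.f = (α_ X.X (𝟙_ C) Y.X).hom ≫ (X.p ⊗ₘ (𝟙 _ ⊗ₘ Y.p)) :=
    kassoc_f' _ _ _
  have e4 : (X.p ⊗ₘ (𝟙 (𝟙_ C) ⊗ₘ Y.p)) ≫ (X.X ◁ (λ_ Y.X).hom) =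
      (X.X ◁ (λ_ Y.X).hom) ≫ (X.p ⊗ₘ Y.p) := by
    rw [← id_tensorHom X.X, tensorHom_comp_tensorHom, tensorHom_comp_tensorHom, id_tensorHom,
      leftUnitor_naturality, Category.comp_id, Category.id_comp]
  rw [e1, e2, e3, Category.assoc, ← Category.assoc (X.p ⊗ₘ _), e4, Category.assoc,
    tensorHom_comp_tensorHom, X.idem, Y.idem, triangle_assoc]

instance : MonoidalCategory (Karoubi C) where
  tensorObj P Q := kobj P Q
  tensorUnit := kunit
  tensorHom f g := khom f g
  whiskerLeft P _ _ f := khom (𝟙 P) f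
  whiskerRight f P := khom f (𝟙 P)
  associator P Q R := kassoc P Q R
  leftUnitor P := klunit P
  rightUnitor P := krunit P
  tensorHom_def f g := by rw [khom_comp, Category.id_comp, Category.comp_id]
  id_tensorHom_id _ _ := rfl
  tensorHom_comp_tensorHom f g h i := khom_comp f g h i
  whiskerLeft_id _ _ := rfl
  id_whiskerRight _ _ := rfl
  associator_naturality f g h := kassoc_nat f g h
  leftUnitor_naturality f := klunit_nat f
  rightUnitor_naturality f := krunit_nat f
  pentagon W X Y Z := kpent W X Y Z
  triangle X Y := ktri X Y

variable [Preadditive C] [MonoidalPreadditive C]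

theorem khom_add {P Q P' Q' : Karoubi C} (f : P ⟶ Q) (g h : P' ⟶ Q') :
    khom f (g + h) = khom f g + khom f h := by
  apply Karoubi.hom_ext
  exact MonoidalPreadditive.tensor_add _ _ _

theorem add_khom {P Q P' Q' : Karoubi C} (f g : P ⟶ Q) (h : P' ⟶ Q') :
    khom (f + g) h = khom f h + khom g h := by
  apply Karoubi.hom_ext
  exact MonoidalPreadditive.add_tensor _ _ _

theorem khom_zero {P Q P' Q' : Karoubi C} (f : P ⟶ Q) : khom f (0 : P' ⟶ Q') = 0 := by
  apply Karoubi.hom_ext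
  exact MonoidalPreadditive.tensor_zero _

theorem zero_khom {P Q P' Q' : Karoubi C} (h : P' ⟶ Q') : khom (0 : P ⟶ Q) h = 0 := by
  apply Karoubi.hom_ext
  exact MonoidalPreadditive.zero_tensor _

instance : MonoidalPreadditive (Karoubi C) where
  whiskerLeft_zero := khom_zero _
  zero_whiskerRight := zero_khom _
  whiskerLeft_add f g := khom_add _ f g
  add_whiskerRight f g := add_khom f g _

end KaroubiMonoidal

/-! ### Quotient by the tensor ideal generated by a morphism -/

namespace TensorQuotient
universe v u
variable {C : Type u} [Category.{v} C] [Preadditive C] [MonoidalCategory C]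

/-- The ideal of morphisms generated by the morphisms satisfying `S`: the smallest family of
morphisms containing them and closed under addition, under composition with arbitrary morphisms
on both sides and under tensoring with identities on both sides. -/
inductive Ideal (S : ∀ ⦃X Y : C⦄, (X ⟶ Y) → Prop) : ∀ ⦃X Y : C⦄, (X ⟶ Y) → Prop
  | of {X Y : C} (f : X ⟶ Y) : S f → Ideal S f
  | zero (X Y : C) : Ideal S (0 : X ⟶ Y)
  | add {X Y : C} (f g : X ⟶ Y) : Ideal S f → Ideal S g → Ideal S (f + g)
  | precomp {X Y Z : C} (f : X ⟶ Y) (g : Y ⟶ Z) : Ideal S g → Ideal S (f ≫ g)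
  | postcomp {X Y Z : C} (f : X ⟶ Y) (g : Y ⟶ Z) : Ideal S f → Ideal S (f ≫ g)
  | whiskerLeft (X : C) {Y Z : C} (f : Y ⟶ Z) : Ideal S f → Ideal S (X ◁ f)
  | whiskerRight {X Y : C} (f : X ⟶ Y) (Z : C) : Ideal S f → Ideal S (f ▷ Z)

variable (S : ∀ ⦃X Y : C⦄, (X ⟶ Y) → Prop)

/-- Two morphisms are identified if their difference lies in the ideal. -/
def rel : HomRel C := fun _ _ f g => Ideal S (f - g)

variable {S}

theorem Ideal.neg {X Y : C} {f : X ⟶ Y} (h : Ideal S f) : Ideal S (-f) := by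
  have := Ideal.precomp (-𝟙 X) f h
  rwa [Preadditive.neg_comp, Category.id_comp] at this

variable (S)

instance : Congruence (rel S) where
  equivalence :=
    { refl := fun f => by rw [rel, sub_self]; exact Ideal.zero _ _
      symm := fun {f g} h => by rw [rel, ← neg_sub]; exact Ideal.neg h
      trans := fun {f g h} h1 h2 => by
        rw [rel, ← sub_add_sub_cancel f g h]; exact Ideal.add _ _ h1 h2 }
  comp_left f g g' h := by
    rw [rel, ← Preadditive.comp_sub]; exact Ideal.precomp _ _ h
  comp_right g h := by
    rw [rel, ← Preadditive.sub_comp]; exact Ideal.postcomp _ _ h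

theorem rel_add ⦃X Y : C⦄ (f₁ f₂ g₁ g₂ : X ⟶ Y) (h : rel S f₁ f₂) (h' : rel S g₁ g₂) :
    rel S (f₁ + g₁) (f₂ + g₂) := by
  rw [rel, add_sub_add_comm]; exact Ideal.add _ _ h h'

/-- The quotient of a monoidal preadditive category by the ideal generated by `S`. -/
abbrev Quo := CategoryTheory.Quotient (rel S)

noncomputable instance : Preadditive (Quo S) := Quotient.preadditive (rel S) (rel_add S)

/-- The quotient functor. -/
abbrev proj : C ⥤ Quo S := Quotient.functor (rel S)

instance : (proj S).Additive := Quotient.functor_additive (rel S) (rel_add S)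

theorem proj_eq {X Y : C} {f g : X ⟶ Y} : (proj S).map f = (proj S).map g ↔ Ideal S (f - g) :=
  Quotient.functor_map_eq_iff (rel S) f g

variable [MonoidalPreadditive C]

theorem whiskerLeft_sub' (X : C) {Y Z : C} (f g : Y ⟶ Z) : X ◁ (f - g) = X ◁ f - X ◁ g := by
  rw [eq_sub_iff_add_eq, ← MonoidalPreadditive.whiskerLeft_add, sub_add_cancel]

theorem sub_whiskerRight' {X Y : C} (f g : X ⟶ Y) (Z : C) : (f - g) ▷ Z = f ▷ Z - g ▷ Z := by
  rw [eq_sub_iff_add_eq, ← MonoidalPreadditive.add_whiskerRight, sub_add_cancel]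

/-- Left whiskering in the quotient. -/
def wl (X : Quo S) {Y Z : Quo S} (f : Y ⟶ Z) :
    (proj S).obj (X.as ⊗ Y.as) ⟶ (proj S).obj (X.as ⊗ Z.as) :=
  Quot.lift (fun g => (proj S).map (X.as ◁ g)) (by
    intro g g' h
    rw [HomRel.compClosure_iff_self] at h
    rw [proj_eq, ← whiskerLeft_sub']
    exact Ideal.whiskerLeft _ _ h) f

/-- Right whiskering in the quotient. -/
def wr {X Y : Quo S} (f : X ⟶ Y) (Z : Quo S) :
    (proj S).obj (X.as ⊗ Z.as) ⟶ (proj S).obj (Y.as ⊗ Z.as) :=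
  Quot.lift (fun g => (proj S).map (g ▷ Z.as)) (by
    intro g g' h
    rw [HomRel.compClosure_iff_self] at h
    rw [proj_eq, ← sub_whiskerRight']
    exact Ideal.whiskerRight _ _ h) f

theorem wl_map (X : C) {Y Z : C} (f : Y ⟶ Z) :
    wl S ((proj S).obj X) ((proj S).map f) = (proj S).map (X ◁ f) := rfl

theorem wr_map {X Y : C} (f : X ⟶ Y) (Z : C) :
    wr S ((proj S).map f) ((proj S).obj Z) = (proj S).map (f ▷ Z) := rfl

theorem exists_rep {X Y : C} (f : (proj S).obj X ⟶ (proj S).obj Y) :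
    ∃ g : X ⟶ Y, (proj S).map g = f := (proj S).map_surjective f

instance : MonoidalCategory (Quo S) where
  tensorObj X Y := (proj S).obj (X.as ⊗ Y.as)
  tensorUnit := (proj S).obj (𝟙_ C)
  whiskerLeft X _ _ f := wl S X f
  whiskerRight f Y := wr S f Y
  tensorHom f g := wr S f _ ≫ wl S _ g
  associator X Y Z := (proj S).mapIso (α_ X.as Y.as Z.as)
  leftUnitor X := (proj S).mapIso (λ_ X.as)
  rightUnitor X := (proj S).mapIso (ρ_ X.as)
  tensorHom_def _ _ := rfl
  id_tensorHom_id X Y := by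
    have h := congrArg (proj S).map (id_tensorHom_id X.as Y.as)
    rw [MonoidalCategory.tensorHom_def, CategoryTheory.Functor.map_comp, CategoryTheory.Functor.map_id] at h
    exact h
  tensorHom_comp_tensorHom {X₁ Y₁ Z₁ X₂ Y₂ Z₂} f₁ f₂ g₁ g₂ := by
    obtain ⟨f₁, rfl⟩ := exists_rep S (X := X₁.as) (Y := Y₁.as) f₁
    obtain ⟨f₂, rfl⟩ := exists_rep S (X := X₂.as) (Y := Y₂.as) f₂
    obtain ⟨g₁, rfl⟩ := exists_rep S (X := Y₁.as) (Y := Z₁.as) g₁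
    obtain ⟨g₂, rfl⟩ := exists_rep S (X := Y₂.as) (Y := Z₂.as) g₂
    have h := congrArg (proj S).map (tensorHom_comp_tensorHom f₁ f₂ g₁ g₂)
    simp only [MonoidalCategory.tensorHom_def, CategoryTheory.Functor.map_comp] at h
    exact h
  whiskerLeft_id X Y := by
    have h := congrArg (proj S).map (whiskerLeft_id X.as Y.as)
    rw [CategoryTheory.Functor.map_id] at h
    exact h
  id_whiskerRight X Y := by
    have h := congrArg (proj S).map (id_whiskerRight X.as Y.as)
    rw [CategoryTheory.Functor.map_id] at h
    exact h
  associator_naturality {X₁ X₂ X₃ Y₁ Y₂ Y₃} f₁ f₂ f₃ := by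
    obtain ⟨f₁, rfl⟩ := exists_rep S (X := X₁.as) (Y := Y₁.as) f₁
    obtain ⟨f₂, rfl⟩ := exists_rep S (X := X₂.as) (Y := Y₂.as) f₂
    obtain ⟨f₃, rfl⟩ := exists_rep S (X := X₃.as) (Y := Y₃.as) f₃
    have h := congrArg (proj S).map (associator_naturality f₁ f₂ f₃)
    simp only [MonoidalCategory.tensorHom_def] at h
    exact h
  leftUnitor_naturality {X Y} f := by
    obtain ⟨f, rfl⟩ := exists_rep S (X := X.as) (Y := Y.as) f
    have h := congrArg (proj S).map (leftUnitor_naturality f)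
    rw [CategoryTheory.Functor.map_comp, CategoryTheory.Functor.map_comp] at h
    exact h
  rightUnitor_naturality {X Y} f := by
    obtain ⟨f, rfl⟩ := exists_rep S (X := X.as) (Y := Y.as) f
    have h := congrArg (proj S).map (rightUnitor_naturality f)
    rw [CategoryTheory.Functor.map_comp, CategoryTheory.Functor.map_comp] at h
    exact h
  pentagon W X Y Z := by
    have h := congrArg (proj S).map (pentagon W.as X.as Y.as Z.as)
    simp only [CategoryTheory.Functor.map_comp] at h
    exact h
  triangle X Y := by
    have h := congrArg (proj S).map (triangle X.as Y.as)
    simp only [CategoryTheory.Functor.map_comp] at h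
    exact h

instance : MonoidalPreadditive (Quo S) where
  whiskerLeft_zero {X Y Z} := by
    have h := congrArg (proj S).map (MonoidalPreadditive.whiskerLeft_zero (X := X.as) (Y := Y.as) (Z := Z.as))
    exact h
  zero_whiskerRight {X Y Z} := by
    have h := congrArg (proj S).map (MonoidalPreadditive.zero_whiskerRight (X := X.as) (Y := Y.as) (Z := Z.as))
    exact h
  whiskerLeft_add {X Y Z} f g := by
    obtain ⟨f, rfl⟩ := exists_rep S (X := Y.as) (Y := Z.as) f
    obtain ⟨g, rfl⟩ := exists_rep S (X := Y.as) (Y := Z.as) g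
    have h := congrArg (proj S).map (MonoidalPreadditive.whiskerLeft_add (X := X.as) f g)
    exact h
  add_whiskerRight {X Y Z} f g := by
    obtain ⟨f, rfl⟩ := exists_rep S (X := Y.as) (Y := Z.as) f
    obtain ⟨g, rfl⟩ := exists_rep S (X := Y.as) (Y := Z.as) g
    have h := congrArg (proj S).map (MonoidalPreadditive.add_whiskerRight (X := X.as) f g)
    exact h

instance [Limits.HasFiniteBiproducts C] : Limits.HasFiniteBiproducts (Quo S) where
  out n :=
    { has_biproduct := fun F =>
        inferInstanceAs (Limits.HasBiproduct fun i => (proj S).obj (F i).as) }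

end TensorQuotient

/-! ### Graded algebra objects on finite biproducts -/

section Graded
open Limits
universe v u
variable {C : Type u} [Category.{v} C] [Preadditive C] [MonoidalCategory C]
  [MonoidalPreadditive C] [HasFiniteBiproducts C] {N : ℕ} (G : Fin N → C)

/-- The multiplication on `⨁ G` that is the sum of given maps `μ i j : G i ⊗ G j ⟶ G (i + j)`
for `i + j < N` and of zero maps for the other `i` and `j`. -/
noncomputable def gradedMul
    (μ : ∀ (i j : Fin N) (h : (i : ℕ) + j < N), G i ⊗ G j ⟶ G ⟨i + j, h⟩) :
    (⨁ G) ⊗ (⨁ G) ⟶ ⨁ G :=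
  ∑ i : Fin N, ∑ j : Fin N, if h : (i : ℕ) + j < N then
    (biproduct.π G i ⊗ₘ biproduct.π G j) ≫ μ i j h ≫ biproduct.ι G ⟨i + j, h⟩ else 0

variable {G}

theorem ext_left {X Y : C} {f g : (⨁ G) ⊗ X ⟶ Y}
    (h : ∀ i, biproduct.ι G i ▷ X ≫ f = biproduct.ι G i ▷ X ≫ g) : f = g := by
  have e : 𝟙 ((⨁ G) ⊗ X) = ∑ i, biproduct.π G i ▷ X ≫ biproduct.ι G i ▷ X := by
    rw [← id_whiskerRight, ← biproduct.total, sum_whiskerRight]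
    simp only [comp_whiskerRight]
  rw [← Category.id_comp f, ← Category.id_comp g, e, Preadditive.sum_comp, Preadditive.sum_comp]
  simp only [Category.assoc, h]

theorem ext_right {X Y : C} {f g : X ⊗ (⨁ G) ⟶ Y}
    (h : ∀ i, X ◁ biproduct.ι G i ≫ f = X ◁ biproduct.ι G i ≫ g) : f = g := by
  have e : 𝟙 (X ⊗ (⨁ G)) = ∑ i, X ◁ biproduct.π G i ≫ X ◁ biproduct.ι G i := by
    rw [← MonoidalCategory.whiskerLeft_id, ← biproduct.total, whiskerLeft_sum]
    simp only [MonoidalCategory.whiskerLeft_comp]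
  rw [← Category.id_comp f, ← Category.id_comp g, e, Preadditive.sum_comp, Preadditive.sum_comp]
  simp only [Category.assoc, h]

theorem tensor_ι_π (i j a b : Fin N) :
    (biproduct.ι G i ⊗ₘ biproduct.ι G j) ≫ (biproduct.π G a ⊗ₘ biproduct.π G b) =
      if h : i = a ∧ j = b then
        eqToHom (congrArg G h.1) ⊗ₘ eqToHom (congrArg G h.2) else 0 := by
  rw [tensorHom_comp_tensorHom, biproduct.ι_π, biproduct.ι_π]
  by_cases h1 : i = a
  · by_cases h2 : j = b
    · rw [dif_pos h1, dif_pos h2, dif_pos ⟨h1, h2⟩]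
    · rw [dif_neg h2, dif_neg (fun h : i = a ∧ j = b => h2 h.2), MonoidalPreadditive.tensor_zero]
  · rw [dif_neg h1, dif_neg (fun h : i = a ∧ j = b => h1 h.1), MonoidalPreadditive.zero_tensor]

theorem ι_gradedMul (μ : ∀ (i j : Fin N) (h : (i : ℕ) + j < N), G i ⊗ G j ⟶ G ⟨i + j, h⟩)
    (i j : Fin N) :
    (biproduct.ι G i ⊗ₘ biproduct.ι G j) ≫ gradedMul G μ =
      if h : (i : ℕ) + j < N then μ i j h ≫ biproduct.ι G ⟨i + j, h⟩ else 0 := by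
  rw [gradedMul, Preadditive.comp_sum, Finset.sum_eq_single i]
  · rw [Preadditive.comp_sum, Finset.sum_eq_single j]
    · split_ifs with h
      · rw [← Category.assoc, tensor_ι_π, dif_pos ⟨rfl, rfl⟩, eqToHom_refl, eqToHom_refl,
          id_tensorHom_id, Category.id_comp]
      · rw [comp_zero]
    · intro b _ hb
      split_ifs
      · rw [← Category.assoc, tensor_ι_π, dif_neg (fun h => hb h.2.symm), zero_comp]
      · rw [comp_zero]
    · intro h; exact (h (Finset.mem_univ _)).elim
  · intro a _ ha
    rw [Preadditive.comp_sum]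
    refine Finset.sum_eq_zero fun b _ => ?_
    split_ifs
    · rw [← Category.assoc, tensor_ι_π, dif_neg (fun h => ha h.1.symm), zero_comp]
    · rw [comp_zero]
  · intro h; exact (h (Finset.mem_univ _)).elim

theorem eqToHom_ι {a b : Fin N} (h : a = b) :
    eqToHom (congrArg G h) ≫ biproduct.ι G b = biproduct.ι G a := by
  subst h; simp

/-- Associative and unital families of multiplications give an algebra object `⨁ G`. -/
@[reducible] noncomputable def gradedMonObj
    (μ : ∀ (i j : Fin N) (h : (i : ℕ) + j < N), G i ⊗ G j ⟶ G ⟨i + j, h⟩)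
    (h0 : 0 < N) (u : 𝟙_ C ⟶ G ⟨0, h0⟩)
    (one_mul : ∀ (j : Fin N) (h : 0 + (j : ℕ) < N), u ▷ G j ≫ μ ⟨0, h0⟩ j h =
      (λ_ (G j)).hom ≫ eqToHom (congrArg G (Fin.ext (Nat.zero_add _).symm)))
    (mul_one : ∀ (i : Fin N) (h : (i : ℕ) + 0 < N), G i ◁ u ≫ μ i ⟨0, h0⟩ h =
      (ρ_ (G i)).hom ≫ eqToHom (congrArg G (Fin.ext (Nat.add_zero _).symm)))
    (assoc : ∀ (i j l : Fin N) (h : (i : ℕ) + j < N) (h' : (j : ℕ) + l < N)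
      (h1 : (i : ℕ) + j + l < N) (h2 : (i : ℕ) + (j + l) < N),
      μ i j h ▷ G l ≫ μ ⟨i + j, h⟩ l h1 =
        (α_ (G i) (G j) (G l)).hom ≫ G i ◁ μ j l h' ≫ μ i ⟨j + l, h'⟩ h2 ≫
          eqToHom (congrArg G (Fin.ext (Nat.add_assoc _ _ _).symm))) :
    MonObj (⨁ G) where
  one := u ≫ biproduct.ι G ⟨0, h0⟩
  mul := gradedMul G μ
  one_mul := by
    apply ext_right
    intro j
    have hj : (0 : ℕ) + j < N := by rw [Nat.zero_add]; exact j.2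
    have e : 𝟙_ C ◁ biproduct.ι G j ≫ (u ≫ biproduct.ι G ⟨0, h0⟩) ▷ (⨁ G) ≫ gradedMul G μ =
        u ▷ G j ≫ (biproduct.ι G ⟨0, h0⟩ ⊗ₘ biproduct.ι G j) ≫ gradedMul G μ := by
      simp only [MonoidalCategory.tensorHom_def', comp_whiskerRight, Category.assoc]
      rw [whisker_exchange_assoc]
    rw [e, ι_gradedMul, dif_pos hj, ← Category.assoc, one_mul, Category.assoc,
      eqToHom_ι (Fin.ext (Nat.zero_add _).symm), leftUnitor_naturality]
  mul_one := by
    apply ext_left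
    intro i
    have hi : (i : ℕ) + 0 < N := i.2
    have e : biproduct.ι G i ▷ 𝟙_ C ≫ (⨁ G) ◁ (u ≫ biproduct.ι G ⟨0, h0⟩) ≫ gradedMul G μ =
        G i ◁ u ≫ (biproduct.ι G i ⊗ₘ biproduct.ι G ⟨0, h0⟩) ≫ gradedMul G μ := by
      simp only [MonoidalCategory.tensorHom_def, MonoidalCategory.whiskerLeft_comp, Category.assoc]
      rw [whisker_exchange_assoc]
    rw [e, ι_gradedMul, dif_pos hi, ← Category.assoc, mul_one, Category.assoc,
      eqToHom_ι (b := ⟨i + ((⟨0, h0⟩ : Fin N) : ℕ), hi⟩) (Fin.ext (Nat.add_zero _).symm), rightUnitor_naturality]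
  mul_assoc := by
    have key : ∀ i j l : Fin N,
        ((biproduct.ι G i ⊗ₘ biproduct.ι G j) ⊗ₘ biproduct.ι G l) ≫
          gradedMul G μ ▷ (⨁ G) ≫ gradedMul G μ =
        ((biproduct.ι G i ⊗ₘ biproduct.ι G j) ⊗ₘ biproduct.ι G l) ≫
          (α_ (⨁ G) (⨁ G) (⨁ G)).hom ≫ (⨁ G) ◁ gradedMul G μ ≫ gradedMul G μ := by
      intro i j l
      have eL : ((biproduct.ι G i ⊗ₘ biproduct.ι G j) ⊗ₘ biproduct.ι G l) ≫
          gradedMul G μ ▷ (⨁ G) =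
          ((biproduct.ι G i ⊗ₘ biproduct.ι G j) ≫ gradedMul G μ) ⊗ₘ biproduct.ι G l := by
        rw [← tensorHom_id, tensorHom_comp_tensorHom, Category.comp_id]
      have eR : (biproduct.ι G i ⊗ₘ (biproduct.ι G j ⊗ₘ biproduct.ι G l)) ≫
          (⨁ G) ◁ gradedMul G μ =
          biproduct.ι G i ⊗ₘ ((biproduct.ι G j ⊗ₘ biproduct.ι G l) ≫ gradedMul G μ) := by
        rw [← id_tensorHom, tensorHom_comp_tensorHom, Category.comp_id]
      rw [← Category.assoc, eL, associator_naturality_assoc, ← Category.assoc (_ ⊗ₘ (_ ⊗ₘ _)), eR,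
        ι_gradedMul, ι_gradedMul]
      have sL : ∀ h : (i : ℕ) + j < N, (μ i j h ≫ biproduct.ι G ⟨i + j, h⟩) ⊗ₘ biproduct.ι G l =
          μ i j h ▷ G l ≫ (biproduct.ι G ⟨i + j, h⟩ ⊗ₘ biproduct.ι G l) := fun h => by
        rw [← tensorHom_id, tensorHom_comp_tensorHom, Category.id_comp]
      have sR : ∀ h : (j : ℕ) + l < N, biproduct.ι G i ⊗ₘ (μ j l h ≫ biproduct.ι G ⟨j + l, h⟩) =
          G i ◁ μ j l h ≫ (biproduct.ι G i ⊗ₘ biproduct.ι G ⟨j + l, h⟩) := fun h => by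
        rw [← id_tensorHom, tensorHom_comp_tensorHom, Category.id_comp]
      by_cases h : (i : ℕ) + j + l < N
      · have hij : (i : ℕ) + j < N := by omega
        have hjl : (j : ℕ) + l < N := by omega
        have h' : (i : ℕ) + (j + l) < N := by omega
        rw [dif_pos hij, dif_pos hjl, sL, sR, Category.assoc, Category.assoc, ι_gradedMul,
          ι_gradedMul, dif_pos (show ((⟨i + j, hij⟩ : Fin N) : ℕ) + l < N from h),
          dif_pos (show (i : ℕ) + ((⟨j + l, hjl⟩ : Fin N) : ℕ) < N from h'),
          ← Category.assoc (μ i j hij ▷ G l), assoc i j l hij hjl h h']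
        simp only [Category.assoc]
        rw [eqToHom_ι (Fin.ext (Nat.add_assoc _ _ _).symm)]
      · have zL : ((if h : (i : ℕ) + j < N then μ i j h ≫ biproduct.ι G ⟨i + j, h⟩ else 0) ⊗ₘ
            biproduct.ι G l) ≫ gradedMul G μ = 0 := by
          split_ifs with hij
          · rw [sL, Category.assoc, ι_gradedMul,
              dif_neg (show ¬ ((⟨i + j, hij⟩ : Fin N) : ℕ) + l < N from h), comp_zero]
          · rw [MonoidalPreadditive.zero_tensor, zero_comp]
        have zR : (biproduct.ι G i ⊗ₘ
            (if h : (j : ℕ) + l < N then μ j l h ≫ biproduct.ι G ⟨j + l, h⟩ else 0)) ≫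
            gradedMul G μ = 0 := by
          split_ifs with hjl
          · rw [sR, Category.assoc, ι_gradedMul,
              dif_neg (show ¬ (i : ℕ) + ((⟨j + l, hjl⟩ : Fin N) : ℕ) < N from
                fun h' => h (by rw [Nat.add_assoc]; exact h')), comp_zero]
          · rw [MonoidalPreadditive.tensor_zero, zero_comp]
        rw [zL, zR, comp_zero]
    apply ext_right
    intro l
    rw [← cancel_epi (α_ (⨁ G) (⨁ G) (G l)).inv]
    apply ext_left
    intro i
    rw [← cancel_epi (α_ (G i) (⨁ G) (G l)).hom]
    rw [← cancel_epi (𝟙 _ : (G i ⊗ (⨁ G)) ⊗ G l ⟶ _)]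
    have s : ∀ {Y : C} (f g : (G i ⊗ (⨁ G)) ⊗ G l ⟶ Y),
        (∀ j, (G i ◁ biproduct.ι G j) ▷ G l ≫ f = (G i ◁ biproduct.ι G j) ▷ G l ≫ g) → f = g := by
      intro Y f g hfg
      have e : 𝟙 ((G i ⊗ (⨁ G)) ⊗ G l) = ∑ j, (G i ◁ biproduct.π G j) ▷ G l ≫
          (G i ◁ biproduct.ι G j) ▷ G l := by
        rw [← id_whiskerRight, ← MonoidalCategory.whiskerLeft_id, ← biproduct.total,
          whiskerLeft_sum, sum_whiskerRight]
        simp only [MonoidalCategory.whiskerLeft_comp, comp_whiskerRight]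
      rw [← Category.id_comp f, ← Category.id_comp g, e, Preadditive.sum_comp,
        Preadditive.sum_comp]
      simp only [Category.assoc, hfg]
    apply s
    intro j
    have k := key i j l
    have e : ((biproduct.ι G i ⊗ₘ biproduct.ι G j) ⊗ₘ biproduct.ι G l) =
      (G i ◁ biproduct.ι G j) ▷ G l ≫ 𝟙 _ ≫ (α_ (G i) (⨁ G) (G l)).hom ≫
      biproduct.ι G i ▷ ((⨁ G) ⊗ G l) ≫ (α_ (⨁ G) (⨁ G) (G l)).inv ≫
      ((⨁ G) ⊗ (⨁ G)) ◁ biproduct.ι G l := by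
      rw [MonoidalCategory.tensorHom_def _ (biproduct.ι G l), MonoidalCategory.tensorHom_def',
        comp_whiskerRight, whiskerRight_tensor]
      simp only [Category.assoc, Category.id_comp, Iso.hom_inv_id_assoc]
    rw [e] at k
    simpa only [Category.assoc] using k

end Graded

/-! ### The reduced Temperley-Lieb category -/

theorem jw_absorb (k a b : ℕ) (h : a + b ≤ k + 1) :
    lcomp (delta k) (ltensor (jw k a) (jw k b)) (jw k (a + b)) = jw k (a + b) := by
  have e : ltensor (jw k a) (jw k b) =
      lcomp (delta k) (ltensor (jw k a) (lid b)) (ltensor (lid a) (jw k b)) := by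
    refine Eq.symm ((ltensor_lcomp (delta k) _ _ _ _).trans ?_)
    rw [lid_lcomp, lcomp_lid]
  rw [e, lcomp_assoc, jw_absorb_right a b h, jw_absorb_left a b h]

/-- The Temperley-Lieb category at level `k`: the additive and idempotent completion of the
linear category of planar diagrams. -/
abbrev TL (k : ℕ) := Idempotents.Karoubi (Mat_ (Strands k))

/-- The object `i`, as an object of the additive completion. -/
abbrev strandsObj (k i : ℕ) : Mat_ (Strands k) := ⟨Unit, fun _ => ⟨i⟩⟩

open MatMonoidal KaroubiMonoidal

theorem ent_comp_single {C : Type*} [Category C] [Preadditive C] {L M N : Mat_ C} (f : L ⟶ M)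
    (g : M ⟶ N) (i k) (j : M.ι) (h : ∀ j', j' = j) : ent (f ≫ g) i k = ent f i j ≫ ent g j k := by
  rw [ent_comp, Finset.sum_eq_single j]
  · intro j' _ hj; exact (hj (h j')).elim
  · intro h; exact (h (Finset.mem_univ _)).elim

/-- The object `Fᵢ = (i, fᵢ)`. -/
noncomputable def F (k i : ℕ) (h : i ≤ k + 1) : TL k where
  X := strandsObj k i
  p := ofEnt fun _ _ => jw k i
  idem := by
    apply ent_ext
    intro a b
    rw [ent_comp_single _ _ _ _ () (fun _ => rfl)]
    exact jw_idem h

/-- The map `π : Fᵢ ⊗ Fⱼ ⟶ Fᵢ₊ⱼ` given by `fᵢ₊ⱼ ∘ (fᵢ ⊗ fⱼ)`. -/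
noncomputable def piMap (k i j : ℕ) (h : i + j ≤ k + 1) :
    F k i (by omega) ⊗ F k j (by omega) ⟶ F k (i + j) h where
  f := ofEnt fun _ _ => lcomp (delta k) (ltensor (jw k i) (jw k j)) (jw k (i + j))
  comm := by
    apply ent_ext
    rintro ⟨⟨⟩, ⟨⟩⟩ ⟨⟩
    refine (ent_comp_single _ _ _ _ ((), ()) (fun _ => rfl)).trans ?_
    refine (congrArg (fun x => lcomp (delta k) (ltensor (jw k i) (jw k j)) x)
      (ent_comp_single _ _ _ _ () (fun _ => rfl))).trans ?_
    change lcomp (delta k) (ltensor (jw k i) (jw k j)) (lcomp (delta k)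
      (lcomp (delta k) (ltensor (jw k i) (jw k j)) (jw k (i + j))) (jw k (i + j))) =
      lcomp (delta k) (ltensor (jw k i) (jw k j)) (jw k (i + j))
    rw [jw_absorb k i j h, jw_idem h, jw_absorb k i j h]

/-- The identification of the unit object with `F₀`. -/
noncomputable def unitMap (k : ℕ) : 𝟙_ (TL k) ⟶ F k 0 (by omega) where
  f := ofEnt fun _ _ => jw k 0
  comm := by
    apply ent_ext
    rintro ⟨⟩ ⟨⟩
    refine (congrArg (fun x : strandsObj k 0 ⟶ strandsObj k 0 => ent x () ()) (Category.id_comp _)).trans ?_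
    refine (ent_comp_single _ _ _ _ () (fun _ => rfl)).trans ?_
    exact jw_idem (n := 0) (Nat.zero_le _)

theorem F_eq (k : ℕ) {a b : ℕ} (h : a = b) (ha : a ≤ k + 1) (hb : b ≤ k + 1) :
    F k a ha = F k b hb := by subst h; rfl

theorem ent_eqToHom_F (k : ℕ) {a b : ℕ} (h : a = b) (ha : a ≤ k + 1) (hb : b ≤ k + 1) :
    ent (eqToHom (F_eq k h ha hb)).f () () = lcast rfl h (jw k a) := by
  subst h; rfl

theorem eqToHom_comp_strands {k a b c : ℕ} (h : a = b) (g : LinHom b c) :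
    (eqToHom (congrArg Strands.mk h) : (⟨a⟩ : Strands k) ⟶ ⟨b⟩) ≫ (g : (⟨b⟩ : Strands k) ⟶ ⟨c⟩) =
      lcast h.symm rfl g := by
  subst h; exact Category.id_comp _

theorem lcomp_lcast {a b c d : ℕ} (δ : ℂ) (h : c = d) (f : LinHom a b) (g : LinHom b c) :
    lcomp δ f (lcast rfl h g) = lcast rfl h (lcomp δ f g) := by subst h; rfl

theorem lcast_jw (k : ℕ) {a b c : ℕ} (h : a = b) (h' : a = c) (hbc : b = c) :
    lcast h h' (jw k a) = lcast rfl hbc (jw k b) := by subst h h'; rfl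

theorem piMap_ent (k i j : ℕ) (h : i + j ≤ k + 1) (a b) :
    ent (piMap k i j h).f a b = jw k (i + j) := jw_absorb k i j h

theorem piMap_assoc (k i j l : ℕ) (h : i + j + l ≤ k + 1) :
    piMap k i j (by omega) ▷ F k l (by omega) ≫ piMap k (i + j) l h =
      (α_ (F k i (by omega)) (F k j (by omega)) (F k l (by omega))).hom ≫
        F k i (by omega) ◁ piMap k j l (by omega) ≫ piMap k i (j + l) (by omega) ≫
          eqToHom (F_eq k (Nat.add_assoc _ _ _).symm _ _) := by
  apply Idempotents.Karoubi.hom_ext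
  apply ent_ext
  rintro ⟨⟨⟨⟩, ⟨⟩⟩, ⟨⟩⟩ ⟨⟩
  have hL : ent (piMap k i j (by omega) ▷ F k l (by omega) ≫ piMap k (i + j) l h).f
      (((), ()), ()) () = jw k (i + j + l) := by
    refine (ent_comp_single _ _ _ _ ((), ()) (fun _ => rfl)).trans ?_
    refine (congrArg₂ (fun x y => lcomp (delta k) (ltensor x (jw k l)) y)
      (piMap_ent k i j _ ((), ()) ()) (piMap_ent k (i + j) l h ((), ()) ())).trans ?_
    exact jw_absorb k (i + j) l h
  have h' : i + (j + l) ≤ k + 1 := by omega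
  have hR : ent ((F k i (by omega)) ◁ piMap k j l (by omega) ≫ piMap k i (j + l) h' ≫
      eqToHom (F_eq k (Nat.add_assoc _ _ _).symm _ h)).f ((), ((), ())) () =
      lcast rfl (Nat.add_assoc _ _ _).symm (jw k (i + (j + l))) := by
    refine (ent_comp_single _ _ _ _ ((), ()) (fun _ => rfl)).trans ?_
    have e1 : ent (piMap k i (j + l) h' ≫
        eqToHom (F_eq k (Nat.add_assoc _ _ _).symm _ h)).f ((), ()) () =
        lcast rfl (Nat.add_assoc _ _ _).symm (jw k (i + (j + l))) := by
      refine (ent_comp_single _ _ _ _ () (fun _ => rfl)).trans ?_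
      refine (congrArg₂ (fun x y => lcomp (delta k) x y) (piMap_ent k i (j + l) h' ((), ()) ())
        (ent_eqToHom_F k (Nat.add_assoc i j l).symm _ _)).trans ?_
      refine (lcomp_lcast _ _ _ _).trans ?_
      exact congrArg _ (jw_idem h')
    refine (congrArg₂ (fun x y => lcomp (delta k) (ltensor (jw k i) x) y)
      (piMap_ent k j l _ ((), ()) ()) e1).trans ?_
    refine (lcomp_lcast _ _ _ _).trans ?_
    exact congrArg _ (jw_absorb k i (j + l) h')
  refine hL.trans (Eq.symm ?_)
  have hA : ∀ {Y : TL k} (g : kobj (F k i (by omega)) (kobj (F k j (by omega))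
      (F k l (by omega))) ⟶ Y), ((α_ (F k i (by omega)) (F k j (by omega)) (F k l (by omega))).hom ≫ g).f =
      (α_ (strandsObj k i) (strandsObj k j) (strandsObj k l)).hom ≫ g.f := by
    intro Y g
    refine (congrArg (· ≫ g.f) (kassoc_f' _ _ _)).trans ?_
    rw [Category.assoc]
    exact congrArg _ (Idempotents.Karoubi.p_comp g)
  rw [hA]
  refine (ent_comp_single _ _ _ _ ((), ((), ())) (fun _ => rfl)).trans ?_
  refine (congrArg₂ (fun x y => lcomp (delta k) x y)
    ((isMono_assoc (strandsObj k i) (strandsObj k j) (strandsObj k l)).self (((), ()), ())) hR).trans ?_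
  refine (eqToHom_comp_strands (k := k) (Nat.add_assoc i j l) _).trans ?_
  have : ∀ {a b : ℕ} (h : a = b), lcast h rfl (lcast rfl h (jw k a)) = jw k b := by
    intro a b h; subst h; rfl
  exact this (Nat.add_assoc i j l).symm

theorem unit_piMap (k j : ℕ) (h : 0 + j ≤ k + 1) :
    unitMap k ▷ F k j (by omega) ≫ piMap k 0 j h =
      (λ_ (F k j (by omega))).hom ≫ eqToHom (F_eq k (Nat.zero_add _).symm _ _) := by
  apply Idempotents.Karoubi.hom_ext
  apply ent_ext
  rintro ⟨⟨⟩, ⟨⟩⟩ ⟨⟩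
  have hL : ent (unitMap k ▷ F k j (by omega) ≫ piMap k 0 j h).f ((), ()) () = jw k (0 + j) := by
    refine (ent_comp_single _ _ _ _ ((), ()) (fun _ => rfl)).trans ?_
    refine (congrArg (fun y => lcomp (delta k) (ltensor (jw k 0) (jw k j)) y)
      (piMap_ent k 0 j h ((), ()) ())).trans ?_
    exact jw_absorb k 0 j h
  refine hL.trans (Eq.symm ?_)
  have h' : j ≤ k + 1 := by omega
  have hA : ((λ_ (F k j h')).hom ≫ eqToHom (F_eq k (Nat.zero_add _).symm _ h)).f =
      (λ_ (strandsObj k j)).hom ≫ (eqToHom (F_eq k (Nat.zero_add _).symm h' h)).f := by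
    refine (congrArg (· ≫ Idempotents.Karoubi.Hom.f _) (klunit_f _)).trans ?_
    rw [Category.assoc]
    exact congrArg _ (Idempotents.Karoubi.p_comp _)
  rw [hA]
  refine (ent_comp_single _ _ _ _ () (fun _ => rfl)).trans ?_
  refine (congrArg₂ (fun x y => lcomp (delta k) x y)
    ((isMono_lunit (strandsObj k j)).self ((), ())) (ent_eqToHom_F k (Nat.zero_add j).symm _ _)).trans ?_
  refine (eqToHom_comp_strands (k := k) (Nat.zero_add j) _).trans ?_
  have : ∀ {a b : ℕ} (h : a = b), lcast h rfl (lcast rfl h (jw k a)) = jw k b := by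
    intro a b h; subst h; rfl
  exact this (Nat.zero_add j).symm

theorem piMap_unit (k i : ℕ) (h : i + 0 ≤ k + 1) :
    F k i (by omega) ◁ unitMap k ≫ piMap k i 0 h =
      (ρ_ (F k i (by omega))).hom ≫ eqToHom (F_eq k (Nat.add_zero _).symm _ _) := by
  apply Idempotents.Karoubi.hom_ext
  apply ent_ext
  rintro ⟨⟨⟩, ⟨⟩⟩ ⟨⟩
  have hL : ent (F k i (by omega) ◁ unitMap k ≫ piMap k i 0 h).f ((), ()) () = jw k (i + 0) := by
    refine (ent_comp_single _ _ _ _ ((), ()) (fun _ => rfl)).trans ?_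
    refine (congrArg (fun y => lcomp (delta k) (ltensor (jw k i) (jw k 0)) y)
      (piMap_ent k i 0 h ((), ()) ())).trans ?_
    exact jw_absorb k i 0 h
  refine hL.trans (Eq.symm ?_)
  have h' : i ≤ k + 1 := by omega
  have hA : ((ρ_ (F k i h')).hom ≫ eqToHom (F_eq k (Nat.add_zero _).symm _ h)).f =
      (ρ_ (strandsObj k i)).hom ≫ (eqToHom (F_eq k (Nat.add_zero _).symm h' h)).f := by
    refine (congrArg (· ≫ Idempotents.Karoubi.Hom.f _) (krunit_f _)).trans ?_
    rw [Category.assoc]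
    exact congrArg _ (Idempotents.Karoubi.p_comp _)
  rw [hA]
  refine (ent_comp_single _ _ _ _ () (fun _ => rfl)).trans ?_
  refine (congrArg₂ (fun x y => lcomp (delta k) x y)
    ((isMono_runit (strandsObj k i)).self ((), ())) (ent_eqToHom_F k (Nat.add_zero i).symm _ _)).trans ?_
  refine (eqToHom_comp_strands (k := k) (Nat.add_zero i) _).trans ?_
  rfl

/-- The identity morphism of the object `Fₖ₊₁`. -/
inductive IsIdTop (k : ℕ) : ∀ ⦃X Y : TL k⦄, (X ⟶ Y) → Prop
  | id : IsIdTop k (𝟙 (F k (k + 1) le_rfl))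

/-- The reduced Temperley-Lieb category at level `k`: the quotient of the Temperley-Lieb category
by the ideal of morphisms generated by `Fₖ₊₁`. -/
noncomputable abbrev TLred (k : ℕ) := TensorQuotient.Quo (IsIdTop k)

/-- The quotient functor. -/
noncomputable abbrev reduce (k : ℕ) : TL k ⥤ TLred k := TensorQuotient.proj (IsIdTop k)

/-- The objects `Fᵢ` of the reduced Temperley-Lieb category, for `0 ≤ i ≤ k`. -/
noncomputable abbrev Fred (k : ℕ) (i : Fin (k + 1)) : TLred k := (reduce k).obj (F k i (by omega))

/-- The object `Σ = F₀ ⊕ ⋯ ⊕ Fₖ` of the reduced Temperley-Lieb category. -/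
noncomputable abbrev Sig (k : ℕ) : TLred k := ⨁ Fred k

/-- The algebra structure on `Σ`: the unit is the inclusion of `F₀`, and the multiplication is the
sum of the maps `π : Fᵢ ⊗ Fⱼ ⟶ Fᵢ₊ⱼ` over all `i` and `j` with `i + j ≤ k`. -/
noncomputable instance (k : ℕ) : MonObj (Sig k) :=
  gradedMonObj (G := Fred k) (fun i j h => (reduce k).map (piMap k i j (by omega)))
    (Nat.succ_pos k) ((reduce k).map (unitMap k))
    (fun j h => by
      have e := congrArg (reduce k).map (unit_piMap k j (by omega))
      rw [CategoryTheory.Functor.map_comp, CategoryTheory.Functor.map_comp, eqToHom_map] at e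
      exact e)
    (fun i h => by
      have e := congrArg (reduce k).map (piMap_unit k i (by omega))
      rw [CategoryTheory.Functor.map_comp, CategoryTheory.Functor.map_comp, eqToHom_map] at e
      exact e)
    (fun i j l h h' h1 h2 => by
      have e := congrArg (reduce k).map (piMap_assoc k i j l (by omega))
      simp only [CategoryTheory.Functor.map_comp, eqToHom_map] at e
      exact e)

/-! ### Frobenius structures -/

section Frobenius
universe v u
variable {C : Type u} [Category.{v} C] [MonoidalCategory C]

/-- The map `φ : A ⟶ A ⊗ A ⊗ Aᵛ ⟶ W ⊗ Aᵛ` attached to `n : A ⟶ W`, where `Aᵛ` is a left dual of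
the algebra `A`: the coevaluation `𝟙 ⟶ A ⊗ Aᵛ` followed by `n ∘ m`. -/
def frobeniusMap (A : C) [MonObj A] (Ad : C) [ExactPairing A Ad] {W : C} (n : A ⟶ W) :
    A ⟶ W ⊗ Ad :=
  (ρ_ A).inv ≫ A ◁ η_ A Ad ≫ (α_ A A Ad).inv ≫ (MonObj.mul ≫ n) ▷ Ad

/-- `(W, n)` is a Frobenius structure on the algebra `A`: there is a left dual `Aᵛ` of `A`, with
evaluation `Aᵛ ⊗ A ⟶ 𝟙` and coevaluation `𝟙 ⟶ A ⊗ Aᵛ`, for which the map `A ⟶ W ⊗ Aᵛ` is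
invertible. -/
def IsFrobeniusStructure (A : C) [MonObj A] (W : C) (n : A ⟶ W) : Prop :=
  ∃ (Ad : C) (_ : ExactPairing A Ad), IsIso (frobeniusMap A Ad n)

/-- A classical Frobenius structure is a Frobenius structure `(W, n)` in which `W` is the unit
object. -/
def AdmitsClassicalFrobeniusStructure (A : C) [MonObj A] : Prop :=
  ∃ n : A ⟶ 𝟙_ C, IsFrobeniusStructure A (𝟙_ C) n

end Frobenius
end TemperleyLieb

open CategoryTheory MonoidalCategory Limits TemperleyLieb

namespace TemperleyLieb

/-! ### The closure of a diagram -/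

namespace Diagram
variable {m n p : ℕ}

/-! A Jones-Wenzl projection `f_i` with `i > 0` kills every diagram `i → 0`: in a non-crossing
matching of `i` dots some two adjacent dots are joined, such a diagram factors, up to the invertible
scalar `δ`, through a cap-cup on these two strands, and `f_i` annihilates cap-cups. Hence there are
no nonzero morphisms `F_i → 𝟙` in the Temperley-Lieb category (`hom_F_unit_eq_zero`), and since the
quotient functor is full there are none in the quotient either. This is the second claim.

For the first claim, restrict the map attached to `n : Σ → 𝟙` to the summand `F_1`, which exists
because `1 ≤ k`. The multiplication is graded, so a product with a factor of positive degree has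
positive degree or is zero, and `n` vanishes on it. Thus the Frobenius map is zero on `F_1`
(`ι_frobeniusMap_eq_zero`). If it were invertible, the inclusion of `F_1` would be zero, and so
would be the identity of `F_1`.

It remains to see that `F_1` survives in the quotient, which is where the value of `q` matters. The
obstruction is the Markov trace `ltrace`. Morphisms whose composite with every morphism in the
opposite direction has trace zero form a tensor ideal: composition is handled by cyclicity of the
trace, tensoring by partial traces. The projection `f_{k+1}` is negligible (`negligible_jw`):
against the identity its trace is `±[k+2] = 0`, and it kills every other diagram `k+1 → k+1`. So all
of the ideal generated by `F_{k+1}` is negligible (`negligible_of_ideal`), whereas the identity of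
one strand has trace `δ = -[2] ≠ 0`.

The statements about loops are obtained from linear algebra instead of planar topology. The 0-1
matrix `relMat` of a diagram represents stacking by matrix multiplication with every loop worth `2`,
and closing up by the matrix trace. Powers of `2` determine their exponents and `relMat` determines
its diagram, so an identity of matrices gives equality of diagrams and of numbers of loops, and
these hold for the loop value `δ` as well. -/

theorem compat_iff_le_ker {X : Type} {s : Setoid X} {l : X → Bool} :
    Compat s l ↔ s ≤ Setoid.ker l := Iff.rfl

theorem compat_sup {X : Type} {s t : Setoid X} {l : X → Bool} :
    Compat (s ⊔ t) l ↔ Compat s l ∧ Compat t l := by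
  simp only [compat_iff_le_ker, sup_le_iff]

/-- The number of loops obtained by joining each bottom dot with the top dot above it. -/
noncomputable def closureLoops (f : Diagram n n) : ℕ := Nat.card (Quotient (f.rel ⊔ (id n).rel))

/-- The diagonal entry at a labeling is `1` exactly when the same labeling on bottom and top dots is
constant along lines. The trace therefore counts the two-valued labelings of the components of the
closed picture. -/
theorem trace_relMat (f : Diagram n n) : (relMat f.rel).trace = 2 ^ closureLoops f := by
  classical
  -- With `Empty` as the set of outer dots no label is prescribed and no component is excluded, so
  -- `card_compat` counts all components.
  have h := card_compat (f.rel ⊔ (id n).rel) (X := Empty) (fun x => x.elim) (fun x => x.elim)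
  have hc : Compat ((f.rel ⊔ (id n).rel).comap (fun x : Empty => x.elim)) (fun x => x.elim) :=
    fun x => x.elim
  rw [if_pos hc] at h
  have e : Nat.card {c : Quotient (f.rel ⊔ (id n).rel) // ∀ x : Empty, c ≠ Quotient.mk _ x.elim} =
      closureLoops f := Nat.card_congr (Equiv.subtypeUnivEquiv fun c x => x.elim)
  rw [e] at h
  rw [← h]
  simp only [Matrix.trace, Matrix.diag, relMat, Finset.sum_boole, Nat.cast_id]
  rw [← Fintype.card_subtype, ← Nat.card_eq_fintype_card]
  refine Nat.card_congr
    { toFun := fun a => ⟨Sum.elim a.1 a.1, compat_sup.2 ⟨a.2, compat_id.2 rfl⟩,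
        funext fun x => x.elim⟩
      invFun := fun L => ⟨fun i => L.1 (Sum.inl i), ?_⟩
      left_inv := fun a => rfl
      right_inv := ?_ }
  · obtain ⟨L, hL, -⟩ := L
    rw [compat_sup] at hL
    have h2 := hL.2
    rw [← Sum.elim_comp_inl_inr L, compat_id] at h2
    have h1 := hL.1
    rw [← Sum.elim_comp_inl_inr L, ← h2] at h1
    exact h1
  · rintro ⟨L, hL, hLo⟩
    apply Subtype.ext
    have h2 := (compat_sup.1 hL).2
    rw [← Sum.elim_comp_inl_inr L, compat_id] at h2
    funext x
    rcases x with x | x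
    · rfl
    · exact congrFun h2 x

theorem trace_relMat_mul (f : Diagram m n) (g : Diagram n m) :
    (relMat f.rel * relMat g.rel).trace = 2 ^ (loops f g + closureLoops (comp f g)) := by
  rw [relMat_comp, Matrix.trace_smul, trace_relMat, smul_eq_mul, pow_add]

/-- Cyclicity of the matrix trace, with the exponents of `2` compared. This is what makes the Markov
trace cyclic for every loop value. -/
theorem closureLoops_comp_comm (f : Diagram m n) (g : Diagram n m) :
    loops f g + closureLoops (comp f g) = loops g f + closureLoops (comp g f) := by
  apply Nat.pow_right_injective le_rfl
  simp only
  rw [← trace_relMat_mul, ← trace_relMat_mul, Matrix.trace_mul_comm]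

/-! ### Partial traces -/

theorem relMat_cast {m' n' : ℕ} (hm : m = m') (hn : n = n') (f : Diagram m n) (a b) :
    relMat (cast hm hn f).rel a b =
      relMat f.rel (fun i => a (Fin.cast hm i)) (fun i => b (Fin.cast hn i)) := by
  subst hm hn; rfl

/-- Only the shape of the answer, a power of the loop value times one diagram, is needed for partial
traces; the exponent and the diagram are never identified. -/
theorem exists_relMat_mul_mul {r : ℕ} (f : Diagram m n) (g : Diagram n p) (h : Diagram p r) :
    ∃ (e : ℕ) (d : Diagram m r),
      relMat f.rel * relMat g.rel * relMat h.rel = 2 ^ e • relMat d.rel := by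
  refine ⟨loops f g + loops (comp f g) h, comp (comp f g) h, ?_⟩
  rw [relMat_comp, Matrix.smul_mul, relMat_comp, smul_smul, pow_add]

/-! ### Matrices of cups and caps beside identity strands -/

theorem sum_append {a b : ℕ} (F : (Fin (a + b) → Bool) → ℕ) :
    ∑ x, F x = ∑ y : Fin a → Bool, ∑ z : Fin b → Bool, F (Fin.append y z) := by
  rw [← (Fin.appendEquiv a b).sum_comp, Fintype.sum_prod_type]
  rfl

theorem relMat_tensor_append {m₁ m₂ n₁ n₂ : ℕ} (f : Diagram m₁ n₁) (g : Diagram m₂ n₂)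
    (a a' b b') : relMat (tensor f g).rel (Fin.append a a') (Fin.append b b') =
      relMat f.rel a b * relMat g.rel a' b' := by
  rw [relMat_tensor]
  simp only [Fin.append_left, Fin.append_right]

/-- Strands are added one at a time, as `n + 1 + 1`, while a cup or cap occupies `n + 2`. These two
agree definitionally, so no cast is needed here. -/
theorem append_append_right (w : Fin n → Bool) (s u : Fin 1 → Bool) :
    (fun i => (Fin.append (Fin.append w s) u : Fin (n + 1 + 1) → Bool)
      (Fin.castAdd 2 i : Fin (n + 2))) = w ∧
    (Fin.append (Fin.append w s) u : Fin (n + 1 + 1) → Bool)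
      (Fin.natAdd n (0 : Fin 2) : Fin (n + 2)) = s 0 ∧
    (Fin.append (Fin.append w s) u : Fin (n + 1 + 1) → Bool)
      (Fin.natAdd n (1 : Fin 2) : Fin (n + 2)) = u 0 :=
  ⟨funext fun i => (Fin.append_left (Fin.append w s) u (Fin.castAdd 1 i)).trans
      (Fin.append_left w s i),
    (Fin.append_left (Fin.append w s) u (Fin.natAdd n 0)).trans (Fin.append_right w s 0),
    Fin.append_right (Fin.append w s) u 0⟩

/-- On the left, `1 + (1 + n)` and `2 + n` are only propositionally equal, hence the `Fin.cast`. -/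
theorem append_append_left (w : Fin n → Bool) (s u : Fin 1 → Bool) :
    Fin.append s (Fin.append u w) (Fin.cast (Nat.add_assoc 1 1 n) (Fin.castAdd n (0 : Fin 2))) =
      s 0 ∧
    Fin.append s (Fin.append u w) (Fin.cast (Nat.add_assoc 1 1 n) (Fin.castAdd n (1 : Fin 2))) =
      u 0 ∧
    (fun i => Fin.append s (Fin.append u w)
      (Fin.cast (Nat.add_assoc 1 1 n) (Fin.natAdd 2 i))) = w := by
  refine ⟨Fin.append_left s _ 0, ?_, funext fun i => ?_⟩
  · exact (Fin.append_right s (Fin.append u w) (Fin.castAdd n 0)).trans (Fin.append_left u w 0)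
  · have e : Fin.cast (Nat.add_assoc 1 1 n) (Fin.natAdd 2 i) = Fin.natAdd 1 (Fin.natAdd 1 i) :=
      Fin.ext (by simp; omega)
    rw [e, Fin.append_right, Fin.append_right]

theorem fun_fin_one_eq {s u : Fin 1 → Bool} : s = u ↔ s 0 = u 0 := by
  rw [funext_iff, Fin.forall_fin_one]

/-- A cup forces equal labels on the two new strands and leaves the others alone. This entry
formula, with the three analogues that follow, turns closing a strand into a sum over one label. -/
theorem relMat_id_cup (x w : Fin n → Bool) (s u : Fin 1 → Bool) :
    relMat (tensor (id n) cup).rel x (Fin.append (Fin.append w s) u : Fin (n + 1 + 1) → Bool) =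
      if x = w ∧ s = u then 1 else 0 := by
  obtain ⟨h1, h2, h3⟩ := append_append_right w s u
  refine (relMat_tensor (id n) cup x _).trans ?_
  rw [relMat_id, relMat_cup, Matrix.one_apply]
  refine (congrArg₂ (· * ·) (if_congr (Eq.congr rfl h1) rfl rfl)
    (if_congr (Eq.congr h2 h3) rfl rfl)).trans ?_
  simp only [fun_fin_one_eq (s := s), Fin.castAdd_zero, Fin.cast_eq_self]
  split_ifs <;> simp_all

theorem relMat_id_cap (x w : Fin n → Bool) (s u : Fin 1 → Bool) :
    relMat (tensor (id n) cap).rel (Fin.append (Fin.append w s) u : Fin (n + 1 + 1) → Bool) x =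
      if w = x ∧ s = u then 1 else 0 := by
  obtain ⟨h1, h2, h3⟩ := append_append_right w s u
  refine (relMat_tensor (id n) cap _ x).trans ?_
  rw [relMat_id, relMat_cap, Matrix.one_apply]
  refine (congrArg₂ (· * ·) (if_congr (Eq.congr h1 rfl) rfl rfl)
    (if_congr (Eq.congr h2 h3) rfl rfl)).trans ?_
  simp only [fun_fin_one_eq (s := s), Fin.castAdd_zero, Fin.cast_eq_self]
  split_ifs <;> simp_all

theorem relMat_cup_id (x w : Fin n → Bool) (s u : Fin 1 → Bool) :
    relMat (cast (Nat.zero_add n) (Nat.add_assoc 1 1 n) (tensor cup (id n))).rel x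
      (Fin.append s (Fin.append u w)) = if x = w ∧ s = u then 1 else 0 := by
  obtain ⟨h1, h2, h3⟩ := append_append_left w s u
  rw [relMat_cast, relMat_tensor, relMat_id, relMat_cup, Matrix.one_apply]
  refine (congrArg₂ (· * ·) (if_congr (Eq.congr h1 h2) rfl rfl)
    (if_congr (Eq.congr rfl h3) rfl rfl)).trans ?_
  simp only [fun_fin_one_eq (s := s), Fin.natAdd_zero, Fin.cast_cast, Fin.cast_eq_self]
  split_ifs <;> simp_all

theorem relMat_cap_id (x w : Fin n → Bool) (s u : Fin 1 → Bool) :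
    relMat (cast (Nat.add_assoc 1 1 n) (Nat.zero_add n) (tensor cap (id n))).rel
      (Fin.append s (Fin.append u w)) x = if w = x ∧ s = u then 1 else 0 := by
  obtain ⟨h1, h2, h3⟩ := append_append_left w s u
  rw [relMat_cast, relMat_tensor, relMat_id, relMat_cap, Matrix.one_apply]
  refine (congrArg₂ (· * ·) (if_congr (Eq.congr h1 h2) rfl rfl)
    (if_congr (Eq.congr h3 rfl) rfl rfl)).trans ?_
  simp only [fun_fin_one_eq (s := s), Fin.natAdd_zero, Fin.cast_cast, Fin.cast_eq_self]
  split_ifs <;> simp_all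

/-- Closing the last strand of a diagram gives a power of the loop value times a diagram. -/
theorem exists_partialTrace_right (g : Diagram (n + 1) (m + 1)) :
    ∃ (e : ℕ) (d : Diagram n m), ∀ x y,
      ∑ t : Fin 1 → Bool, relMat g.rel (Fin.append x t) (Fin.append y t) =
        2 ^ e * relMat d.rel x y := by
  classical
  -- The last strand is closed up through an auxiliary strand to its right: a cup below, `g ⊗ 1` in
  -- the middle, a cap above. The cup and the cap identify the labels of the two strands, and the
  -- identity carries that label from bottom to top.
  obtain ⟨e, d, h⟩ := exists_relMat_mul_mul (m := n) (n := n + 1 + 1) (p := m + 1 + 1) (r := m)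
    (tensor (id n) cup) (tensor g (id 1)) (tensor (id m) cap)
  refine ⟨e, d, fun x y => ?_⟩
  have h1 := congrFun (congrFun h x) y
  rw [Matrix.smul_apply, smul_eq_mul] at h1
  rw [← h1]
  simp only [Matrix.mul_apply, sum_append (a := n + 1) (b := 1), sum_append (a := m + 1) (b := 1),
    sum_append (b := 1) (a := n), sum_append (b := 1) (a := m), relMat_id_cup, relMat_id_cap,
    relMat_tensor_append, relMat_id, Matrix.one_apply]
  simp [ite_and]

/-- Closing the first strand of a diagram gives a power of the loop value times a diagram. -/
theorem exists_partialTrace_left (g : Diagram (1 + n) (1 + m)) :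
    ∃ (e : ℕ) (d : Diagram n m), ∀ x y,
      ∑ t : Fin 1 → Bool, relMat g.rel (Fin.append t x) (Fin.append t y) =
        2 ^ e * relMat d.rel x y := by
  classical
  -- The mirror image: the auxiliary strand runs on the left of `g`.
  obtain ⟨e, d, h⟩ := exists_relMat_mul_mul
    (cast (Nat.zero_add n) (Nat.add_assoc 1 1 n) (tensor cup (id n))) (tensor (id 1) g)
    (cast (Nat.add_assoc 1 1 m) (Nat.zero_add m) (tensor cap (id m)))
  refine ⟨e, d, fun x y => ?_⟩
  have h1 := congrFun (congrFun h x) y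
  rw [Matrix.smul_apply, smul_eq_mul] at h1
  rw [← h1]
  simp only [Matrix.mul_apply, sum_append (a := 1) (b := 1 + n), sum_append (a := 1) (b := 1 + m),
    sum_append (a := 1) (b := n), sum_append (a := 1) (b := m), relMat_cup_id, relMat_cap_id,
    relMat_tensor_append, relMat_id, Matrix.one_apply]
  simp [ite_and]

/-- The extra identity strand forces the last labels at bottom and top of `g` to agree, so the trace
can be taken over that strand first. The right side is the trace of `f` against the partial trace of
`g`. -/
theorem trace_tensor_id_mul (f : Diagram m n) (g : Diagram (n + 1) (m + 1)) :
    (relMat (tensor f (id 1)).rel * relMat g.rel).trace =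
      ∑ x, ∑ y, relMat f.rel x y *
        ∑ t : Fin 1 → Bool, relMat g.rel (Fin.append y t) (Fin.append x t) := by
  classical
  simp only [Matrix.trace, Matrix.diag, Matrix.mul_apply]
  rw [sum_append]
  refine Finset.sum_congr rfl fun x _ => ?_
  simp only [sum_append (a := n) (b := 1), relMat_tensor_append, relMat_id, Matrix.one_apply]
  rw [Finset.sum_comm]
  simp [Finset.mul_sum]

theorem trace_id_tensor_mul (f : Diagram m n) (g : Diagram (1 + n) (1 + m)) :
    (relMat (tensor (id 1) f).rel * relMat g.rel).trace =
      ∑ x, ∑ y, relMat f.rel x y *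
        ∑ t : Fin 1 → Bool, relMat g.rel (Fin.append t y) (Fin.append t x) := by
  classical
  simp only [Matrix.trace, Matrix.diag, Matrix.mul_apply]
  rw [sum_append, Finset.sum_comm]
  refine Finset.sum_congr rfl fun x _ => ?_
  simp only [sum_append (a := 1) (b := n), relMat_tensor_append, relMat_id, Matrix.one_apply]
  simp only [ite_mul, one_mul, zero_mul, Finset.sum_ite_irrel, Finset.sum_const_zero, Finset.sum_ite_eq, Finset.mem_univ, if_true]
  rw [Finset.sum_comm]
  simp [Finset.mul_sum]

theorem relMat_capCup (x y : Fin 2 → Bool) :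
    relMat (comp cap cup).rel x y = if x 0 = x 1 ∧ y 0 = y 1 then 1 else 0 := by
  have h := congrFun (congrFun (relMat_comp cap cup) x) y
  rw [loops_cap_cup, pow_zero, one_smul] at h
  rw [← h, Matrix.mul_apply]
  simp only [relMat_cap, relMat_cup]
  clear h; revert x y; decide

/-- The partial trace of the cap-cup on the last two strands is the identity. -/
theorem partialTrace_id_capCup (x y : Fin (n + 1) → Bool) :
    ∑ t : Fin 1 → Bool, relMat (tensor (id n) (comp cap cup)).rel
      (Fin.append x t : Fin (n + 1 + 1) → Bool) (Fin.append y t : Fin (n + 1 + 1) → Bool) = relMat (id (n + 1)).rel x y := by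
  obtain ⟨⟨x, s⟩, rfl⟩ := (Fin.appendEquiv n 1).surjective x
  obtain ⟨⟨y, u⟩, rfl⟩ := (Fin.appendEquiv n 1).surjective y
  have e : ∀ t : Fin 1 → Bool, relMat (tensor (id n) (comp cap cup)).rel
      (Fin.append (Fin.append x s) t : Fin (n + 1 + 1) → Bool)
        (Fin.append (Fin.append y u) t : Fin (n + 1 + 1) → Bool) = if x = y ∧ s = t ∧ u = t then 1 else 0 := by
    intro t
    obtain ⟨h1, h2, h3⟩ := append_append_right x s t
    obtain ⟨h4, h5, h6⟩ := append_append_right y u t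
    refine (relMat_tensor (id n) (comp cap cup) _ _).trans ?_
    rw [relMat_id, relMat_capCup, Matrix.one_apply]
    refine (congrArg₂ (· * ·) (if_congr (Eq.congr h1 h4) rfl rfl)
      (if_congr (and_congr (Eq.congr h2 h3) (Eq.congr h5 h6)) rfl rfl)).trans ?_
    simp only [fun_fin_one_eq (u := t)]
    split_ifs <;> simp_all
  -- Summing the conditions `s = t` and `u = t` over `t` leaves `s = u`: the closed cap-cup
  -- straightens to a vertical line.
  refine (Finset.sum_congr rfl fun t _ => e t).trans ?_
  rw [relMat_id, Matrix.one_apply]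
  simp only [(Fin.appendEquiv n 1).injective.eq_iff, Prod.mk.injEq]
  by_cases hxy : x = y
  · by_cases hsu : s = u <;> simp [hxy, hsu, ite_and, Ne.symm]
  · simp [hxy]

end Diagram
end TemperleyLieb

namespace TemperleyLieb
namespace Diagram
variable {m n p : ℕ}

/-! ### Diagrams without adjacent bottom dots on the same line -/

/-- An innermost arc has no dots under it. The dot just after `i` lies under the arc from `i` to
`j`, so by planarity its own line stays under that arc and spans fewer dots. -/
theorem exists_adjacent_of_rel (d : Diagram m n) {i j : Fin m} (hij : i < j)
    (h : d.rel (Sum.inl i) (Sum.inl j)) :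
    ∃ i j : Fin m, (i : ℕ) + 1 = j ∧ d.rel (Sum.inl i) (Sum.inl j) := by
  -- The number `l` of dots strictly between `i` and `j` is the induction parameter.
  obtain ⟨l, hl⟩ : ∃ l : ℕ, (i : ℕ) + 1 + l = j := ⟨j - i - 1, by omega⟩
  induction l using Nat.strong_induction_on generalizing i j with
  | _ l ih =>
    rcases Nat.eq_zero_or_pos l with h0 | h0
    · exact ⟨i, j, by omega, h⟩
    · let a : Fin m := ⟨i + 1, by omega⟩
      have ha := d.rel_partner (Sum.inl a)
      have hia : pos (Sum.inl i : Fin m ⊕ Fin n) < pos (Sum.inl a : Fin m ⊕ Fin n) :=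
        Nat.lt_succ_self _
      have haj : pos (Sum.inl a : Fin m ⊕ Fin n) < pos (Sum.inl j : Fin m ⊕ Fin n) := by
        simp only [pos, a]; omega
      have hne := d.partner_ne (Sum.inl a)
      -- Leaving the interval from `i` to `j` on either side would cross the arc. The bounds are
      -- weak here; equality is excluded below because `i` and `j` are already each other's
      -- partners.
      have hnot : ∀ z, d.rel (Sum.inl a) z → z ≠ Sum.inl a →
          pos (Sum.inl i : Fin m ⊕ Fin n) ≤ pos z ∧ pos z ≤ pos (Sum.inl j : Fin m ⊕ Fin n) := by
        intro z hz hza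
        constructor
        · by_contra hlt
          exact d.planar _ _ _ _ (not_le.1 hlt) hia haj (d.rel.symm hz) h
        · by_contra hlt
          exact d.planar _ _ _ _ hia haj (not_le.1 hlt) h hz
      obtain ⟨h1, h2⟩ := hnot _ ha hne
      rcases hp : d.partner (Sum.inl a) with b | b
      · rw [hp] at ha hne h1 h2
        simp only [pos] at h1 h2
        have hib : (i : ℕ) ≠ b := by
          intro e
          have e' : i = b := Fin.ext e
          subst e'
          have h3 := eq_partner h (by intro e; simp at e; omega)
          have h4 := eq_partner (d.rel.symm ha) (by intro e; simp [a, Fin.ext_iff] at e)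
          rw [← h4] at h3
          simp [a, Fin.ext_iff] at h3
          omega
        have hjb : (j : ℕ) ≠ b := by
          intro e
          have e' : j = b := Fin.ext e
          subst e'
          have h3 := eq_partner (d.rel.symm h) (by intro e; simp at e; omega)
          have h4 := eq_partner (d.rel.symm ha) (by intro e; simp [a, Fin.ext_iff] at e; omega)
          rw [← h4] at h3
          simp [a, Fin.ext_iff] at h3
        have hab : (a : ℕ) ≠ b := fun e => hne (congrArg Sum.inl (Fin.ext e.symm))
        simp only [a] at hab
        exact ih (b - a - 1) (by simp only [a]; omega) (i := a) (j := b)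
          (by simp only [Fin.lt_def, a]; omega) ha (by simp only [a]; omega)
      -- A top dot comes after all bottom dots in the boundary order, so it cannot lie under the
      -- arc.
      · rw [hp] at h2
        simp only [pos] at h2
        omega

/-- A diagram with at most as many top dots as bottom dots is an identity, or two adjacent bottom
dots lie on the same line. -/
theorem eq_id_or_exists_adjacent (d : Diagram m n) (hmn : n ≤ m) :
    (∃ h : m = n, d = cast rfl h (id m)) ∨
      ∃ i j : Fin m, (i : ℕ) + 1 = j ∧ d.rel (Sum.inl i) (Sum.inl j) := by
  by_cases hex : ∃ i j : Fin m, i < j ∧ d.rel (Sum.inl i) (Sum.inl j)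
  · obtain ⟨i, j, hij, h⟩ := hex
    exact Or.inr (d.exists_adjacent_of_rel hij h)
  left
  have hbot : ∀ i j : Fin m, d.rel (Sum.inl i) (Sum.inl j) → i = j := by
    intro i j h
    rcases lt_trichotomy i j with hij | hij | hij
    · exact (hex ⟨i, j, hij, h⟩).elim
    · exact hij
    · exact (hex ⟨j, i, hij, d.rel.symm h⟩).elim
  have htop : ∀ i : Fin m, ∃ a : Fin n, d.rel (Sum.inl i) (Sum.inr a) := by
    intro i
    have h1 := d.rel_partner (Sum.inl i)
    have h2 := d.partner_ne (Sum.inl i)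
    rcases hp : d.partner (Sum.inl i) with b | b
    · rw [hp] at h1 h2; exact (h2 (congrArg _ (hbot _ _ h1).symm)).elim
    · rw [hp] at h1; exact ⟨b, h1⟩
  choose t ht using htop
  have hinj : Function.Injective t := by
    intro i j h
    apply hbot
    have h2 := ht j
    rw [← h] at h2
    exact d.rel.trans (ht i) (d.rel.symm h2)
  have hle := Fintype.card_le_of_injective t hinj
  simp only [Fintype.card_fin] at hle
  have hmn' : m = n := le_antisymm hle hmn
  subst hmn'
  refine ⟨rfl, ?_⟩
  have hmono : StrictMono t := by
    intro i j hij
    rcases lt_trichotomy (t i) (t j) with h | h | h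
    · exact h
    · exact (hij.ne (hinj h)).elim
    -- Top dots are read from right to left, so `t j < t i` would put the ends of the two lines in
    -- crossing order.
    · refine (d.planar (Sum.inl i) (Sum.inl j) (Sum.inr (t i)) (Sum.inr (t j)) ?_ ?_ ?_
        (ht i) (ht j)).elim <;> simp only [pos] <;> omega
  have hid : ∀ i, t i = i := by
    intro i
    -- A finite linear order has no order automorphism besides the identity.
    have := Subsingleton.elim (hmono.orderIsoOfSurjective t (Finite.surjective_of_injective hinj))
      (OrderIso.refl _)
    exact congrArg (fun e : Fin m ≃o Fin m => e i) this
  have hrel : ∀ i, d.rel (Sum.inl i) (Sum.inr i) := fun i => by simpa only [hid] using ht i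
  change d = id m
  apply ext_compat
  intro a b
  rw [compat_id]
  constructor
  · intro h; funext i; exact h _ _ (hrel i)
  · rintro rfl x y hxy
    rcases x with x | x <;> rcases y with y | y
    · rw [hbot _ _ hxy]
    · exact congrArg a (hbot _ _ (d.rel.trans hxy (d.rel.symm (hrel y))))
    · exact congrArg a (hbot _ _ (d.rel.trans (hrel x) hxy))
    · exact congrArg a (hbot _ _ (d.rel.trans (hrel x) (d.rel.trans hxy (d.rel.symm (hrel y)))))

/-! ### Stacking a cap-cup below a diagram -/

/-- The cap-cup with `a` strands on its left and `b` strands on its right. -/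
def capCupAt (a b : ℕ) : Diagram (a + 2 + b) (a + 2 + b) :=
  tensor (tensor (id a) (comp cap cup)) (id b)

theorem relMat_capCupAt (a b : ℕ) (x x' : Fin a → Bool) (s s' : Fin 2 → Bool)
    (y y' : Fin b → Bool) :
    relMat (capCupAt a b).rel (Fin.append (Fin.append x s) y)
      (Fin.append (Fin.append x' s') y') =
        if x = x' ∧ (s 0 = s 1 ∧ s' 0 = s' 1) ∧ y = y' then 1 else 0 := by
  rw [capCupAt, relMat_tensor_append, relMat_tensor_append, relMat_id, relMat_id, relMat_capCup,
    Matrix.one_apply, Matrix.one_apply]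
  split_ifs <;> simp_all

/-- A line has exactly two ends, so the common label on the line joining the two marked dots is
independent of all other labels. -/
theorem relMat_congr_of_rel {a b : ℕ} (d : Diagram (a + 2 + b) n)
    (h : d.rel (Sum.inl (Fin.castAdd b (Fin.natAdd a 0))) (Sum.inl (Fin.castAdd b (Fin.natAdd a 1))))
    (x : Fin a → Bool) (y : Fin b → Bool) (s s' : Fin 2 → Bool) (hs : s 0 = s 1)
    (hs' : s' 0 = s' 1) (z : Fin n → Bool) :
    relMat d.rel (Fin.append (Fin.append x s) y) z =
      relMat d.rel (Fin.append (Fin.append x s') y) z := by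
  have key : ∀ s s' : Fin 2 → Bool, s' 0 = s' 1 →
      Compat d.rel (Sum.elim (Fin.append (Fin.append x s) y) z) →
      Compat d.rel (Sum.elim (Fin.append (Fin.append x s') y) z) := by
    intro s s' hs' hc u v huv
    by_cases huv' : v = u
    · rw [huv']
    have hv := eq_partner huv huv'
    have hu := eq_partner (d.rel.symm huv) (Ne.symm huv')
    have h1 := eq_partner h (by simp [Fin.ext_iff])
    have h0 := eq_partner (d.rel.symm h) (by simp [Fin.ext_iff])
    -- The two labelings differ at most on the two marked dots.
    have hval : ∀ w : Fin (a + 2 + b) ⊕ Fin n,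
        w ≠ Sum.inl (Fin.castAdd b (Fin.natAdd a 0)) →
        w ≠ Sum.inl (Fin.castAdd b (Fin.natAdd a 1)) →
        Sum.elim (Fin.append (Fin.append x s') y) z w =
          Sum.elim (Fin.append (Fin.append x s) y) z w := by
      rintro (w | w) hw0 hw1
      · induction w using Fin.addCases with
        | left w =>
          induction w using Fin.addCases with
          | left w => simp
          | right w =>
            exfalso
            fin_cases w
            · exact hw0 rfl
            · exact hw1 rfl
        | right w => simp
      · rfl
    -- If one end of a line is a marked dot, the other end is the other marked dot and `hs'`
    -- applies. Otherwise both ends keep their old labels.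
    by_cases hu0 : u = Sum.inl (Fin.castAdd b (Fin.natAdd a 0))
    · rw [hu0, ← h1] at hv
      rw [hu0, hv]; simpa using hs'
    by_cases hu1 : u = Sum.inl (Fin.castAdd b (Fin.natAdd a 1))
    · rw [hu1, ← h0] at hv
      rw [hu1, hv]; simpa using hs'.symm
    rw [hval u hu0 hu1, hval v, hc u v huv]
    · intro hv0; rw [hv0, ← h1] at hu; exact hu1 hu
    · intro hv1; rw [hv1, ← h0] at hu; exact hu0 hu
  classical
  simp only [relMat]
  exact if_congr ⟨key s s' hs', key s' s hs⟩ rfl rfl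

theorem relMat_eq_zero_of_rel {a b : ℕ} (d : Diagram (a + 2 + b) n)
    (h : d.rel (Sum.inl (Fin.castAdd b (Fin.natAdd a 0))) (Sum.inl (Fin.castAdd b (Fin.natAdd a 1))))
    (x : Fin a → Bool) (y : Fin b → Bool) (s : Fin 2 → Bool) (hs : s 0 ≠ s 1) (z : Fin n → Bool) :
    relMat d.rel (Fin.append (Fin.append x s) y) z = 0 := by
  classical
  refine if_neg fun hc => hs ?_
  simpa using hc _ _ h

/-- The arc joining the two adjacent dots closes with the upper half of the cap-cup to one loop, and
the lower half takes the place of that arc. Hence such a diagram factors through the cap-cup as soon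
as the loop value is invertible. -/
theorem capCupAt_comp {a b : ℕ} (d : Diagram (a + 2 + b) n)
    (h : d.rel (Sum.inl (Fin.castAdd b (Fin.natAdd a 0)))
      (Sum.inl (Fin.castAdd b (Fin.natAdd a 1)))) :
    loops (capCupAt a b) d = 1 ∧ comp (capCupAt a b) d = d := by
  have key : relMat (capCupAt a b).rel * relMat d.rel = 2 ^ 1 • relMat d.rel := by
    classical
    ext x z
    obtain ⟨⟨x, y⟩, rfl⟩ := (Fin.appendEquiv (a + 2) b).surjective x
    obtain ⟨⟨x, s⟩, rfl⟩ := (Fin.appendEquiv a 2).surjective x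
    change (relMat (capCupAt a b).rel * relMat d.rel) (Fin.append (Fin.append x s) y) z =
      2 ^ 1 * relMat d.rel (Fin.append (Fin.append x s) y) z
    rw [Matrix.mul_apply]
    simp only [sum_append (a := a + 2) (b := b), sum_append (a := a) (b := 2), relMat_capCupAt,
      ite_and]
    by_cases hs : s 0 = s 1
    · have e : ∀ s' : Fin 2 → Bool, (if s' 0 = s' 1 then
          relMat d.rel (Fin.append (Fin.append x s') y) z else 0) =
          if s' 0 = s' 1 then relMat d.rel (Fin.append (Fin.append x s) y) z else 0 := by
        intro s'
        split_ifs with hs'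
        · rw [relMat_congr_of_rel d h x y s s' hs hs' z]
        · rfl
      -- The two labels of the arc in the middle layer give the factor `2 ^ 1`, that is, one loop.
      have hcard : (Finset.univ.filter fun s' : Fin 2 → Bool => s' 0 = s' 1).card = 2 ^ 1 := by
        decide
      simp only [hs, if_true, ite_mul, one_mul, zero_mul, Finset.sum_ite_irrel,
        Finset.sum_const_zero, Finset.sum_ite_eq, Finset.mem_univ, e]
      rw [← Finset.sum_filter, Finset.sum_const, hcard, smul_eq_mul]
    · rw [relMat_eq_zero_of_rel d h x y s hs z]
      simp [hs]
  rw [relMat_comp] at key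
  exact ⟨(relMat_smul_cancel key).1, Diagram.ext (relMat_smul_cancel key).2⟩

end Diagram
end TemperleyLieb

namespace TemperleyLieb
variable {k m n p : ℕ}

/-! ### Jones-Wenzl projections below a diagram -/

/-- A cap-cup above a Jones-Wenzl projection vanishes. -/
theorem jw_capCup (a b : ℕ) (h : a + 2 + b ≤ k + 1) :
    lcomp (delta k) (jw k (a + 2 + b)) (ltensor (ltensor (lid a) capCup) (lid b)) = 0 := by
  induction b with
  | zero =>
    rw [ltensor_zero]
    obtain ⟨h1, h2, h3, h4⟩ := jw_aux (k := k) a (by omega)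
    have hq1 := qint_ne_zero k (a + 1) (by omega) (by omega)
    have hq2 := qint_ne_zero k (a + 2) (by omega) (by omega)
    have hgh : lcomp (delta k) (ltensor (jw k (a + 1)) (lid 1)) (ltensor (jw k a) (lid 2)) =
        ltensor (jw k (a + 1)) (lid 1) := by
      have hh' : ltensor (jw k a) (lid 2) = ltensor (ltensor (jw k a) (lid 1)) (lid 1) :=
        ltensor_lid_succ _ 1
      rw [hh']
      refine (ltensor_lcomp (delta k) (jw k (a + 1)) (lid 1) (ltensor (jw k a) (lid 1))
        (lid 1)).trans ?_
      rw [h2, lid_lcomp]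
    have hf : jw k (a + 2) = ltensor (jw k (a + 1)) (lid 1) + (qint k (a + 1) / qint k (a + 2)) •
      lcomp (delta k) (lcomp (delta k) (ltensor (jw k (a + 1)) (lid 1)) (ltensor (lid a) capCup))
        (ltensor (jw k (a + 1)) (lid 1)) := rfl
    change lcomp (delta k) (jw k (a + 2)) (ltensor (lid a) capCup) = 0
    -- The relation `h4` contracts the cap-cup, the projection and the cap-cup to `-[a+2]/[a+1]`
    -- times a single cap-cup. Its coefficient cancels `[a+1]/[a+2]` up to sign, so the two terms of
    -- the recursion cancel.
    rw [hf, map_add, map_smul, LinearMap.add_apply, LinearMap.smul_apply, lcomp_assoc, lcomp_assoc,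
      ← lcomp_assoc _ (ltensor (lid a) capCup), h4, map_smul]
    have e : lcomp (delta k) (ltensor (jw k (a + 1)) (lid 1)) (lcomp (delta k)
      (ltensor (jw k a) (lid 2)) (ltensor (lid a) capCup)) =
      lcomp (delta k) (ltensor (jw k (a + 1)) (lid 1)) (ltensor (lid a) capCup) :=
      (lcomp_assoc _ _ _ _).symm.trans (congrArg (fun x => lcomp (delta k) x _) hgh)
    refine (congrArg (fun x => _ + _ • _ • x) e).trans ?_
    rw [smul_smul]
    have : qint k (a + 1) / qint k (a + 2) * -(qint k (a + 2) / qint k (a + 1)) = -1 := by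
      field_simp
    rw [this]
    module
  | succ b ih =>
    obtain ⟨h1, h2, h3, h4⟩ := jw_aux (k := k) (a + 2 + b) (by omega)
    have hh' : ltensor (ltensor (lid a) capCup) (lid (b + 1)) =
      ltensor (ltensor (ltensor (lid a) capCup) (lid b)) (lid 1) := ltensor_lid_succ _ b
    change lcomp (delta k) (jw k (a + 2 + b + 1)) _ = 0
    -- A larger projection absorbs a smaller one on its left strands, where the cap-cup is already
    -- killed by induction.
    rw [hh', ← h2]
    refine (lcomp_assoc _ _ _ _).trans ?_
    have e : lcomp (delta k) (ltensor (jw k (a + 2 + b)) (lid 1))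
        (ltensor (ltensor (ltensor (lid a) capCup) (lid b)) (lid 1)) = 0 := by
      rw [ltensor_lcomp, ih (by omega)]; simp
    refine (congrArg _ e).trans (map_zero _)

/-- For `k ≥ 1` the index `2` is within the range `1, …, k + 1` where quantum integers are nonzero.
-/
theorem delta_ne_zero (hk : 1 ≤ k) : delta k ≠ 0 :=
  neg_ne_zero.2 (qint_ne_zero k 2 (by omega) (by omega))

theorem dg_capCupAt (a b : ℕ) :
    dg (Diagram.capCupAt a b) = ltensor (ltensor (lid a) capCup) (lid b) := by
  rw [lid, lid, capCup, ltensor_dg, ltensor_dg, Diagram.capCupAt]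

/-- A Jones-Wenzl projection below a diagram with two adjacent bottom dots on the same line
vanishes. -/
theorem jw_lcomp_of_adjacent (hm : m ≤ k + 1) (d : Diagram m n)
    {i j : Fin m} (hij : (i : ℕ) + 1 = j) (h : d.rel (Sum.inl i) (Sum.inl j)) :
    lcomp (delta k) (jw k m) (dg d) = 0 := by
  -- The strand count is rewritten as `a + 2 + b`, with the joined dots in the middle, to match
  -- `capCupAt`.
  obtain ⟨b, hb⟩ : ∃ b, m = i + 2 + b := ⟨m - (i + 2), by omega⟩
  obtain ⟨a, ha⟩ : ∃ a : ℕ, a = i := ⟨_, rfl⟩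
  rw [← ha] at hb
  subst hb
  have hi : i = Fin.castAdd b (Fin.natAdd a 0) := Fin.ext (by simp [ha])
  have hj : j = Fin.castAdd b (Fin.natAdd a 1) := Fin.ext (by simp [ha, ← hij])
  rw [hi, hj] at h
  obtain ⟨h1, h2⟩ := Diagram.capCupAt_comp d h
  have e : lcomp (delta k) (dg (Diagram.capCupAt a b)) (dg d) = delta k • dg d := by
    rw [lcomp_dg, h1, h2, pow_one]
  -- The bound `a + 2 + b ≤ k + 1` already forces `1 ≤ k`, so `d` is `δ⁻¹` times the cap-cup stacked
  -- below `d`.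
  have hδ : delta k ≠ 0 := delta_ne_zero (by omega)
  rw [← inv_smul_smul₀ hδ (dg d), ← e, map_smul, ← lcomp_assoc, dg_capCupAt, jw_capCup a b hm,
    map_zero, LinearMap.zero_apply, smul_zero]

/-- There are no nonzero morphisms from a Jones-Wenzl projection to fewer strands. -/
theorem jw_lcomp_of_lt (hm : m ≤ k + 1) (hn : n < m) (f : LinHom m n) :
    lcomp (delta k) (jw k m) f = 0 := by
  induction f using lin_induction with
  | h0 => simp
  | hadd f g h1 h2 => rw [map_add, h1, h2, add_zero]
  | hs c d =>
    rcases d.eq_id_or_exists_adjacent hn.le with ⟨h, -⟩ | ⟨i, j, hij, h⟩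
    · omega
    · rw [map_smul, jw_lcomp_of_adjacent hm d hij h, smul_zero]

/-! ### The Markov trace -/

/-- The Markov trace: the closure of a diagram, with every loop replaced by a scalar. -/
noncomputable def ltrace (δ : ℂ) : LinHom n n →ₗ[ℂ] ℂ :=
  Finsupp.linearCombination ℂ fun f => δ ^ Diagram.closureLoops f

theorem ltrace_dg (δ : ℂ) (f : Diagram n n) : ltrace δ (dg f) = δ ^ Diagram.closureLoops f := by
  simp [ltrace, dg]

theorem ltrace_lcomp_dg (δ : ℂ) (f : Diagram m n) (g : Diagram n m) :
    ltrace δ (lcomp δ (dg f) (dg g)) = δ ^ (Diagram.loops f g + Diagram.closureLoops (f.comp g)) := by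
  rw [lcomp_dg, map_smul, ltrace_dg, smul_eq_mul, pow_add]

/-- By bilinearity this reduces to diagrams, where the two total loop counts agree. -/
theorem ltrace_lcomp_comm (δ : ℂ) (f : LinHom m n) (g : LinHom n m) :
    ltrace δ (lcomp δ f g) = ltrace δ (lcomp δ g f) := by
  induction f using lin_induction with
  | h0 => simp
  | hadd f f' h1 h2 => simp only [map_add, LinearMap.add_apply, h1, h2]
  | hs c f =>
    induction g using lin_induction with
    | h0 => simp
    | hadd f f' h1 h2 => simp only [map_add, LinearMap.add_apply, h1, h2]
    | hs d g =>
      simp only [map_smul, LinearMap.smul_apply, ltrace_lcomp_dg,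
        Diagram.closureLoops_comp_comm f g]
      rw [smul_comm]

/-- The hypothesis describes the partial trace of `g` at loop value `2`, as `2 ^ e` times a diagram
`d`. The conclusion carries the same `e` and `d` over to an arbitrary loop value. -/
theorem ltrace_ltensor_lid_dg (δ : ℂ) (f : LinHom m n) (g : Diagram (n + 1) (m + 1)) (e : ℕ)
    (d : Diagram n m) (h : ∀ x y, ∑ t : Fin 1 → Bool, Diagram.relMat g.rel (Fin.append x t)
      (Fin.append y t) = 2 ^ e * Diagram.relMat d.rel x y) :
    ltrace δ (lcomp δ (ltensor f (lid 1)) (dg g)) = δ ^ e * ltrace δ (lcomp δ f (dg d)) := by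
  induction f using lin_induction with
  | h0 => simp
  | hadd f f' h1 h2 => simp only [map_add, LinearMap.add_apply, h1, h2, mul_add]
  | hs c f =>
    simp only [map_smul, LinearMap.smul_apply, smul_eq_mul, lid, ltensor_dg, ltrace_lcomp_dg]
    rw [mul_left_comm, ← pow_add]
    congr 2
    -- For a single diagram `f` both sides are powers of `δ`. Their exponents are compared as
    -- exponents of `2`, where both powers are matrix traces.
    apply Nat.pow_right_injective le_rfl
    simp only
    rw [← Diagram.trace_relMat_mul, pow_add, ← Diagram.trace_relMat_mul,
      Diagram.trace_tensor_id_mul]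
    simp only [h, Matrix.trace, Matrix.diag, Matrix.mul_apply, Finset.mul_sum]
    exact Finset.sum_congr rfl fun x _ => Finset.sum_congr rfl fun y _ => mul_left_comm _ _ _

theorem ltrace_lid_ltensor_dg (δ : ℂ) (f : LinHom m n) (g : Diagram (1 + n) (1 + m)) (e : ℕ)
    (d : Diagram n m) (h : ∀ x y, ∑ t : Fin 1 → Bool, Diagram.relMat g.rel (Fin.append t x)
      (Fin.append t y) = 2 ^ e * Diagram.relMat d.rel x y) :
    ltrace δ (lcomp δ (ltensor (lid 1) f) (dg g)) = δ ^ e * ltrace δ (lcomp δ f (dg d)) := by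
  induction f using lin_induction with
  | h0 => simp
  | hadd f f' h1 h2 => simp only [map_add, LinearMap.add_apply, h1, h2, mul_add]
  | hs c f =>
    simp only [map_smul, LinearMap.smul_apply, smul_eq_mul, lid, ltensor_dg, ltrace_lcomp_dg]
    rw [mul_left_comm, ← pow_add]
    congr 2
    apply Nat.pow_right_injective le_rfl
    simp only
    rw [← Diagram.trace_relMat_mul, pow_add, ← Diagram.trace_relMat_mul,
      Diagram.trace_id_tensor_mul]
    simp only [h, Matrix.trace, Matrix.diag, Matrix.mul_apply, Finset.mul_sum]
    exact Finset.sum_congr rfl fun x _ => Finset.sum_congr rfl fun y _ => mul_left_comm _ _ _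

/-- Closing the last strand of an identity diagram gives one loop and leaves an identity, hence the
exponent `1`. -/
theorem ltrace_ltensor_lid (δ : ℂ) (f : LinHom n n) :
    ltrace δ (ltensor f (lid 1)) = δ * ltrace δ f := by
  have h := ltrace_ltensor_lid_dg δ f (Diagram.id (n + 1)) 1 (Diagram.id n) (by
    intro x y
    have e : ∀ t : Fin 1 → Bool, (Fin.append x t = Fin.append y t) ↔ x = y := fun t => by
      have := (Fin.appendEquiv n 1).injective.eq_iff (a := (x, t)) (b := (y, t))
      rw [Prod.mk.injEq] at this
      exact this.trans (and_iff_left rfl)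
    simp only [Diagram.relMat_id, Matrix.one_apply, e]
    simp)
  rw [← lid, ← lid, lcomp_lid, lcomp_lid, pow_one] at h
  exact h

/-- Closing the last strand of the cap-cup straightens it without creating a loop, hence the
exponent `0`. -/
theorem ltrace_ltensor_lid_capCup (δ : ℂ) (f : LinHom (n + 1) (n + 1)) :
    ltrace δ (lcomp δ (ltensor f (lid 1)) (ltensor (lid n) capCup)) = ltrace δ f := by
  have h := ltrace_ltensor_lid_dg δ f
    (Diagram.tensor (m₁ := n) (n₁ := n) (m₂ := 2) (n₂ := 2) (Diagram.id n)
      (Diagram.comp Diagram.cap Diagram.cup)) 0 (Diagram.id (n + 1))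
    (fun x y => by rw [pow_zero, one_mul]; exact Diagram.partialTrace_id_capCup x y)
  rw [← lid, lcomp_lid, pow_zero, one_mul] at h
  rw [capCup, lid, lid, ltensor_dg (Diagram.id n)]
  exact h

theorem ltrace_lid_one (δ : ℂ) : ltrace δ (lid 1) = δ := by
  have h : Diagram.closureLoops (Diagram.id 1) = 1 := by
    apply Nat.pow_right_injective le_rfl
    simp only
    rw [← Diagram.trace_relMat, Diagram.relMat_id, Matrix.trace_one]
    simp
  rw [lid, ltrace_dg, h, pow_one]

/-- Taking traces in the defining recursion multiplies the trace by `-[2] + [n+1]/[n+2] =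
-[n+3]/[n+2]` at each step, so the product telescopes. The case `n = k` is the one that matters:
there the quantum integer is `[k+2]`. -/
theorem ltrace_jw (hn : n ≤ k) : ltrace (delta k) (jw k (n + 1)) = (-1) ^ (n + 1) * qint k (n + 2) := by
  induction n with
  | zero =>
    refine (ltrace_lid_one (delta k)).trans ?_
    rw [delta]; ring
  | succ n ih =>
    have hgg : lcomp (delta k) (ltensor (jw k (n + 1)) (lid 1)) (ltensor (jw k (n + 1)) (lid 1)) =
        ltensor (jw k (n + 1)) (lid 1) := by
      rw [ltensor_lcomp, jw_idem (by omega), lid_lcomp]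
    have hf : jw k (n + 2) = ltensor (jw k (n + 1)) (lid 1) + (qint k (n + 1) / qint k (n + 2)) •
      lcomp (delta k) (lcomp (delta k) (ltensor (jw k (n + 1)) (lid 1)) (ltensor (lid n) capCup))
        (ltensor (jw k (n + 1)) (lid 1)) := rfl
    have e : ltrace (delta k) (lcomp (delta k) (lcomp (delta k) (ltensor (jw k (n + 1)) (lid 1))
        (ltensor (lid n) capCup)) (ltensor (jw k (n + 1)) (lid 1))) =
        ltrace (delta k) (jw k (n + 1)) := by
      -- Cyclicity brings the two outer copies of the smaller projection together, and idempotence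
      -- merges them.
      refine (ltrace_lcomp_comm _ _ _).trans ?_
      refine (congrArg (ltrace (delta k)) (lcomp_assoc _ _ _ _).symm).trans ?_
      refine (congrArg (fun x => ltrace (delta k) (lcomp (delta k) x _)) hgg).trans ?_
      exact ltrace_ltensor_lid_capCup _ _
    have hq := qint_ne_zero k (n + 2) (by omega) (by omega)
    rw [hf, map_add, map_smul]
    refine (congrArg₂ (fun x y => x + (qint k (n + 1) / qint k (n + 2)) • y)
      (ltrace_ltensor_lid _ _) e).trans ?_
    rw [ih (by omega), delta, smul_eq_mul]
    have hr := qint_rec k (n + 1)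
    field_simp
    linear_combination (-1) ^ (n + 2) * hr

/-- The choice of `q` gives `q ^ (k + 2) = -1`, which is its own inverse. -/
theorem qint_top (k : ℕ) : qint k (k + 2) = 0 := by
  have hk : ((k : ℂ) + 2) ≠ 0 := by
    have : ((k + 2 : ℕ) : ℂ) ≠ 0 := Nat.cast_ne_zero.2 (by omega)
    simpa using this
  have h : qq k ^ (k + 2) = -1 := by
    rw [qq, ← Complex.exp_nat_mul, ← Complex.exp_pi_mul_I]
    congr 1
    push_cast
    field_simp
  rw [qint, h]
  norm_num

/-! ### Negligible morphisms -/

/-- A morphism is negligible if its composite with every morphism in the opposite direction has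
trace zero. -/
def Negligible (δ : ℂ) (f : LinHom m n) : Prop := ∀ g : LinHom n m, ltrace δ (lcomp δ f g) = 0

namespace Negligible
variable {δ : ℂ}

theorem of_diagrams {f : LinHom m n} (h : ∀ d : Diagram n m, ltrace δ (lcomp δ f (dg d)) = 0) :
    Negligible δ f := by
  intro g
  induction g using lin_induction with
  | h0 => simp
  | hadd g g' h1 h2 => rw [map_add, map_add, h1, h2, add_zero]
  | hs c d => rw [map_smul, map_smul, h, smul_zero]

theorem zero : Negligible δ (0 : LinHom m n) := fun g => by simp

theorem add {f g : LinHom m n} (hf : Negligible δ f) (hg : Negligible δ g) :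
    Negligible δ (f + g) := fun h => by
  rw [map_add, LinearMap.add_apply, map_add, hf, hg, add_zero]

theorem sum {ι : Type*} (s : Finset ι) {f : ι → LinHom m n} (hf : ∀ i, Negligible δ (f i)) :
    Negligible δ (∑ i ∈ s, f i) :=
  Finset.sum_induction f (Negligible δ) (fun _ _ => add) zero fun i _ => hf i

theorem lcomp_right {f : LinHom m n} (hf : Negligible δ f) (g : LinHom n p) :
    Negligible δ (lcomp δ f g) := fun h => by
  rw [lcomp_assoc]; exact hf _

/-- Cyclicity moves the left factor to the other side, where it becomes part of the test morphism.
-/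
theorem lcomp_left (f : LinHom m n) {g : LinHom n p} (hg : Negligible δ g) :
    Negligible δ (lcomp δ f g) := fun h => by
  rw [lcomp_assoc, ltrace_lcomp_comm, lcomp_assoc]; exact hg _

theorem of_lcast {m' n' : ℕ} {hm : m = m'} {hn : n = n'} {f : LinHom m n}
    (h : Negligible δ (lcast hm hn f)) : Negligible δ f := by
  subst hm hn; exact h

/-- Testing `f ⊗ 1` against a diagram amounts, up to a power of `δ`, to testing `f` against the
partial trace of that diagram. -/
theorem ltensor_lid {f : LinHom m n} (hf : Negligible δ f) (b : ℕ) :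
    Negligible δ (ltensor f (lid b)) := by
  induction b with
  | zero => rw [ltensor_zero]; exact hf
  | succ b ih =>
    rw [ltensor_lid_succ]
    refine of_diagrams fun g => ?_
    obtain ⟨e, d, h⟩ := Diagram.exists_partialTrace_right g
    exact (ltrace_ltensor_lid_dg δ _ g e d h).trans (by rw [ih, mul_zero])

theorem lid_ltensor {f : LinHom m n} (hf : Negligible δ f) (a : ℕ) :
    Negligible δ (ltensor (lid a) f) := by
  -- The new strand is placed next to `f`, so the induction hypothesis is applied to `1 ⊗ f`, which
  -- has other numbers of dots.
  induction a generalizing m n with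
  | zero =>
    apply of_lcast (hm := Nat.zero_add _) (hn := Nat.zero_add _)
    rw [zero_ltensor]; exact hf
  | succ a ih =>
    have h1 : Negligible δ (ltensor (lid 1) f) := by
      refine of_diagrams fun g => ?_
      obtain ⟨e, d, h⟩ := Diagram.exists_partialTrace_left g
      rw [ltrace_lid_ltensor_dg δ _ g e d h, hf, mul_zero]
    rw [← TemperleyLieb.ltensor_lid]
    apply of_lcast (hm := Nat.add_assoc _ _ _) (hn := Nat.add_assoc _ _ _)
    rw [ltensor_assoc]
    exact ih h1

/-- By the interchange law `f ⊗ g` is `f ⊗ 1` followed by `1 ⊗ g`, so tensoring with identities and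
composing suffice. -/
theorem ltensor_right {m' n' : ℕ} {f : LinHom m n} (hf : Negligible δ f) (g : LinHom m' n') :
    Negligible δ (ltensor f g) := by
  have e := ltensor_lcomp δ f (lid m') (lid n) g
  rw [lid_lcomp, lcomp_lid] at e
  rw [← e]
  exact (hf.ltensor_lid m').lcomp_right _

theorem ltensor_left {m' n' : ℕ} (g : LinHom m' n') {f : LinHom m n} (hf : Negligible δ f) :
    Negligible δ (ltensor g f) := by
  have e := ltensor_lcomp δ (lid m') f g (lid n)
  rw [lid_lcomp, lcomp_lid] at e
  rw [← e]
  exact (hf.lid_ltensor m').lcomp_right _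

end Negligible

/-- Among the diagrams `k+1 → k+1` only the identity is not annihilated by the projection, and
against the identity its trace is a multiple of `[k+2] = 0`. -/
theorem negligible_jw (k : ℕ) : Negligible (delta k) (jw k (k + 1)) := by
  refine Negligible.of_diagrams fun d => ?_
  rcases d.eq_id_or_exists_adjacent le_rfl with ⟨h, hd⟩ | ⟨i, j, hij, h⟩
  · have hd' : d = Diagram.id (k + 1) := hd
    rw [hd', ← lid, lcomp_lid, ltrace_jw le_rfl, qint_top, mul_zero]
  · rw [jw_lcomp_of_adjacent le_rfl d hij h, map_zero]

/-- The test morphism is the identity itself, with trace `δ`. -/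
theorem not_negligible_lid_one (hk : 1 ≤ k) : ¬ Negligible (delta k) (lid 1) := fun h => by
  have h1 := h (lid 1)
  rw [lcomp_lid, ltrace_lid_one] at h1
  exact delta_ne_zero hk h1

end TemperleyLieb

namespace TemperleyLieb
open MatMonoidal KaroubiMonoidal
variable {k : ℕ}

/-! ### The reduced Temperley-Lieb category -/

/-- The entries of a morphism in the ideal generated by `Fₖ₊₁` are negligible. -/
theorem negligible_of_ideal {X Y : TL k} {f : X ⟶ Y} (h : TensorQuotient.Ideal (IsIdTop k) f) :
    ∀ a b, Negligible (delta k) (ent f.f a b) := by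
  induction h with
  | of f hf =>
    -- The only generator is the identity of `F_{k+1}`, whose single matrix entry is the projection
    -- itself.
    cases hf
    exact fun _ _ => negligible_jw k
  | zero X Y => exact fun _ _ => Negligible.zero
  | add f g _ _ hf hg => exact fun a b => (hf a b).add (hg a b)
  | precomp f g _ hg =>
    exact fun a b => Negligible.sum _ fun j => Negligible.lcomp_left _ (hg j b)
  | postcomp f g _ hf =>
    exact fun a b => Negligible.sum _ fun j => (hf a j).lcomp_right _
  | whiskerLeft X f _ hf => exact fun a b => Negligible.ltensor_left _ (hf a.2 b.2)
  | whiskerRight f Z _ hf => exact fun a b => (hf a.1 b.1).ltensor_right _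

/-- A morphism out of `F_i` is unchanged by precomposition with its idempotent `f_i`, and `f_i`
kills everything going to zero strands. -/
theorem hom_F_unit_eq_zero {i : ℕ} (hi : i ≤ k + 1) (h0 : 0 < i) (f : F k i hi ⟶ 𝟙_ (TL k)) :
    f = 0 := by
  apply Idempotents.Karoubi.hom_ext
  have h := Idempotents.Karoubi.p_comp f
  rw [← h]
  apply ent_ext
  rintro ⟨⟩ ⟨⟩
  refine (ent_comp_single _ _ _ _ () (fun _ => rfl)).trans ?_
  exact jw_lcomp_of_lt hi h0 _

/-- If `F_1` became zero, its identity would lie in the ideal. The single entry of that identity is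
`f_1`, the plain strand, which is not negligible. -/
theorem id_Fred_one_ne_zero (hk : 1 ≤ k) : 𝟙 (Fred k ⟨1, by omega⟩) ≠ 0 := by
  intro h
  have h1 : (reduce k).map (𝟙 (F k 1 (by omega))) = (reduce k).map 0 := by
    rw [CategoryTheory.Functor.map_id, CategoryTheory.Functor.map_zero]; exact h
  rw [TensorQuotient.proj_eq, sub_zero] at h1
  exact not_negligible_lid_one hk (negligible_of_ideal h1 () ())

/-! ### The Frobenius map on summands of positive degree -/

/-- The quotient functor is full, so the component lifts to a morphism `F_i → 𝟙` before passing to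
the quotient, and that lift is zero. -/
theorem ι_comp_eq_zero (n : Sig k ⟶ 𝟙_ (TLred k)) (i : Fin (k + 1)) (hi : 0 < (i : ℕ)) :
    biproduct.ι (Fred k) i ≫ n = 0 := by
  obtain ⟨g, hg⟩ := TensorQuotient.exists_rep (IsIdTop k) (X := F k i (by omega)) (Y := 𝟙_ (TL k))
    (biproduct.ι (Fred k) i ≫ n)
  rw [← hg, hom_F_unit_eq_zero _ hi g]
  exact CategoryTheory.Functor.map_zero _ _ _

/-- The elements of positive degree form an ideal of the graded algebra on which `n` vanishes, so
the form given by multiplication followed by `n` has them in its kernel. The argument works for any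
choice of dual. -/
theorem ι_frobeniusMap_eq_zero (Ad : TLred k) [ExactPairing (Sig k) Ad] (n : Sig k ⟶ 𝟙_ (TLred k))
    (i : Fin (k + 1)) (hi : 0 < (i : ℕ)) :
    biproduct.ι (Fred k) i ≫ frobeniusMap (Sig k) Ad n = 0 := by
  -- The pairing is tested on each summand `F_j` of the second factor. The product lands in degree
  -- `i + j ≥ i > 0`, or is zero when `i + j > k`.
  have h : biproduct.ι (Fred k) i ▷ Sig k ≫ MonObj.mul ≫ n = 0 := by
    apply ext_right
    intro j
    rw [← Category.assoc, ← MonoidalCategory.tensorHom_def', ← Category.assoc, comp_zero]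
    refine (congrArg (· ≫ n) (ι_gradedMul _ i j)).trans ?_
    split_ifs with hij
    · rw [Category.assoc, ι_comp_eq_zero n _ (by simp only; omega), comp_zero]
    · rw [zero_comp]
  -- The inclusion slides past the coevaluation to the first factor of the multiplication, where `h`
  -- applies.
  rw [frobeniusMap, rightUnitor_inv_naturality_assoc, ← whisker_exchange_assoc,
    associator_inv_naturality_left_assoc, ← comp_whiskerRight, h,
    MonoidalPreadditive.zero_whiskerRight]
  simp only [comp_zero]

end TemperleyLieb

/-! ### The theorem -/

theorem lemma3p10 (k : ℕ) (hk : 1 ≤ k) :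
    (¬ AdmitsClassicalFrobeniusStructure (Sig k)) ∧
      ∀ (n : Sig k ⟶ 𝟙_ (TLred k)) (i : Fin (k + 1)), 0 < (i : ℕ) →
        biproduct.ι (Fred k) i ≫ n = 0 := by
  refine ⟨?_, ι_comp_eq_zero⟩
  rintro ⟨n, Ad, hAd, hiso⟩
  -- The index `1` is available because `1 ≤ k`.
  have h := ι_frobeniusMap_eq_zero Ad n ⟨1, by omega⟩ Nat.one_pos
  -- Only the injectivity of the Frobenius map, as a monomorphism, is used.
  have h0 : biproduct.ι (Fred k) ⟨1, by omega⟩ = 0 := by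
    rw [← cancel_mono (frobeniusMap (Sig k) Ad n), h, zero_comp]
  apply id_Fred_one_ne_zero hk
  rw [← biproduct.ι_π_self, h0, zero_comp]
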